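/- A finite-dimensional Hamiltonian $H$ is a Hermitian operator on $\mathbb C^d$, $d\ge 1$. For $e\in\mathbb R$ let $[e]_H$ be the set of density matrices $\rho$ on $\mathbb C^d$ with $\mathrm{Tr}(\rho H)=e$. For $\beta\in\mathbb R$ let $e_\beta(H)=\mathrm{Tr}(e^{-\beta H}H)/\mathrm{Tr}(e^{-\beta H})$, and let $e_{+\infty}(H)$ and $e_{-\infty}(H)$ be the smallest and the largest eigenvalue of $H$ (the limits $\beta\to\pm\infty$). Let $f$ assign to every finite-dimensional Hamiltonian $K$ a mean energy $f(K)$ such that $[f(K)]_K\neq\emptyset$. An environment is a finite family of systems with Hamiltonians $H_{E^1},\dots,H_{E^N}$ (of arbitrary finite dimensions, $N$ arbitrary) with total Hamiltonian $H_E=\sum_i H_{E^i}$; its compatible microstates are the states $\sigma=\sigma_1\otimes\cdots\otimes\sigma_N$ with $\sigma_i\in[f(H_{E^i})]_{H_{E^i}}$ for all $i$. * We say that work $W$ can be extracted from the environment if there are an environment and a unitary $U$ on it such that $\mathrm{Tr}(\sigma H_E)-\mathrm{Tr}(U\sigma U^\dagger H_E)\ge W$ for all compatible microstates $\sigma$.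 * For a macrostate $(e,H)$ and a density matrix $\rho_f$ on the same space we write $(e,H)\to\rho_f$ (reachable by macrostate operations) if for all $\epsilon,\epsilon'>0$ there are an environment and a unitary $U$ on system and environment such that for all $\rho\in[e]_H$ and all compatible microstates $\sigma$ of the environment $$\big\|\mathrm{Tr}_E\big(U(\rho\otimes\sigma)U^\dagger\big)-\rho_f\big\|_1\le\epsilon,\qquad \big|\mathrm{Tr}\big(U(\rho\otimes\sigma)U^\dagger H_{SE}\big)-\mathrm{Tr}\big((\rho\otimes\sigma)H_{SE}\big)\big|\le\epsilon',$$ where $H_{SE}=H\otimes 1+1\otimes H_E$. Then the thermal assignments are the only non-trivial ones: 1. If there is no fixed $\beta\in[-\infty,+\infty]$ with $f(H)=e_\beta(H)$ for all $H$, then (i) every amount of work $W\in\mathbb R$ can be extracted from the environment, and (ii) every transition is possible: $(e,H)\to\rho$ for all $H$, all $e\in\mathbb R$ and all density matrices $\rho$. 2. Conversely, if $f(H)=e_\beta(H)$ for all $H$, with a fixed $\beta\in[-\infty,+\infty]$, then not every transition is possible, and if $\beta\ge 0$, then no work $W>0$ can be extracted from the environment. -/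

import Mathlib

open scoped Matrix Kronecker ComplexOrder

noncomputable section

namespace Thermo

/-- A finite-dimensional quantum system with a Hamiltonian: a Hermitian operator on `ℂ^dim`,
with `0 < dim`. -/
structure Hamiltonian where
  dim : ℕ
  dim_pos : 0 < dim
  op : Matrix (Fin dim) (Fin dim) ℂ
  isHermitian : op.IsHermitian

/-- Density matrices. -/
def IsDensity {ι : Type*} [Fintype ι] (ρ : Matrix ι ι ℂ) : Prop :=
  ρ.PosSemidef ∧ ρ.trace = 1

/-- The mean energy `Tr(ρ H)`. -/
def meanEnergy {ι : Type*} [Fintype ι] (ρ H : Matrix ι ι ℂ) : ℝ :=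
  (ρ * H).trace.re

/-- The trace norm `‖A‖₁ = Tr √(A† A)`, the sum of the singular values of `A`. -/
def traceNorm {ι : Type*} [Fintype ι] [DecidableEq ι] (A : Matrix ι ι ℂ) : ℝ :=
  ∑ i, Real.sqrt ((Matrix.isHermitian_conjTranspose_mul_self A).eigenvalues i)

/-- The equivalence class `[e]_H` of microstates compatible with the macrostate `(e, H)`. -/
def microstates (e : ℝ) (H : Hamiltonian) : Set (Matrix (Fin H.dim) (Fin H.dim) ℂ) :=
  {ρ | IsDensity ρ ∧ meanEnergy ρ H.op = e}

/-- The canonical ensemble `exp(-βH) / Tr exp(-βH)`. -/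
def gibbsState (β : ℝ) (H : Hamiltonian) : Matrix (Fin H.dim) (Fin H.dim) ℂ :=
  (NormedSpace.exp (-(β : ℂ) • H.op)).trace⁻¹ • NormedSpace.exp (-(β : ℂ) • H.op)

/-- The smallest eigenvalue of `H`. -/
def groundEnergy (H : Hamiltonian) : ℝ := ⨅ i, H.isHermitian.eigenvalues i

/-- The largest eigenvalue of `H`. -/
def topEnergy (H : Hamiltonian) : ℝ := ⨆ i, H.isHermitian.eigenvalues i

/-- The thermal energy `e_β(H) = Tr(γ_β(H) H)` for `β ∈ ℝ`, extended to `β = ±∞` by its limits: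
the smallest eigenvalue at `β = +∞` and the largest one at `β = -∞`. -/
def thermalEnergy (β : EReal) (H : Hamiltonian) : ℝ :=
  if β = ⊤ then groundEnergy H
  else if β = ⊥ then topEnergy H
  else meanEnergy (gibbsState β.toReal H) H.op

/-- Index set of the product basis of an environment made of the systems `E 0, …, E (N-1)`. -/
abbrev EnvIdx {N : ℕ} (E : Fin N → Hamiltonian) : Type := ∀ i, Fin (E i).dim

/-- The tensor product `A₀ ⊗ ⋯ ⊗ A_{N-1}`. -/
def tensor {N : ℕ} {E : Fin N → Hamiltonian}
    (A : ∀ i, Matrix (Fin (E i).dim) (Fin (E i).dim) ℂ) :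
    Matrix (EnvIdx E) (EnvIdx E) ℂ :=
  Matrix.of fun x y => ∏ i, A i (x i) (y i)

/-- The non-interacting environment Hamiltonian `∑ᵢ 1 ⊗ ⋯ ⊗ Hᵢ ⊗ ⋯ ⊗ 1`. -/
def envHamiltonian {N : ℕ} (E : Fin N → Hamiltonian) : Matrix (EnvIdx E) (EnvIdx E) ℂ :=
  ∑ i, tensor (Function.update
    (fun j => (1 : Matrix (Fin (E j).dim) (Fin (E j).dim) ℂ)) i (E i).op)

/-- The Hamiltonian `H_S ⊗ 1 + 1 ⊗ H_E` of the compound of system and environment. -/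
def totalHamiltonian (S : Hamiltonian) {N : ℕ} (E : Fin N → Hamiltonian) :
    Matrix (Fin S.dim × EnvIdx E) (Fin S.dim × EnvIdx E) ℂ :=
  S.op ⊗ₖ (1 : Matrix (EnvIdx E) (EnvIdx E) ℂ) +
    (1 : Matrix (Fin S.dim) (Fin S.dim) ℂ) ⊗ₖ envHamiltonian E

/-- The partial trace over the second tensor factor. -/
def traceEnv {ι κ : Type*} [Fintype κ] (M : Matrix (ι × κ) (ι × κ) ℂ) : Matrix ι ι ℂ :=
  Matrix.of fun a b => ∑ x, M (a, x) (b, x)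

/-- `(e, H) → ρf` by macrostate operations, when an environment system with Hamiltonian `K` is
assigned the macrostate `(f K, K)`. The same environment and the same unitary have to work for all
microstates of the system and of the environment systems that are compatible with the
macrostates. -/
def MacroReachable (f : Hamiltonian → ℝ) (e : ℝ) (H : Hamiltonian)
    (ρf : Matrix (Fin H.dim) (Fin H.dim) ℂ) : Prop :=
  ∀ ε : ℝ, 0 < ε → ∀ ε' : ℝ, 0 < ε' → ∃ (N : ℕ) (E : Fin N → Hamiltonian),
    ∃ U ∈ Matrix.unitaryGroup (Fin H.dim × EnvIdx E) ℂ,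
      ∀ ρ ∈ microstates e H, ∀ σ : ∀ i, Matrix (Fin (E i).dim) (Fin (E i).dim) ℂ,
        (∀ i, σ i ∈ microstates (f (E i)) (E i)) →
          traceNorm (traceEnv (U * (ρ ⊗ₖ tensor σ) * Uᴴ) - ρf) ≤ ε ∧
          |meanEnergy (U * (ρ ⊗ₖ tensor σ) * Uᴴ) (totalHamiltonian H E) -
            meanEnergy (ρ ⊗ₖ tensor σ) (totalHamiltonian H E)| ≤ ε'

/-- At least the amount `W` of work can be extracted from the environment alone: some unitary on
some environment lowers the mean energy by at least `W`, for all the microstates that are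
compatible with the environment macrostates `(f K, K)`. -/
def WorkExtractable (f : Hamiltonian → ℝ) (W : ℝ) : Prop :=
  ∃ (N : ℕ) (E : Fin N → Hamiltonian), ∃ U ∈ Matrix.unitaryGroup (EnvIdx E) ℂ,
    ∀ σ : ∀ i, Matrix (Fin (E i).dim) (Fin (E i).dim) ℂ,
      (∀ i, σ i ∈ microstates (f (E i)) (E i)) →
        W ≤ meanEnergy (tensor σ) (envHamiltonian E) -
          meanEnergy (U * tensor σ * Uᴴ) (envHamiltonian E)

/-- Macrostate operations are trivial: every transition is possible. -/
def EveryTransitionPossible (f : Hamiltonian → ℝ) : Prop :=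
  ∀ (e : ℝ) (H : Hamiltonian) (ρ : Matrix (Fin H.dim) (Fin H.dim) ℂ),
    IsDensity ρ → MacroReachable f e H ρ

end Thermo

end

set_option linter.unusedSectionVars false

namespace Thermo

/-! ### Spectral decompositions, density matrices and mean energies. -/

section Spectral

variable {ι : Type*} [Fintype ι] [DecidableEq ι]

/-! Thermal assignments are restrictive because of passivity. A product of Gibbs states at one
finite `β` is a Gibbs state of the whole environment, and a unitary acts on its populations by a
doubly stochastic matrix. Averaging `y + 1 ≤ exp y` with that matrix (`gibbs_variational`) bounds
`β` times the energy change, plus the final mean of an arbitrary function `g`, from below. With `g =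
0` this forbids work for `β > 0`; with `g` depending only on the system level it forbids purifying a
maximally mixed qubit at negligible energy cost. At `β = ±∞` the environment already has extremal
energy and cannot give, respectively absorb, energy.

For a non-thermal `f`, some Hamiltonian shares no temperature with the unit qubit
(`exists_no_common_temperature`). Take `N` copies of each. Whatever the compatible microstates are,
the energy of each kind concentrates around its mean (Chernoff), so the environment lives on a
typical set, whose size is at most about `exp (N * (log Z₀(b₀) + b₀ e₀ + log Z₁(b₁) + b₁ e₁))` for
any `b₀, b₁`. At a common `β` with nearly the same total energy there are exponentially more
configurations: minimising the two convex functions `log Z(b) + b e` separately gives strictly less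
than minimising their sum (`exists_entropy_gap`).

Hence the typical set, times any fixed number of labels, injects into configurations of the second
sort. A third kind of system, qubits with a tiny gap, then tunes the energy change to any prescribed
`Δ` (`exists_transition`). The injection yields orthonormal vectors `shiftVec`, hence a unitary that
writes `ρf` into the system and hides the initial system state and the purification of `ρf` in the
environment (`exists_unitary_shift`). It does not depend on the microstates; its error is the square
root of an exponentially small tail times an energy norm of order `N`. For transitions `Δ`
compensates the energy change of the system; for work the system is trivial and `Δ` is negative. -/

lemma eq_eigenvectorUnitary_conj {A : Matrix ι ι ℂ} (hA : A.IsHermitian) :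
    A = (hA.eigenvectorUnitary : Matrix ι ι ℂ) *
      Matrix.diagonal (fun i => (hA.eigenvalues i : ℂ)) *
        (hA.eigenvectorUnitary : Matrix ι ι ℂ)ᴴ := by
  conv_lhs => rw [hA.spectral_theorem, Unitary.conjStarAlgAut_apply]
  rfl

lemma exists_eq_mul_conjTranspose {A : Matrix ι ι ℂ} (hA : A.PosSemidef) :
    ∃ S : Matrix ι ι ℂ, A = S * Sᴴ := by
  refine ⟨(hA.1.eigenvectorUnitary : Matrix ι ι ℂ) *
    Matrix.diagonal (fun i => ((Real.sqrt (hA.1.eigenvalues i) : ℝ) : ℂ)), ?_⟩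
  conv_lhs => rw [eq_eigenvectorUnitary_conj hA.1]
  rw [Matrix.conjTranspose_mul, Matrix.diagonal_conjTranspose, ← mul_assoc, mul_assoc _
    (Matrix.diagonal _) (Matrix.diagonal _), Matrix.diagonal_mul_diagonal]
  congr 3
  ext i
  have : ((Real.sqrt (hA.1.eigenvalues i) * Real.sqrt (hA.1.eigenvalues i) : ℝ) : ℂ) =
      hA.1.eigenvalues i := by
    rw [Real.mul_self_sqrt (hA.eigenvalues_nonneg i)]
  simpa using this.symm

lemma conjTranspose_mul_self_of_unitary {U : Matrix ι ι ℂ} (hU : U ∈ Matrix.unitaryGroup ι ℂ) :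
    Uᴴ * U = 1 := Matrix.mem_unitaryGroup_iff'.1 hU

lemma mul_conjTranspose_self_of_unitary {U : Matrix ι ι ℂ} (hU : U ∈ Matrix.unitaryGroup ι ℂ) :
    U * Uᴴ = 1 := Matrix.mem_unitaryGroup_iff.1 hU

lemma conjTranspose_mem_unitary {U : Matrix ι ι ℂ} (hU : U ∈ Matrix.unitaryGroup ι ℂ) :
    Uᴴ ∈ Matrix.unitaryGroup ι ℂ := by
  rw [Matrix.mem_unitaryGroup_iff, Matrix.star_eq_conjTranspose, Matrix.conjTranspose_conjTranspose]
  exact conjTranspose_mul_self_of_unitary hU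

lemma IsDensity.conj {ρ U : Matrix ι ι ℂ} (hρ : IsDensity ρ) (hU : U ∈ Matrix.unitaryGroup ι ℂ) :
    IsDensity (U * ρ * Uᴴ) := by
  refine ⟨hρ.1.mul_mul_conjTranspose_same U, ?_⟩
  rw [Matrix.trace_mul_comm, ← mul_assoc, conjTranspose_mul_self_of_unitary hU, one_mul, hρ.2]

lemma IsDensity.conj' {ρ U : Matrix ι ι ℂ} (hρ : IsDensity ρ) (hU : U ∈ Matrix.unitaryGroup ι ℂ) :
    IsDensity (Uᴴ * ρ * U) := by
  simpa using hρ.conj (conjTranspose_mem_unitary hU)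

lemma PosSemidef.diag_eq_re {ρ : Matrix ι ι ℂ} (hρ : ρ.PosSemidef) (i : ι) :
    ρ i i = ((ρ i i).re : ℂ) := by
  have h := hρ.diag_nonneg (i := i)
  apply Complex.ext
  · simp
  · simpa using (Complex.nonneg_iff.1 h).2.symm

lemma IsDensity.diag_nonneg {ρ : Matrix ι ι ℂ} (hρ : IsDensity ρ) (i : ι) : 0 ≤ (ρ i i).re :=
  (Complex.nonneg_iff.1 hρ.1.diag_nonneg).1

lemma IsDensity.sum_diag {ρ : Matrix ι ι ℂ} (hρ : IsDensity ρ) : ∑ i, (ρ i i).re = 1 := by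
  have := congrArg Complex.re hρ.2
  simpa [Matrix.trace] using this

/-- In an eigenbasis of `H`, the mean energy is the mean of the eigenvalues. -/
lemma meanEnergy_conj_diagonal (ρ V : Matrix ι ι ℂ) (l : ι → ℝ) :
    meanEnergy ρ (V * Matrix.diagonal (fun i => (l i : ℂ)) * Vᴴ) =
      ∑ i, ((Vᴴ * ρ * V) i i).re * l i := by
  unfold meanEnergy
  rw [← mul_assoc, ← mul_assoc, Matrix.trace_mul_comm, ← mul_assoc, ← mul_assoc]
  simp [Matrix.trace, Matrix.mul_diagonal]

end Spectral

/-! ### Product states, product bases and the environment Hamiltonian. -/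

section Tensor

variable {N : ℕ} {E : Fin N → Hamiltonian}

lemma tensor_mul (A B : ∀ i, Matrix (Fin (E i).dim) (Fin (E i).dim) ℂ) :
    tensor A * tensor B = tensor (fun i => A i * B i) := by
  ext x y
  simp only [tensor, Matrix.mul_apply, Matrix.of_apply, ← Finset.prod_mul_distrib]
  rw [Finset.prod_univ_sum, Fintype.piFinset_univ]

lemma tensor_conjTranspose (A : ∀ i, Matrix (Fin (E i).dim) (Fin (E i).dim) ℂ) :
    (tensor A)ᴴ = tensor (fun i => (A i)ᴴ) := by
  ext x y
  simp [tensor, Matrix.conjTranspose_apply]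

lemma tensor_diagonal (d : ∀ i, Fin (E i).dim → ℂ) :
    tensor (fun i => Matrix.diagonal (d i)) =
      Matrix.diagonal (fun x : EnvIdx E => ∏ i, d i (x i)) := by
  ext x y
  by_cases h : x = y
  · subst h; simp [tensor]
  · obtain ⟨i, hi⟩ := Function.ne_iff.1 h
    rw [Matrix.diagonal_apply_ne _ h]
    exact Finset.prod_eq_zero (Finset.mem_univ i) (Matrix.diagonal_apply_ne _ hi)

lemma tensor_one :
    tensor (fun i => (1 : Matrix (Fin (E i).dim) (Fin (E i).dim) ℂ)) = 1 := by
  simp only [← Matrix.diagonal_one]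
  rw [tensor_diagonal]
  simp

lemma trace_tensor (A : ∀ i, Matrix (Fin (E i).dim) (Fin (E i).dim) ℂ) :
    (tensor A).trace = ∏ i, (A i).trace := by
  simp only [Matrix.trace, Matrix.diag_apply]
  rw [Finset.prod_univ_sum, Fintype.piFinset_univ]
  rfl

lemma tensor_unitary {V : ∀ i, Matrix (Fin (E i).dim) (Fin (E i).dim) ℂ}
    (hV : ∀ i, V i ∈ Matrix.unitaryGroup (Fin (E i).dim) ℂ) :
    tensor V ∈ Matrix.unitaryGroup (EnvIdx E) ℂ := by
  rw [Matrix.mem_unitaryGroup_iff, Matrix.star_eq_conjTranspose, tensor_conjTranspose, tensor_mul,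
    ← tensor_one]
  congr 1
  ext1 i
  exact mul_conjTranspose_self_of_unitary (hV i)

lemma IsDensity.tensor {σ : ∀ i, Matrix (Fin (E i).dim) (Fin (E i).dim) ℂ}
    (hσ : ∀ i, IsDensity (σ i)) : IsDensity (tensor σ) := by
  constructor
  · choose S hS using fun i => exists_eq_mul_conjTranspose (hσ i).1
    have : Thermo.tensor σ = Thermo.tensor S * (Thermo.tensor S)ᴴ := by
      rw [tensor_conjTranspose, tensor_mul]
      congr 1
      ext1 i
      exact hS i
    rw [this]
    exact Matrix.posSemidef_self_mul_conjTranspose _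
  · rw [trace_tensor]
    exact Finset.prod_eq_one fun i _ => (hσ i).2

/-- Product states become independent random variables here: the populations in a product basis
factorise, and positivity makes each factor real, so that the real part passes through the product.
-/
lemma tensor_conj_apply_re {V σ : ∀ i, Matrix (Fin (E i).dim) (Fin (E i).dim) ℂ}
    (hσ : ∀ i, IsDensity (σ i))  (x : EnvIdx E) :
    (((tensor V)ᴴ * tensor σ * tensor V) x x).re = ∏ i, (((V i)ᴴ * σ i * V i) (x i) (x i)).re := by
  rw [tensor_conjTranspose, tensor_mul, tensor_mul]
  have : ∀ i, ((V i)ᴴ * σ i * V i) (x i) (x i) =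
      ((((V i)ᴴ * σ i * V i) (x i) (x i)).re : ℂ) := fun i =>
    PosSemidef.diag_eq_re ((hσ i).1.conjTranspose_mul_mul_same (V i)) (x i)
  simp only [tensor, Matrix.of_apply]
  rw [Finset.prod_congr rfl fun i _ => this i, ← Complex.ofReal_prod, Complex.ofReal_re]

/-- The total Hamiltonian of the environment in the product of the eigenbases. -/
lemma envHamiltonian_eq {V : ∀ i, Matrix (Fin (E i).dim) (Fin (E i).dim) ℂ}
    (hV : ∀ i, V i ∈ Matrix.unitaryGroup (Fin (E i).dim) ℂ) {l : ∀ i, Fin (E i).dim → ℝ}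
    (hl : ∀ i, (E i).op = V i * Matrix.diagonal (fun j => (l i j : ℂ)) * (V i)ᴴ) :
    envHamiltonian E = tensor V *
      Matrix.diagonal (fun x : EnvIdx E => ((∑ i, l i (x i) : ℝ) : ℂ)) * (tensor V)ᴴ := by
  have h1 : ∀ i, tensor (Function.update
      (fun j => (1 : Matrix (Fin (E j).dim) (Fin (E j).dim) ℂ)) i (E i).op) =
      tensor V * Matrix.diagonal (fun x : EnvIdx E => (l i (x i) : ℂ)) * (tensor V)ᴴ := by
    intro i
    have h2 : Matrix.diagonal (fun x : EnvIdx E => (l i (x i) : ℂ)) =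
        tensor (E := E) (fun j => Matrix.diagonal
          (Function.update (fun j (_ : Fin (E j).dim) => (1 : ℂ)) i (fun a => (l i a : ℂ)) j)) := by
      rw [tensor_diagonal]
      congr 1
      ext x
      rw [Finset.prod_eq_single i]
      · simp
      · intro b _ hb; simp [Function.update_of_ne hb]
      · simp
    rw [h2, tensor_conjTranspose, tensor_mul, tensor_mul]
    congr 1
    ext1 j
    by_cases hj : j = i
    · subst hj; simp [hl]
    · simp only [Function.update_of_ne hj]
      rw [Matrix.diagonal_one, mul_one, mul_conjTranspose_self_of_unitary (hV j)]
  unfold envHamiltonian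
  simp only [h1]
  rw [← Finset.sum_mul, ← Finset.mul_sum]
  congr 2
  ext x y
  by_cases h : x = y
  · subst h; simp [Matrix.sum_apply]
  · simp [Matrix.sum_apply, Matrix.diagonal_apply_ne _ h]

lemma meanEnergy_tensor {σ : ∀ i, Matrix (Fin (E i).dim) (Fin (E i).dim) ℂ}
    (hσ : ∀ i, IsDensity (σ i)) :
    meanEnergy (tensor σ) (envHamiltonian E) = ∑ i, meanEnergy (σ i) (E i).op := by
  unfold meanEnergy envHamiltonian
  rw [Finset.mul_sum, Matrix.trace_sum, Complex.re_sum]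
  refine Finset.sum_congr rfl fun i _ => ?_
  rw [tensor_mul, trace_tensor, Finset.prod_eq_single i]
  · simp
  · intro b _ hb; simp [Function.update_of_ne hb, (hσ b).2]
  · simp

end Tensor

/-! ### Trace norm, partial trace and Kronecker products. -/

section TraceNorm

variable {ι κ : Type*} [Fintype ι] [DecidableEq ι] [Fintype κ]

lemma sum_eigenvalues_conjTranspose_mul_self (A : Matrix ι ι ℂ) :
    ∑ i, (Matrix.isHermitian_conjTranspose_mul_self A).eigenvalues i =
      ∑ i, ∑ j, ‖A i j‖ ^ 2 := by
  have h := congrArg Complex.re (Matrix.isHermitian_conjTranspose_mul_self A).trace_eq_sum_eigenvalues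
  rw [Complex.re_sum] at h
  simp only [Complex.coe_algebraMap, Complex.ofReal_re] at h
  rw [← h, Finset.sum_comm]
  simp only [Matrix.trace, Matrix.diag_apply, Matrix.mul_apply, Complex.re_sum,
    Matrix.conjTranspose_apply]
  refine Finset.sum_congr rfl fun i _ => Finset.sum_congr rfl fun j _ => ?_
  rw [← Complex.normSq_eq_norm_sq, Complex.normSq_apply]
  simp

/-- An entry is at most the Frobenius norm, which is the ℓ² norm of the singular values and hence at
most their sum. With `traceNorm_le` it allows all later estimates to be made entrywise. -/
lemma norm_entry_le_traceNorm (A : Matrix ι ι ℂ) (a b : ι) : ‖A a b‖ ≤ traceNorm A := by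
  have h0 : ∀ i, 0 ≤ (Matrix.isHermitian_conjTranspose_mul_self A).eigenvalues i :=
    (Matrix.posSemidef_conjTranspose_mul_self A).eigenvalues_nonneg
  have hnn : 0 ≤ traceNorm A := Finset.sum_nonneg fun i _ => Real.sqrt_nonneg _
  refine le_of_sq_le_sq ?_ hnn
  calc ‖A a b‖ ^ 2 ≤ ∑ j, ‖A a j‖ ^ 2 :=
        Finset.single_le_sum (f := fun j => ‖A a j‖ ^ 2) (fun j _ => by positivity)
          (Finset.mem_univ b)
    _ ≤ ∑ i, ∑ j, ‖A i j‖ ^ 2 :=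
        Finset.single_le_sum (f := fun i => ∑ j, ‖A i j‖ ^ 2)
          (fun j _ => Finset.sum_nonneg fun _ _ => by positivity) (Finset.mem_univ a)
    _ = ∑ i, Real.sqrt ((Matrix.isHermitian_conjTranspose_mul_self A).eigenvalues i) ^ 2 := by
        rw [← sum_eigenvalues_conjTranspose_mul_self]
        exact Finset.sum_congr rfl fun i _ => (Real.sq_sqrt (h0 i)).symm
    _ ≤ traceNorm A ^ 2 := by
        unfold traceNorm
        exact Finset.sum_sq_le_sq_sum_of_nonneg fun i _ => Real.sqrt_nonneg _

lemma traceNorm_le {A : Matrix ι ι ℂ} {c : ℝ} (hc : 0 ≤ c) (h : ∀ a b, ‖A a b‖ ≤ c) :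
    traceNorm A ≤ (Fintype.card ι : ℝ) ^ 2 * c := by
  have h0 : ∀ i, 0 ≤ (Matrix.isHermitian_conjTranspose_mul_self A).eigenvalues i :=
    (Matrix.posSemidef_conjTranspose_mul_self A).eigenvalues_nonneg
  have h1 : ∀ i, Real.sqrt ((Matrix.isHermitian_conjTranspose_mul_self A).eigenvalues i) ≤
      (Fintype.card ι : ℝ) * c := by
    intro i
    refine Real.sqrt_le_iff.2 ⟨by positivity, ?_⟩
    calc _ ≤ ∑ i, (Matrix.isHermitian_conjTranspose_mul_self A).eigenvalues i :=
          Finset.single_le_sum (fun i _ => h0 i) (Finset.mem_univ i)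
      _ = ∑ i, ∑ j, ‖A i j‖ ^ 2 := sum_eigenvalues_conjTranspose_mul_self A
      _ ≤ ∑ _i : ι, ∑ _j : ι, c ^ 2 :=
          Finset.sum_le_sum fun i _ => Finset.sum_le_sum fun j _ =>
            pow_le_pow_left₀ (norm_nonneg _) (h i j) 2
      _ = _ := by simp; ring
  calc traceNorm A ≤ ∑ _i : ι, (Fintype.card ι : ℝ) * c := Finset.sum_le_sum fun i _ => h1 i
    _ = _ := by simp; ring

lemma trace_traceEnv_mul [DecidableEq κ] (W : Matrix (ι × κ) (ι × κ) ℂ) (A : Matrix ι ι ℂ) :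
    (traceEnv W * A).trace = (W * A ⊗ₖ (1 : Matrix κ κ ℂ)).trace := by
  simp only [Matrix.trace, Matrix.diag_apply, Matrix.mul_apply, traceEnv, Matrix.of_apply,
    Fintype.sum_prod_type, Matrix.kroneckerMap_apply, Matrix.one_apply, mul_ite, mul_one, mul_zero,
    Finset.sum_ite_eq', Finset.mem_univ, if_true, Finset.sum_mul]
  refine Finset.sum_congr rfl fun i _ => ?_
  rw [Finset.sum_comm]

lemma kronecker_conj_mul (A : Matrix ι ι ℂ) (B V : Matrix κ κ ℂ) [DecidableEq κ] :
    (1 : Matrix ι ι ℂ) ⊗ₖ V * A ⊗ₖ B * ((1 : Matrix ι ι ℂ) ⊗ₖ V)ᴴ = A ⊗ₖ (V * B * Vᴴ) := by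
  rw [Matrix.conjTranspose_kronecker, Matrix.conjTranspose_one, ← Matrix.mul_kronecker_mul,
    ← Matrix.mul_kronecker_mul, one_mul, mul_one]

lemma one_kronecker_unitary [DecidableEq κ] {V : Matrix κ κ ℂ}
    (hV : V ∈ Matrix.unitaryGroup κ ℂ) :
    (1 : Matrix ι ι ℂ) ⊗ₖ V ∈ Matrix.unitaryGroup (ι × κ) ℂ := by
  rw [Matrix.mem_unitaryGroup_iff, Matrix.star_eq_conjTranspose, Matrix.conjTranspose_kronecker,
    ← Matrix.mul_kronecker_mul, mul_conjTranspose_self_of_unitary hV]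
  simp

lemma IsDensity.kronecker [DecidableEq κ] {ρ : Matrix ι ι ℂ} {σ : Matrix κ κ ℂ}
    (hρ : IsDensity ρ) (hσ : IsDensity σ) : IsDensity (ρ ⊗ₖ σ) := by
  refine ⟨hρ.1.kronecker hσ.1, ?_⟩
  rw [Matrix.trace_kronecker, hρ.2, hσ.2, one_mul]

end TraceNorm

/-! ### Gibbs states in an eigenbasis. -/

section Gibbs

variable {ι : Type*} [Fintype ι]

/-- The partition function of a system with energy levels `l`. -/
noncomputable def partitionFunction (l : ι → ℝ) (β : ℝ) : ℝ := ∑ i, Real.exp (-β * l i)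

/-- The Gibbs distribution on the energy levels `l`. -/
noncomputable def gibbsWeight (l : ι → ℝ) (β : ℝ) (i : ι) : ℝ :=
  Real.exp (-β * l i) / partitionFunction l β

/-- The mean energy of the Gibbs distribution on the energy levels `l`. -/
noncomputable def gibbsEnergy (l : ι → ℝ) (β : ℝ) : ℝ := ∑ i, gibbsWeight l β i * l i

lemma partitionFunction_pos [Nonempty ι] (l : ι → ℝ) (β : ℝ) : 0 < partitionFunction l β :=
  Finset.sum_pos (fun _ _ => Real.exp_pos _) Finset.univ_nonempty

lemma gibbsWeight_pos [Nonempty ι] (l : ι → ℝ) (β : ℝ) (i : ι) : 0 < gibbsWeight l β i :=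
  div_pos (Real.exp_pos _) (partitionFunction_pos l β)

lemma sum_gibbsWeight [Nonempty ι] (l : ι → ℝ) (β : ℝ) : ∑ i, gibbsWeight l β i = 1 := by
  unfold gibbsWeight
  rw [← Finset.sum_div]
  exact div_self (partitionFunction_pos l β).ne'

instance (H : Hamiltonian) : Nonempty (Fin H.dim) := ⟨⟨0, H.dim_pos⟩⟩

lemma isDensity_conj_diagonal [DecidableEq ι] {V : Matrix ι ι ℂ}
    (hV : V ∈ Matrix.unitaryGroup ι ℂ) {p : ι → ℝ} (h0 : ∀ i, 0 ≤ p i) (h1 : ∑ i, p i = 1) :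
    IsDensity (V * Matrix.diagonal (fun i => (p i : ℂ)) * Vᴴ) := by
  refine IsDensity.conj ⟨Matrix.PosSemidef.diagonal fun i => by simpa using h0 i, ?_⟩ hV
  rw [Matrix.trace_diagonal, ← Complex.ofReal_sum, h1, Complex.ofReal_one]

lemma gibbsState_eq {H : Hamiltonian} {V : Matrix (Fin H.dim) (Fin H.dim) ℂ}
    (hV : V ∈ Matrix.unitaryGroup (Fin H.dim) ℂ) {l : Fin H.dim → ℝ}
    (hl : H.op = V * Matrix.diagonal (fun i => (l i : ℂ)) * Vᴴ) (β : ℝ) :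
    gibbsState β H = V * Matrix.diagonal (fun i => (gibbsWeight l β i : ℂ)) * Vᴴ := by
  have hinv : V⁻¹ = Vᴴ := Matrix.inv_eq_right_inv (mul_conjTranspose_self_of_unitary hV)
  have hu : IsUnit V := IsUnit.of_mul_eq_one _ (mul_conjTranspose_self_of_unitary hV)
  have hexp : NormedSpace.exp (-(β : ℂ) • H.op) =
      V * Matrix.diagonal (fun i => ((Real.exp (-β * l i) : ℝ) : ℂ)) * Vᴴ := by
    have h1 : -(β : ℂ) • H.op = V * Matrix.diagonal (-(β : ℂ) • fun i => (l i : ℂ)) * V⁻¹ := by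
      rw [hinv, hl, Matrix.diagonal_smul, Matrix.mul_smul, Matrix.smul_mul]
    rw [h1, Matrix.exp_conj _ _ hu, Matrix.exp_diagonal, hinv]
    congr 3
    ext i
    rw [Pi.coe_exp, ← Complex.exp_eq_exp_ℂ]
    simp
  have htr : (NormedSpace.exp (-(β : ℂ) • H.op)).trace = (partitionFunction l β : ℂ) := by
    rw [hexp, Matrix.trace_mul_comm, ← mul_assoc, conjTranspose_mul_self_of_unitary hV, one_mul,
      Matrix.trace_diagonal, partitionFunction, Complex.ofReal_sum]
  unfold gibbsState
  rw [htr, hexp, ← Matrix.smul_mul, ← Matrix.mul_smul, ← Matrix.diagonal_smul]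
  congr 3
  ext i
  simp [gibbsWeight, div_eq_inv_mul]

/-- Any diagonalisation is admitted, not only the one by `eigenvectorUnitary`; comparing two of them
removes the dependence on the ordering of `eigenvalues`. -/
lemma thermalEnergy_coe {H : Hamiltonian} {V : Matrix (Fin H.dim) (Fin H.dim) ℂ}
    (hV : V ∈ Matrix.unitaryGroup (Fin H.dim) ℂ) {l : Fin H.dim → ℝ}
    (hl : H.op = V * Matrix.diagonal (fun i => (l i : ℂ)) * Vᴴ) (β : ℝ) :
    thermalEnergy (β : EReal) H = gibbsEnergy l β := by
  have h : thermalEnergy (β : EReal) H = meanEnergy (gibbsState β H) H.op := by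
    simp [thermalEnergy]
  rw [h, gibbsState_eq hV hl]
  conv_lhs => rw [hl]
  rw [meanEnergy_conj_diagonal]
  unfold gibbsEnergy
  refine Finset.sum_congr rfl fun i _ => ?_
  rw [← mul_assoc, ← mul_assoc, conjTranspose_mul_self_of_unitary hV, one_mul, mul_assoc,
    conjTranspose_mul_self_of_unitary hV, mul_one]
  simp

lemma gibbsState_isDensity (β : ℝ) (H : Hamiltonian) : IsDensity (gibbsState β H) := by
  rw [gibbsState_eq H.isHermitian.eigenvectorUnitary.2 (eq_eigenvectorUnitary_conj H.isHermitian)]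
  exact isDensity_conj_diagonal H.isHermitian.eigenvectorUnitary.2
    (fun i => (gibbsWeight_pos _ _ _).le) (sum_gibbsWeight _ _)

end Gibbs

/-! ### Passivity of Gibbs states. -/

section Passivity

variable {ι : Type*} [Fintype ι] [DecidableEq ι]

lemma sum_norm_sq_col {U : Matrix ι ι ℂ} (hU : U ∈ Matrix.unitaryGroup ι ℂ) (j : ι) :
    ∑ i, ‖U i j‖ ^ 2 = 1 := by
  have h := congrArg Complex.re (congrFun (congrFun (conjTranspose_mul_self_of_unitary hU) j) j)
  rw [Matrix.mul_apply, Complex.re_sum] at h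
  simp only [Matrix.one_apply_eq, Complex.one_re] at h
  rw [← h]
  refine Finset.sum_congr rfl fun i _ => ?_
  rw [← Complex.normSq_eq_norm_sq, Complex.normSq_apply]
  simp

lemma sum_norm_sq_row {U : Matrix ι ι ℂ} (hU : U ∈ Matrix.unitaryGroup ι ℂ) (i : ι) :
    ∑ j, ‖U i j‖ ^ 2 = 1 := by
  simpa using sum_norm_sq_col (conjTranspose_mem_unitary hU) i

lemma conj_diagonal_apply_re (U : Matrix ι ι ℂ) (p : ι → ℝ) (i : ι) :
    ((U * Matrix.diagonal (fun i => (p i : ℂ)) * Uᴴ) i i).re = ∑ j, ‖U i j‖ ^ 2 * p j := by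
  rw [Matrix.mul_apply, Complex.re_sum]
  refine Finset.sum_congr rfl fun j _ => ?_
  rw [Matrix.mul_diagonal, Matrix.conjTranspose_apply, ← Complex.normSq_eq_norm_sq,
    Complex.normSq_apply]
  simp
  ring

/-- A quantitative form of the passivity of Gibbs states. -/
lemma gibbs_variational {U : Matrix ι ι ℂ} (hU : U ∈ Matrix.unitaryGroup ι ℂ) {l p g : ι → ℝ}
    {β c : ℝ} (hc : 0 ≤ c) (hp : ∀ i, p i = c * Real.exp (-β * l i)) {q : ι → ℝ}
    (hq : ∀ i, q i = ∑ j, ‖U i j‖ ^ 2 * p j) :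
    ∑ i, p i - ∑ i, p i * Real.exp (-g i) ≤
      β * (∑ i, q i * l i - ∑ i, p i * l i) + ∑ i, q i * g i := by
  -- Since `p i = p j * exp (-β (l i - l j))`, this is `p j` times `1 - exp (-y) ≤ y` with `y = β (l
  -- i - l j) + g i`. Averaging over the doubly stochastic weights `‖U i j‖ ^ 2` gives the claim.
  have key : ∀ i j, p j - p i * Real.exp (-g i) ≤ p j * (β * (l i - l j) + g i) := by
    intro i j
    have h1 : p i * Real.exp (-g i) = p j * Real.exp (-(β * (l i - l j) + g i)) := by
      rw [hp i, hp j, mul_assoc, mul_assoc, ← Real.exp_add, ← Real.exp_add]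
      ring_nf
    have h2 := Real.add_one_le_exp (-(β * (l i - l j) + g i))
    have h3 : 0 ≤ p j := by rw [hp]; positivity
    rw [h1]
    nlinarith
  have hsum : ∑ i, ∑ j, ‖U i j‖ ^ 2 * (p j - p i * Real.exp (-g i)) ≤
      ∑ i, ∑ j, ‖U i j‖ ^ 2 * (p j * (β * (l i - l j) + g i)) :=
    Finset.sum_le_sum fun i _ => Finset.sum_le_sum fun j _ =>
      mul_le_mul_of_nonneg_left (key i j) (by positivity)
  have hcol : ∀ a : ι → ℝ, ∑ i, ∑ j, ‖U i j‖ ^ 2 * a j = ∑ j, a j := by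
    intro a
    rw [Finset.sum_comm]
    refine Finset.sum_congr rfl fun j _ => ?_
    rw [← Finset.sum_mul, sum_norm_sq_col hU, one_mul]
  have hrow : ∀ a : ι → ℝ, ∑ i, ∑ j, ‖U i j‖ ^ 2 * a i = ∑ i, a i := by
    intro a
    refine Finset.sum_congr rfl fun i _ => ?_
    rw [← Finset.sum_mul, sum_norm_sq_row hU, one_mul]
  have hl : ∑ i, ∑ j, ‖U i j‖ ^ 2 * (p j - p i * Real.exp (-g i)) =
      ∑ i, p i - ∑ i, p i * Real.exp (-g i) := by
    simp only [mul_sub, Finset.sum_sub_distrib]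
    rw [hcol, hrow fun i => p i * Real.exp (-g i)]
  have hr : ∑ i, ∑ j, ‖U i j‖ ^ 2 * (p j * (β * (l i - l j) + g i)) =
      β * (∑ i, q i * l i - ∑ i, p i * l i) + ∑ i, q i * g i := by
    rw [← hcol fun j => p j * l j, mul_sub, Finset.mul_sum, Finset.mul_sum,
      ← Finset.sum_sub_distrib, ← Finset.sum_add_distrib]
    refine Finset.sum_congr rfl fun i _ => ?_
    rw [hq, Finset.sum_mul, Finset.sum_mul, Finset.mul_sum, Finset.mul_sum,
      ← Finset.sum_sub_distrib, ← Finset.sum_add_distrib]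
    exact Finset.sum_congr rfl fun j _ => by ring
  linarith

/-- `gibbs_variational` for a Gibbs state of a Hamiltonian with eigenbasis `V`. -/
lemma gibbs_variational_conj {U V : Matrix ι ι ℂ} (hU : U ∈ Matrix.unitaryGroup ι ℂ)
    (hV : V ∈ Matrix.unitaryGroup ι ℂ) {l p : ι → ℝ} (g : ι → ℝ)
    {β c : ℝ} (hc : 0 ≤ c) (hp : ∀ i, p i = c * Real.exp (-β * l i)) {H ω : Matrix ι ι ℂ}
    (hH : H = V * Matrix.diagonal (fun i => (l i : ℂ)) * Vᴴ)
    (hω : ω = V * Matrix.diagonal (fun i => (p i : ℂ)) * Vᴴ) :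
    ∑ i, p i - ∑ i, p i * Real.exp (-g i) ≤
      β * (meanEnergy (U * ω * Uᴴ) H - meanEnergy ω H) +
        ∑ i, ((Vᴴ * (U * ω * Uᴴ) * V) i i).re * g i := by
  have hVV := conjTranspose_mul_self_of_unitary hV
  have h1 : Vᴴ * (U * ω * Uᴴ) * V =
      (Vᴴ * U * V) * Matrix.diagonal (fun i => (p i : ℂ)) * (Vᴴ * U * V)ᴴ := by
    rw [hω]
    simp only [Matrix.conjTranspose_mul, Matrix.conjTranspose_conjTranspose, mul_assoc]
  have h2 : ∀ i, ((Vᴴ * ω * V) i i).re = p i := by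
    intro i
    rw [hω, ← mul_assoc, ← mul_assoc, hVV, one_mul, mul_assoc, hVV, mul_one]
    simp
  have hW : Vᴴ * U * V ∈ Matrix.unitaryGroup ι ℂ :=
    mul_mem (mul_mem (conjTranspose_mem_unitary hV) hU) hV
  have h3 := gibbs_variational hW (g := g) hc hp
    (fun i => conj_diagonal_apply_re (Vᴴ * U * V) p i)
  rw [← h1] at h3
  rw [hH, meanEnergy_conj_diagonal, meanEnergy_conj_diagonal]
  simpa only [h2] using h3

end Passivity

/-! ### The compound of system and environment. -/

section Compound

variable {ι κ : Type*} [Fintype ι] [DecidableEq ι] [Fintype κ] [DecidableEq κ]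

lemma traceEnv_apply_eq (W : Matrix (ι × κ) (ι × κ) ℂ) (a b : ι) :
    traceEnv W a b = (W * Matrix.single b a 1 ⊗ₖ (1 : Matrix κ κ ℂ)).trace := by
  rw [← trace_traceEnv_mul, Matrix.trace_mul_comm, Matrix.trace_single_mul]
  simp

lemma traceEnv_conj (W : Matrix (ι × κ) (ι × κ) ℂ) {V : Matrix κ κ ℂ}
    (hV : V ∈ Matrix.unitaryGroup κ ℂ) :
    traceEnv (((1 : Matrix ι ι ℂ) ⊗ₖ V)ᴴ * W * ((1 : Matrix ι ι ℂ) ⊗ₖ V)) = traceEnv W := by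
  ext a b
  rw [traceEnv_apply_eq, traceEnv_apply_eq, mul_assoc, mul_assoc, Matrix.trace_mul_comm, mul_assoc,
    kronecker_conj_mul, mul_one, mul_conjTranspose_self_of_unitary hV]

lemma one_kronecker_eq_conj {HE V : Matrix κ κ ℂ} {l : κ → ℝ}
    (hl : HE = V * Matrix.diagonal (fun i => (l i : ℂ)) * Vᴴ) :
    (1 : Matrix ι ι ℂ) ⊗ₖ HE = ((1 : Matrix ι ι ℂ) ⊗ₖ V) *
      Matrix.diagonal (fun i : ι × κ => (l i.2 : ℂ)) * ((1 : Matrix ι ι ℂ) ⊗ₖ V)ᴴ := by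
  have : Matrix.diagonal (fun i : ι × κ => (l i.2 : ℂ)) =
      (1 : Matrix ι ι ℂ) ⊗ₖ Matrix.diagonal (fun i => (l i : ℂ)) := by
    rw [← Matrix.diagonal_one, Matrix.diagonal_kronecker_diagonal]
    simp
  rw [this, kronecker_conj_mul, hl]

lemma meanEnergy_le_of_le {ω H V : Matrix ι ι ℂ} (hω : IsDensity ω)
    (hV : V ∈ Matrix.unitaryGroup ι ℂ) {l : ι → ℝ}
    (hH : H = V * Matrix.diagonal (fun i => (l i : ℂ)) * Vᴴ) {c : ℝ} (h : ∀ i, l i ≤ c) :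
    meanEnergy ω H ≤ c := by
  rw [hH, meanEnergy_conj_diagonal]
  calc _ ≤ ∑ i, ((Vᴴ * ω * V) i i).re * c := Finset.sum_le_sum fun i _ =>
        mul_le_mul_of_nonneg_left (h i) ((hω.conj' hV).diag_nonneg i)
    _ = c := by rw [← Finset.sum_mul, (hω.conj' hV).sum_diag, one_mul]

lemma le_meanEnergy_of_le {ω H V : Matrix ι ι ℂ} (hω : IsDensity ω)
    (hV : V ∈ Matrix.unitaryGroup ι ℂ) {l : ι → ℝ}
    (hH : H = V * Matrix.diagonal (fun i => (l i : ℂ)) * Vᴴ) {c : ℝ} (h : ∀ i, c ≤ l i) :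
    c ≤ meanEnergy ω H := by
  rw [hH, meanEnergy_conj_diagonal]
  calc c = ∑ i, ((Vᴴ * ω * V) i i).re * c := by
        rw [← Finset.sum_mul, (hω.conj' hV).sum_diag, one_mul]
    _ ≤ _ := Finset.sum_le_sum fun i _ =>
        mul_le_mul_of_nonneg_left (h i) ((hω.conj' hV).diag_nonneg i)

lemma meanEnergy_totalHamiltonian (S : Hamiltonian) {N : ℕ} (E : Fin N → Hamiltonian)
    (W : Matrix (Fin S.dim × EnvIdx E) (Fin S.dim × EnvIdx E) ℂ) :
    meanEnergy W (totalHamiltonian S E) = meanEnergy (traceEnv W) S.op +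
      meanEnergy W ((1 : Matrix (Fin S.dim) (Fin S.dim) ℂ) ⊗ₖ envHamiltonian E) := by
  unfold meanEnergy totalHamiltonian
  rw [mul_add, Matrix.trace_add, Complex.add_re, trace_traceEnv_mul]

lemma traceEnv_kronecker (ρ : Matrix ι ι ℂ) {σ : Matrix κ κ ℂ} (hσ : IsDensity σ) :
    traceEnv (ρ ⊗ₖ σ) = ρ := by
  ext a b
  simp only [traceEnv, Matrix.of_apply, Matrix.kroneckerMap_apply]
  rw [← Finset.mul_sum, show ∑ x, σ x x = 1 from hσ.2, mul_one]

lemma meanEnergy_kronecker {ρ : Matrix ι ι ℂ} (hρ : IsDensity ρ) (σ HE : Matrix κ κ ℂ) :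
    meanEnergy (ρ ⊗ₖ σ) ((1 : Matrix ι ι ℂ) ⊗ₖ HE) = meanEnergy σ HE := by
  unfold meanEnergy
  rw [← Matrix.mul_kronecker_mul, Matrix.trace_kronecker, mul_one, hρ.2, one_mul]

end Compound

/-! ### The environment in its product eigenbasis. -/

section Thermal

variable {N : ℕ} (E : Fin N → Hamiltonian)

/-- The product of eigenbases of the environment systems. -/
noncomputable abbrev envBasis : Matrix (EnvIdx E) (EnvIdx E) ℂ :=
  tensor fun i => ((E i).isHermitian.eigenvectorUnitary : Matrix (Fin (E i).dim) (Fin (E i).dim) ℂ)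

/-- The energies of the product basis `envBasis E`. -/
noncomputable def envEnergy (x : EnvIdx E) : ℝ := ∑ i, (E i).isHermitian.eigenvalues (x i)

lemma envBasis_unitary : envBasis E ∈ Matrix.unitaryGroup (EnvIdx E) ℂ :=
  tensor_unitary fun i => (E i).isHermitian.eigenvectorUnitary.2

lemma envHamiltonian_eq_envBasis : envHamiltonian E =
    envBasis E * Matrix.diagonal (fun x => (envEnergy E x : ℂ)) * (envBasis E)ᴴ :=
  envHamiltonian_eq (fun i => (E i).isHermitian.eigenvectorUnitary.2)
    fun i => eq_eigenvectorUnitary_conj (E i).isHermitian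

lemma sum_groundEnergy_le (x : EnvIdx E) : ∑ i, groundEnergy (E i) ≤ envEnergy E x :=
  Finset.sum_le_sum fun i _ => ciInf_le (Set.finite_range _).bddBelow (x i)

lemma le_sum_topEnergy (x : EnvIdx E) : envEnergy E x ≤ ∑ i, topEnergy (E i) :=
  Finset.sum_le_sum fun i _ => le_ciSup (Set.finite_range _).bddAbove (x i)

/-- The Gibbs distribution of the environment. -/
noncomputable def envWeight (β : ℝ) (x : EnvIdx E) : ℝ :=
  ∏ i, gibbsWeight (E i).isHermitian.eigenvalues β (x i)

lemma envWeight_eq (β : ℝ) (x : EnvIdx E) : envWeight E β x =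
    (∏ i, (partitionFunction (E i).isHermitian.eigenvalues β)⁻¹) *
      Real.exp (-β * envEnergy E x) := by
  unfold envWeight gibbsWeight envEnergy
  rw [Finset.mul_sum, Real.exp_sum, ← Finset.prod_mul_distrib]
  exact Finset.prod_congr rfl fun i _ => by rw [div_eq_inv_mul]

lemma sum_envWeight (β : ℝ) : ∑ x, envWeight E β x = 1 := by
  unfold envWeight
  have := Finset.prod_univ_sum (fun i : Fin N => (Finset.univ : Finset (Fin (E i).dim)))
    (fun i a => gibbsWeight (E i).isHermitian.eigenvalues β a)
  rw [Fintype.piFinset_univ] at this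
  rw [← this]
  exact Finset.prod_eq_one fun i _ => sum_gibbsWeight _ _

lemma tensor_gibbsState (β : ℝ) : tensor (fun i => gibbsState β (E i)) =
    envBasis E * Matrix.diagonal (fun x => (envWeight E β x : ℂ)) * (envBasis E)ᴴ := by
  have : Matrix.diagonal (fun x => (envWeight E β x : ℂ)) = tensor (E := E) fun i =>
      Matrix.diagonal (fun a => (gibbsWeight (E i).isHermitian.eigenvalues β a : ℂ)) := by
    rw [tensor_diagonal]
    simp [envWeight]
  rw [this, tensor_conjTranspose, tensor_mul, tensor_mul]
  congr 1
  ext1 i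
  exact gibbsState_eq (E i).isHermitian.eigenvectorUnitary.2
    (eq_eigenvectorUnitary_conj (E i).isHermitian) β

end Thermal

/-! ### Thermal assignments: no work, and forbidden transitions. -/

/-- The two-level system with energies `0` and `g`. -/
noncomputable def qubit (g : ℝ) : Hamiltonian where
  dim := 2
  dim_pos := by norm_num
  op := Matrix.diagonal fun i => ((![0, g] i : ℝ) : ℂ)
  isHermitian := by
    rw [Matrix.isHermitian_diagonal_iff]
    intro i
    simp [isSelfAdjoint_iff]

lemma meanEnergy_two (M : Matrix (Fin 2) (Fin 2) ℂ) (g : ℝ) :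
    meanEnergy M (Matrix.diagonal fun i => ((![0, g] i : ℝ) : ℂ)) = (M 1 1).re * g := by
  simp [meanEnergy, Matrix.trace, Matrix.mul_diagonal, Fin.sum_univ_two]

lemma diagonal_two_isDensity {p : Fin 2 → ℝ} (h0 : ∀ i, 0 ≤ p i) (h1 : p 0 + p 1 = 1) :
    IsDensity (Matrix.diagonal fun i => (p i : ℂ)) := by
  simpa using isDensity_conj_diagonal (one_mem _) h0 (by rw [Fin.sum_univ_two, h1])

lemma not_workExtractable_of_thermal {f : Hamiltonian → ℝ}
    (hf : ∀ H, (microstates (f H) H).Nonempty) {β : EReal} (h : ∀ H, f H = thermalEnergy β H)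
    (hβ : 0 ≤ β) {W : ℝ} (hW : 0 < W) : ¬ WorkExtractable f W := by
  rintro ⟨N, E, U, hU, hwork⟩
  rcases eq_or_ne β ⊤ with htop | htop
  · choose σ hσ using fun i => hf (E i)
    have hσd : ∀ i, IsDensity (σ i) := fun i => (hσ i).1
    have h1 := hwork σ hσ
    rw [meanEnergy_tensor hσd, Finset.sum_congr rfl fun i _ => (hσ i).2] at h1
    have h2 := le_meanEnergy_of_le ((IsDensity.tensor hσd).conj hU) (envBasis_unitary E)
      (envHamiltonian_eq_envBasis E) (sum_groundEnergy_le E)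
    have h3 : ∀ i, f (E i) = groundEnergy (E i) := fun i => by rw [h, thermalEnergy, if_pos htop]
    simp only [h3] at h1
    linarith
  · obtain ⟨b, rfl⟩ : ∃ b : ℝ, β = b :=
      ⟨β.toReal, (EReal.coe_toReal htop (by rintro rfl; simp at hβ)).symm⟩
    have hb : 0 ≤ b := by exact_mod_cast hβ
    have h1 := hwork (fun i => gibbsState b (E i))
      (fun i => ⟨gibbsState_isDensity b (E i), by rw [h]; simp [thermalEnergy]⟩)
    have hc : 0 ≤ ∏ i, (partitionFunction (E i).isHermitian.eigenvalues b)⁻¹ :=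
      Finset.prod_nonneg fun i _ => (inv_pos.2 (partitionFunction_pos _ _)).le
    rcases hb.eq_or_lt with rfl | hb
    -- At `β = 0` the variational inequality loses the energy term, but the state is a multiple of
    -- the identity and is fixed by every unitary.
    · have h2 : tensor (fun i => gibbsState 0 (E i)) =
          ((∏ i, (partitionFunction (E i).isHermitian.eigenvalues 0)⁻¹ : ℝ) : ℂ) • 1 := by
        rw [tensor_gibbsState]
        simp only [envWeight_eq, neg_zero, zero_mul, Real.exp_zero, mul_one]
        rw [← Matrix.smul_one_eq_diagonal, Matrix.mul_smul, mul_one, Matrix.smul_mul,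
          mul_conjTranspose_self_of_unitary (envBasis_unitary E)]
      rw [h2, Matrix.mul_smul, mul_one, Matrix.smul_mul, mul_conjTranspose_self_of_unitary hU]
        at h1
      linarith
    · have h2 := gibbs_variational_conj hU (envBasis_unitary E) (fun _ => 0) hc (envWeight_eq E b)
        (envHamiltonian_eq_envBasis E) (tensor_gibbsState E b)
      simp only [neg_zero, Real.exp_zero, mul_one, sub_self, mul_zero, Finset.sum_const_zero,
        add_zero] at h2
      have h3 := nonneg_of_mul_nonneg_right h2 hb
      linarith

lemma abs_re_sub_le {a b : ℂ} {ε : ℝ} (h : ‖a - b‖ ≤ ε) : |a.re - b.re| ≤ ε := by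
  rw [← Complex.sub_re]
  exact (Complex.abs_re_le_norm _).trans h

lemma MacroReachable.exists_unitary {f : Hamiltonian → ℝ} {e : ℝ} {S : Hamiltonian}
    {ρf : Matrix (Fin S.dim) (Fin S.dim) ℂ} (h : MacroReachable f e S ρf) {ε ε' : ℝ} (hε : 0 < ε)
    (hε' : 0 < ε') :
    ∃ (N : ℕ) (E : Fin N → Hamiltonian), ∃ U ∈ Matrix.unitaryGroup (Fin S.dim × EnvIdx E) ℂ,
      ∀ ρ ∈ microstates e S, ∀ σ : ∀ i, Matrix (Fin (E i).dim) (Fin (E i).dim) ℂ,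
        (∀ i, σ i ∈ microstates (f (E i)) (E i)) →
          (∀ a b, ‖traceEnv (U * (ρ ⊗ₖ tensor σ) * Uᴴ) a b - ρf a b‖ ≤ ε) ∧
          |meanEnergy (traceEnv (U * (ρ ⊗ₖ tensor σ) * Uᴴ)) S.op - e +
            (meanEnergy (U * (ρ ⊗ₖ tensor σ) * Uᴴ)
              ((1 : Matrix (Fin S.dim) (Fin S.dim) ℂ) ⊗ₖ envHamiltonian E) -
            meanEnergy (tensor σ) (envHamiltonian E))| ≤ ε' := by
  obtain ⟨N, E, U, hU, hE⟩ := h ε hε ε' hε'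
  refine ⟨N, E, U, hU, fun ρ hρ σ hσ => ?_⟩
  obtain ⟨h1, h2⟩ := hE ρ hρ σ hσ
  refine ⟨fun a b => (norm_entry_le_traceNorm _ a b).trans h1, ?_⟩
  rw [meanEnergy_totalHamiltonian, meanEnergy_totalHamiltonian,
    traceEnv_kronecker _ (IsDensity.tensor fun i => (hσ i).1), hρ.2, meanEnergy_kronecker hρ.1]
    at h2
  convert h2 using 2
  ring

lemma EveryTransitionPossible.exists_unitary_qubit {f : Hamiltonian → ℝ}
    (hall : EveryTransitionPossible f) (g : ℝ) {p q : Fin 2 → ℝ} (hp0 : ∀ i, 0 ≤ p i)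
    (hp1 : p 0 + p 1 = 1) (hq0 : ∀ i, 0 ≤ q i) (hq1 : q 0 + q 1 = 1) {ε ε' : ℝ} (hε : 0 < ε)
    (hε' : 0 < ε') :
    ∃ (N : ℕ) (E : Fin N → Hamiltonian), ∃ U ∈ Matrix.unitaryGroup (Fin 2 × EnvIdx E) ℂ,
      ∀ σ : ∀ i, Matrix (Fin (E i).dim) (Fin (E i).dim) ℂ,
        (∀ i, σ i ∈ microstates (f (E i)) (E i)) →
        ∀ ω W : Matrix (Fin 2 × EnvIdx E) (Fin 2 × EnvIdx E) ℂ,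
          ω = (Matrix.diagonal fun i => (p i : ℂ)) ⊗ₖ tensor σ → W = U * ω * Uᴴ →
          (∀ a, |(traceEnv W a a).re - q a| ≤ ε) ∧
          |(traceEnv W 1 1).re * g - p 1 * g +
            (meanEnergy W ((1 : Matrix (Fin 2) (Fin 2) ℂ) ⊗ₖ envHamiltonian E) -
            meanEnergy (tensor σ) (envHamiltonian E))| ≤ ε' := by
  obtain ⟨N, E, U, hU, hE⟩ := (hall (p 1 * g) (qubit g) _
    (diagonal_two_isDensity hq0 hq1)).exists_unitary hε hε'
  refine ⟨N, E, U, hU, ?_⟩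
  rintro σ hσ ω W rfl rfl
  obtain ⟨h1, h2⟩ := hE (Matrix.diagonal fun i => (p i : ℂ)) ⟨diagonal_two_isDensity hp0 hp1,
      (meanEnergy_two (Matrix.diagonal fun i => (p i : ℂ)) g).trans (by simp)⟩ σ hσ
  refine ⟨fun a => ?_, ?_⟩
  · have h3 := abs_re_sub_le (h1 a a)
    rw [Matrix.diagonal_apply_eq, Complex.ofReal_re] at h3
    exact h3
  · refine le_of_eq_of_le ?_ h2
    congr 2
    exact congrArg (fun t => t - p 1 * g) (meanEnergy_two _ g).symm

/-- A qubit with zero Hamiltonian cannot go from maximally mixed to pure: its entropy would have to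
move into a Gibbs environment of nearly unchanged energy. The tolerance `ε'` is such that `|b| * ε'
≤ 1 / 100`. -/
lemma not_everyTransitionPossible_of_thermal_coe {f : Hamiltonian → ℝ}
    {b : ℝ} (h : ∀ H, f H = thermalEnergy (b : EReal) H) :
    ¬ EveryTransitionPossible f := by
  intro hall
  obtain ⟨N, E, U, hU, hE⟩ := hall.exists_unitary_qubit 0 (p := fun _ => 1 / 2) (q := ![1, 0])
    (fun i => by norm_num) (by norm_num) (fun i => by fin_cases i <;> simp) (by simp)
    (ε := 1 / 100) (by norm_num) (ε' := 1 / (100 * (|b| + 1))) (by positivity)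
  have hσ : ∀ i, gibbsState b (E i) ∈ microstates (f (E i)) (E i) := fun i =>
    ⟨gibbsState_isDensity b (E i), by rw [h]; simp [thermalEnergy]⟩
  obtain ⟨h1, h2⟩ := hE (fun i => gibbsState b (E i)) hσ _ _ rfl rfl
  set ω : Matrix (Fin 2 × EnvIdx E) (Fin 2 × EnvIdx E) ℂ :=
    (Matrix.diagonal fun _ : Fin 2 => ((1 / 2 : ℝ) : ℂ)) ⊗ₖ tensor (fun i => gibbsState b (E i))
    with hω
  have hω' : ω = ((1 : Matrix (Fin 2) (Fin 2) ℂ) ⊗ₖ envBasis E) *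
      Matrix.diagonal (fun i : Fin 2 × EnvIdx E => ((1 / 2 * envWeight E b i.2 : ℝ) : ℂ)) *
        ((1 : Matrix (Fin 2) (Fin 2) ℂ) ⊗ₖ envBasis E)ᴴ := by
    have : Matrix.diagonal (fun i : Fin 2 × EnvIdx E => ((1 / 2 * envWeight E b i.2 : ℝ) : ℂ)) =
        (Matrix.diagonal fun _ : Fin 2 => ((1 / 2 : ℝ) : ℂ)) ⊗ₖ
          Matrix.diagonal (fun x => (envWeight E b x : ℂ)) := by
      rw [Matrix.diagonal_kronecker_diagonal]
      congr 1
      ext i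
      push_cast
      rfl
    rw [this, kronecker_conj_mul, hω, tensor_gibbsState]
  have hc : 0 ≤ 1 / 2 * ∏ i, (partitionFunction (E i).isHermitian.eigenvalues b)⁻¹ :=
    mul_nonneg (by norm_num)
      (Finset.prod_nonneg fun i _ => (inv_pos.2 (partitionFunction_pos _ _)).le)
  -- The function `g` is `-1/2` on level `0` and `1` on level `1`. Its final mean would be close to
  -- `-1/2`, whereas the left side `1 - (exp (1/2) + exp (-1)) / 2` is about `-0.008`.
  have h3 := gibbs_variational_conj hU (one_kronecker_unitary (envBasis_unitary E))
    (fun i : Fin 2 × EnvIdx E => (![-(1 / 2), 1] i.1 : ℝ)) hc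
    (fun i => by rw [envWeight_eq, mul_assoc])
    (one_kronecker_eq_conj (envHamiltonian_eq_envBasis E)) hω'
  have h4 : ∑ i : Fin 2 × EnvIdx E,
      ((((1 : Matrix (Fin 2) (Fin 2) ℂ) ⊗ₖ envBasis E)ᴴ * (U * ω * Uᴴ) *
        ((1 : Matrix (Fin 2) (Fin 2) ℂ) ⊗ₖ envBasis E)) i i).re * ![-(1 / 2), 1] i.1 =
      -(1 / 2) * (traceEnv (U * ω * Uᴴ) 0 0).re + (traceEnv (U * ω * Uᴴ) 1 1).re := by
    rw [← traceEnv_conj (U * ω * Uᴴ) (envBasis_unitary E), Fintype.sum_prod_type,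
      Fin.sum_univ_two]
    simp only [traceEnv, Matrix.of_apply, Complex.re_sum, ← Finset.sum_mul]
    simp
    ring
  have h5 : ∑ i : Fin 2 × EnvIdx E, 1 / 2 * envWeight E b i.2 = 1 := by
    rw [Fintype.sum_prod_type, Fin.sum_univ_two, ← Finset.mul_sum, sum_envWeight]
    norm_num
  have h6 : ∑ i : Fin 2 × EnvIdx E, 1 / 2 * envWeight E b i.2 *
      Real.exp (-(![-(1 / 2), 1] i.1 : ℝ)) = 1 / 2 * Real.exp (1 / 2) + 1 / 2 * Real.exp (-1) := by
    rw [Fintype.sum_prod_type, Fin.sum_univ_two]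
    simp only [← Finset.sum_mul, ← Finset.mul_sum, sum_envWeight]
    simp
  rw [h4, h5, h6, hω, meanEnergy_kronecker (diagonal_two_isDensity (fun i => by norm_num)
    (by norm_num)), ← hω] at h3
  have h7 := h1 0
  have h8 := h1 1
  simp only [Matrix.cons_val_zero, Matrix.cons_val_one] at h7 h8
  rw [mul_zero, mul_zero, sub_zero, zero_add] at h2
  have h9 : b * (meanEnergy (U * ω * Uᴴ)
      ((1 : Matrix (Fin 2) (Fin 2) ℂ) ⊗ₖ envHamiltonian E) -
        meanEnergy (tensor fun i => gibbsState b (E i)) (envHamiltonian E)) ≤ 1 / 100 := by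
    refine (le_abs_self _).trans ?_
    rw [abs_mul]
    calc _ ≤ |b| * (1 / (100 * (|b| + 1))) := mul_le_mul_of_nonneg_left h2 (abs_nonneg b)
      _ ≤ 1 / 100 := by
        rw [mul_one_div, div_le_div_iff₀ (by positivity) (by norm_num)]
        nlinarith [abs_nonneg b]
  have e1 : Real.exp (1 / 2) < 33 / 20 := by
    have h := Real.exp_one_lt_d9
    have h' : Real.exp 1 = Real.exp (1 / 2) * Real.exp (1 / 2) := by
      rw [← Real.exp_add]; norm_num
    nlinarith [Real.exp_pos (1 / 2)]
  have e2 := Real.exp_neg_one_lt_d9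
  linarith [(abs_le.1 h7).1, (abs_le.1 h8).2]

lemma not_everyTransitionPossible_of_thermal {f : Hamiltonian → ℝ}
    (hf : ∀ H, (microstates (f H) H).Nonempty) {β : EReal} (h : ∀ H, f H = thermalEnergy β H) :
    ¬ EveryTransitionPossible f := by
  -- For a qubit of gap `1`, the errors `1 / 4` in the population and `1 / 4` in the energy add up
  -- to `1 / 2`, so flipping the qubit forces an environment energy change of at least `1 / 2`.
  have hred : ∀ p q : Fin 2 → ℝ, (∀ i, 0 ≤ p i) → p 0 + p 1 = 1 → (∀ i, 0 ≤ q i) →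
      q 0 + q 1 = 1 → EveryTransitionPossible f →
      ∃ (N : ℕ) (E : Fin N → Hamiltonian) (W : Matrix (Fin 2 × EnvIdx E) (Fin 2 × EnvIdx E) ℂ),
        IsDensity W ∧ |(q 1 - p 1) + (meanEnergy W
          ((1 : Matrix (Fin 2) (Fin 2) ℂ) ⊗ₖ envHamiltonian E) - ∑ i, f (E i))| ≤ 1 / 2 := by
    intro p q hp0 hp1 hq0 hq1 hall
    obtain ⟨N, E, U, hU, hE⟩ := hall.exists_unitary_qubit 1 hp0 hp1 hq0 hq1
      (ε := 1 / 4) (by norm_num) (ε' := 1 / 4) (by norm_num)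
    choose σ hσ using fun i => hf (E i)
    have hσd : ∀ i, IsDensity (σ i) := fun i => (hσ i).1
    obtain ⟨h1, h2⟩ := hE σ hσ _ _ rfl rfl
    refine ⟨N, E, U * ((Matrix.diagonal fun i => (p i : ℂ)) ⊗ₖ tensor σ) * Uᴴ,
      ((diagonal_two_isDensity hp0 hp1).kronecker (IsDensity.tensor hσd)).conj hU, ?_⟩
    rw [meanEnergy_tensor hσd, Finset.sum_congr rfl fun i _ => (hσ i).2] at h2
    have h3 := h1 1
    rw [abs_le] at h2 h3 ⊢
    constructor <;> linarith [h2.1, h2.2, h3.1, h3.2]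
  rcases eq_or_ne β ⊤ with htop | htop
  · intro hall
    obtain ⟨N, E, W, hW, h1⟩ := hred ![1, 0] ![0, 1] (fun i => by fin_cases i <;> simp) (by simp)
      (fun i => by fin_cases i <;> simp) (by simp) hall
    have h2 := le_meanEnergy_of_le hW (one_kronecker_unitary (envBasis_unitary E))
      (one_kronecker_eq_conj (envHamiltonian_eq_envBasis E))
      (fun i => sum_groundEnergy_le E i.2)
    have h3 : ∀ i, f (E i) = groundEnergy (E i) := fun i => by rw [h, thermalEnergy, if_pos htop]
    simp only [h3, Matrix.cons_val_one] at h1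
    have := (abs_le.1 h1).2
    norm_num at this
    linarith
  rcases eq_or_ne β ⊥ with hbot | hbot
  · intro hall
    obtain ⟨N, E, W, hW, h1⟩ := hred ![0, 1] ![1, 0] (fun i => by fin_cases i <;> simp) (by simp)
      (fun i => by fin_cases i <;> simp) (by simp) hall
    have h2 := meanEnergy_le_of_le hW (one_kronecker_unitary (envBasis_unitary E))
      (one_kronecker_eq_conj (envHamiltonian_eq_envBasis E))
      (fun i => le_sum_topEnergy E i.2)
    have h3 : ∀ i, f (E i) = topEnergy (E i) := fun i => by
      rw [h, thermalEnergy, if_neg htop, if_pos hbot]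
    simp only [h3, Matrix.cons_val_one] at h1
    have := (abs_le.1 h1).1
    norm_num at this
    linarith
  · rw [← EReal.coe_toReal htop hbot] at h
    exact not_everyTransitionPossible_of_thermal_coe h

/-! ### Expectation values of concentrated states. -/

section GentleMeasurement

open scoped Matrix.Norms.L2Operator

variable {ι : Type*} [Fintype ι] [DecidableEq ι]

lemma norm_dotProduct_mulVec_le (B : Matrix ι ι ℂ) (u w : ι → ℂ) :
    ‖star u ⬝ᵥ B *ᵥ w‖ ≤ ‖B‖ * (√(∑ i, ‖u i‖ ^ 2) * √(∑ i, ‖w i‖ ^ 2)) := by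
  have h1 : star u ⬝ᵥ B *ᵥ w = inner ℂ (WithLp.toLp 2 u) (WithLp.toLp 2 (B *ᵥ w)) := by
    rw [EuclideanSpace.inner_eq_star_dotProduct, dotProduct_comm]
  rw [h1]
  refine (norm_inner_le_norm _ _).trans ?_
  have h2 := Matrix.l2_opNorm_mulVec B (WithLp.toLp 2 w)
  rw [← EuclideanSpace.norm_eq (WithLp.toLp 2 u), ← EuclideanSpace.norm_eq (WithLp.toLp 2 w)]
  calc _ ≤ ‖WithLp.toLp 2 u‖ * (‖B‖ * ‖WithLp.toLp 2 w‖) :=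
        mul_le_mul_of_nonneg_left h2 (norm_nonneg _)
    _ = _ := by ring

/-- If `ω` is concentrated on the basis vectors in `T`, and `B` is diagonal there, then `Tr(ωB)` is
close to the sum of these diagonal entries. -/
lemma norm_trace_mul_sub_le {ω B : Matrix ι ι ℂ} (hω : IsDensity ω) (T : Finset ι) {b : ι → ℂ}
    (hB : ∀ i ∈ T, ∀ j ∈ T, B i j = if i = j then b i else 0) {τ : ℝ}
    (hτ : ∑ i ∈ Tᶜ, (ω i i).re ≤ τ) :
    ‖(ω * B).trace - ∑ i ∈ T, ω i i * b i‖ ≤ 2 * ‖B‖ * √τ := by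
  obtain ⟨S, hS⟩ := exists_eq_mul_conjTranspose hω.1
  -- With `ω = S * Sᴴ`, the trace is a sum of sandwiches by the columns of `S`. Each column splits
  -- into its part `P j` on `T`, which produces the diagonal sum, and a rest `Q j`; the terms
  -- containing `Q j` are estimated by Cauchy–Schwarz, first in each column and then over the
  -- columns.
  set P : ι → ι → ℂ := fun j i => if i ∈ T then S i j else 0 with hP
  set Q : ι → ι → ℂ := fun j i => if i ∈ T then 0 else S i j with hQ
  have hPQ : ∀ j, S.col j = P j + Q j := by
    intro j; ext i; simp only [hP, hQ, Pi.add_apply, Matrix.col_apply]; split_ifs <;> simp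
  have htr : (ω * B).trace = ∑ j, star (S.col j) ⬝ᵥ B *ᵥ S.col j := by
    rw [hS, mul_assoc, Matrix.trace_mul_comm]
    simp only [Matrix.trace, Matrix.diag_apply, mul_assoc]
    refine Finset.sum_congr rfl fun j _ => ?_
    rw [Matrix.mul_apply]
    simp only [dotProduct, Matrix.conjTranspose_apply, Pi.star_apply, Matrix.col_apply,
      Matrix.mulVec, Matrix.mul_apply]
  have hdiag : ∀ i, ω i i = ∑ j, star (S i j) * S i j := by
    intro i
    rw [hS, Matrix.mul_apply]
    exact Finset.sum_congr rfl fun j _ => by rw [Matrix.conjTranspose_apply, mul_comm]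
  have hdiagre : ∀ i, (ω i i).re = ∑ j, ‖S i j‖ ^ 2 := by
    intro i
    rw [hdiag, Complex.re_sum]
    refine Finset.sum_congr rfl fun j _ => ?_
    rw [← Complex.normSq_eq_norm_sq, Complex.normSq_apply]
    simp
  have hPP : ∑ j, star (P j) ⬝ᵥ B *ᵥ P j = ∑ i ∈ T, ω i i * b i := by
    have : ∀ j, star (P j) ⬝ᵥ B *ᵥ P j = ∑ i ∈ T, star (S i j) * S i j * b i := by
      intro j
      simp only [dotProduct, Matrix.mulVec, Pi.star_apply, hP, apply_ite star, star_zero, ite_mul,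
        zero_mul, mul_ite, mul_zero, Finset.sum_ite_mem, Finset.univ_inter]
      refine Finset.sum_congr rfl fun i hi => ?_
      rw [Finset.sum_eq_single_of_mem i hi]
      · rw [hB i hi i hi, if_pos rfl]; ring
      · intro k hk hki
        rw [hB i hi k hk, if_neg hki.symm, zero_mul]
    simp only [this]
    rw [Finset.sum_comm]
    refine Finset.sum_congr rfl fun i _ => ?_
    rw [hdiag, Finset.sum_mul]
  have hsplit : (ω * B).trace - ∑ i ∈ T, ω i i * b i =
      ∑ j, (star (Q j) ⬝ᵥ B *ᵥ S.col j + star (P j) ⬝ᵥ B *ᵥ Q j) := by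
    rw [htr, ← hPP, ← Finset.sum_sub_distrib]
    refine Finset.sum_congr rfl fun j _ => ?_
    rw [hPQ j]
    simp only [star_add, add_dotProduct, Matrix.mulVec_add, dotProduct_add]
    ring
  have hS0 : ∀ j, 0 ≤ ∑ i, ‖S.col j i‖ ^ 2 := fun j => Finset.sum_nonneg fun i _ => by positivity
  have hPS : ∀ j, √(∑ i, ‖P j i‖ ^ 2) ≤ √(∑ i, ‖S.col j i‖ ^ 2) := by
    intro j
    refine Real.sqrt_le_sqrt (Finset.sum_le_sum fun i _ => ?_)
    simp only [hP, Matrix.col_apply]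
    split_ifs
    · exact le_rfl
    · simp
  have hbound : ∀ j, ‖star (Q j) ⬝ᵥ B *ᵥ S.col j + star (P j) ⬝ᵥ B *ᵥ Q j‖ ≤
      2 * ‖B‖ * (√(∑ i, ‖Q j i‖ ^ 2) * √(∑ i, ‖S.col j i‖ ^ 2)) := by
    intro j
    refine (norm_add_le _ _).trans ?_
    have h1 := norm_dotProduct_mulVec_le B (Q j) (S.col j)
    have h2 := norm_dotProduct_mulVec_le B (P j) (Q j)
    have h3 : ‖B‖ * (√(∑ i, ‖P j i‖ ^ 2) * √(∑ i, ‖Q j i‖ ^ 2)) ≤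
        ‖B‖ * (√(∑ i, ‖S.col j i‖ ^ 2) * √(∑ i, ‖Q j i‖ ^ 2)) :=
      mul_le_mul_of_nonneg_left (mul_le_mul_of_nonneg_right (hPS j) (Real.sqrt_nonneg _))
        (norm_nonneg _)
    linarith
  have hQτ : ∑ j, ∑ i, ‖Q j i‖ ^ 2 ≤ τ := by
    refine le_of_eq_of_le ?_ hτ
    rw [Finset.sum_comm, ← Finset.sum_add_sum_compl T, Finset.sum_eq_zero, zero_add]
    · refine Finset.sum_congr rfl fun i hi => ?_
      rw [hdiagre]
      exact Finset.sum_congr rfl fun j _ => by simp [hQ, Finset.mem_compl.1 hi]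
    · intro i hi
      exact Finset.sum_eq_zero fun j _ => by simp [hQ, hi]
  have hS1 : ∑ j, ∑ i, ‖S.col j i‖ ^ 2 = 1 := by
    rw [Finset.sum_comm, ← hω.sum_diag]
    exact Finset.sum_congr rfl fun i _ => (hdiagre i).symm
  rw [hsplit]
  calc _ ≤ ∑ j, 2 * ‖B‖ * (√(∑ i, ‖Q j i‖ ^ 2) * √(∑ i, ‖S.col j i‖ ^ 2)) :=
        (norm_sum_le _ _).trans (Finset.sum_le_sum fun j _ => hbound j)
    _ = 2 * ‖B‖ * ∑ j, √(∑ i, ‖Q j i‖ ^ 2) * √(∑ i, ‖S.col j i‖ ^ 2) := by rw [Finset.mul_sum]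
    _ ≤ 2 * ‖B‖ * (√(∑ j, ∑ i, ‖Q j i‖ ^ 2) * √(∑ j, ∑ i, ‖S.col j i‖ ^ 2)) := by
        refine mul_le_mul_of_nonneg_left ?_ (by positivity)
        exact Real.sum_sqrt_mul_sqrt_le Finset.univ
          (fun j => Finset.sum_nonneg fun i _ => by positivity) hS0
    _ ≤ 2 * ‖B‖ * √τ := by
        rw [hS1, Real.sqrt_one, mul_one]
        exact mul_le_mul_of_nonneg_left (Real.sqrt_le_sqrt hQτ) (by positivity)

lemma norm_conj_of_unitary {U : Matrix ι ι ℂ} (hU : U ∈ Matrix.unitaryGroup ι ℂ)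
    (B : Matrix ι ι ℂ) : ‖Uᴴ * B * U‖ = ‖B‖ := by
  rw [CStarRing.norm_mul_mem_unitary _ hU,
    CStarRing.norm_mem_unitary_mul _ (conjTranspose_mem_unitary hU)]

lemma norm_single_kronecker_one_le {κ : Type*} [Fintype κ] [DecidableEq κ] (a b : ι) :
    ‖Matrix.single a b (1 : ℂ) ⊗ₖ (1 : Matrix κ κ ℂ)‖ ≤ 1 := by
  have h1 : (Matrix.single a b (1 : ℂ) ⊗ₖ (1 : Matrix κ κ ℂ))ᴴ *
      (Matrix.single a b (1 : ℂ) ⊗ₖ (1 : Matrix κ κ ℂ)) =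
      Matrix.diagonal fun i : ι × κ => if i.1 = b then 1 else 0 := by
    rw [Matrix.conjTranspose_kronecker, ← Matrix.mul_kronecker_mul, Matrix.conjTranspose_single,
      star_one, Matrix.single_mul_single_same, mul_one, Matrix.conjTranspose_one, mul_one]
    have : Matrix.single b b (1 : ℂ) = Matrix.diagonal fun i => if i = b then 1 else 0 := by
      ext i j
      by_cases hij : i = j
      · subst hij; simp [Matrix.single_apply, eq_comm]
      · rw [Matrix.diagonal_apply_ne _ hij, Matrix.single_apply, if_neg]
        rintro ⟨rfl, rfl⟩; exact hij rfl
    rw [this, ← Matrix.diagonal_one, Matrix.diagonal_kronecker_diagonal]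
    simp
  have h2 := Matrix.l2_opNorm_conjTranspose_mul_self
    (Matrix.single a b (1 : ℂ) ⊗ₖ (1 : Matrix κ κ ℂ))
  have h3 : ‖Matrix.diagonal fun i : ι × κ => if i.1 = b then (1 : ℂ) else 0‖ ≤ 1 := by
    rw [Matrix.l2_opNorm_diagonal, pi_norm_le_iff_of_nonneg zero_le_one]
    intro i
    split_ifs <;> simp
  rw [h1] at h2
  nlinarith [norm_nonneg (Matrix.single a b (1 : ℂ) ⊗ₖ (1 : Matrix κ κ ℂ))]

end GentleMeasurement

/-! ### Extending an orthonormal family to a unitary. -/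

section UnitaryExtension

variable {ι : Type*} [Fintype ι] [DecidableEq ι]

lemma exists_unitary_of_orthonormal (w : ι → ι → ℂ) (T : Set ι)
    (hw : ∀ i ∈ T, ∀ j ∈ T, star (w i) ⬝ᵥ w j = if i = j then 1 else 0) :
    ∃ U ∈ Matrix.unitaryGroup ι ℂ, ∀ j ∈ T, ∀ i, U i j = w j i := by
  have ho : Orthonormal ℂ (T.domRestrict fun i => (WithLp.toLp 2 (w i) : EuclideanSpace ℂ ι)) := by
    rw [orthonormal_iff_ite]
    rintro ⟨i, hi⟩ ⟨j, hj⟩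
    rw [Set.domRestrict_apply, Set.domRestrict_apply, EuclideanSpace.inner_eq_star_dotProduct,
      dotProduct_comm, hw i hi j hj]
    simp
  obtain ⟨b, hb⟩ := ho.exists_orthonormalBasis_extension_of_card_eq (by simp)
  refine ⟨(EuclideanSpace.basisFun ι ℂ).toBasis.toMatrix b.toBasis,
    (EuclideanSpace.basisFun ι ℂ).toMatrix_orthonormalBasis_mem_unitary b, fun j hj i => ?_⟩
  rw [Module.Basis.toMatrix_apply]
  simp [hb j hj]

end UnitaryExtension

/-! ### The unitary that prepares a state and shifts the energy. -/

section Shift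

variable {ι κ : Type*} [Fintype ι] [DecidableEq ι] [Fintype κ] [DecidableEq κ]

/-- The vector `∑ₖ R|k⟩ ⊗ |φ k⟩`. -/
noncomputable def shiftVec (R : Matrix ι ι ℂ) (φ : ι → κ) (i : ι × κ) : ℂ :=
  ∑ k, if i.2 = φ k then R i.1 k else 0

lemma shiftVec_sandwich (R A : Matrix ι ι ℂ) (g : κ → ℂ) (φ ψ : ι → κ) :
    star (shiftVec R φ) ⬝ᵥ (A ⊗ₖ Matrix.diagonal g) *ᵥ shiftVec R ψ =
      ∑ k, ∑ k', if φ k = ψ k' then (Rᴴ * A * R) k k' * g (φ k) else 0 := by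
  have h1 : ∀ a y, ((A ⊗ₖ Matrix.diagonal g) *ᵥ shiftVec R ψ) (a, y) =
      ∑ k', if y = ψ k' then (A * R) a k' * g y else 0 := by
    intro a y
    have h : ∀ a', ∑ y', A a a' * Matrix.diagonal g y y' *
        ∑ k, (if y' = ψ k then R a' k else 0) =
        ∑ k, if y = ψ k then A a a' * R a' k * g y else 0 := by
      intro a'
      rw [Finset.sum_eq_single y]
      · rw [Matrix.diagonal_apply_eq, Finset.mul_sum]
        refine Finset.sum_congr rfl fun k _ => ?_
        split_ifs <;> ring
      · intro y' _ hy
        rw [Matrix.diagonal_apply_ne _ hy.symm, mul_zero, zero_mul]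
      · simp
    simp only [Matrix.mulVec, dotProduct, Fintype.sum_prod_type, Matrix.kroneckerMap_apply,
      shiftVec]
    rw [Finset.sum_congr rfl fun a' _ => h a', Finset.sum_comm]
    refine Finset.sum_congr rfl fun k _ => ?_
    split_ifs
    · rw [Matrix.mul_apply, Finset.sum_mul]
    · simp
  have h2 : ∀ a : ι, ∑ y : κ, star (shiftVec R φ (a, y)) *
      ∑ k', (if y = ψ k' then (A * R) a k' * g y else 0) =
      ∑ k : ι, ∑ k' : ι, if φ k = ψ k' then star (R a k) * ((A * R) a k' * g (φ k)) else 0 := by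
    intro a
    simp only [shiftVec, star_sum, apply_ite star, star_zero, Finset.sum_mul]
    rw [Finset.sum_comm]
    refine Finset.sum_congr rfl fun k _ => ?_
    rw [Finset.sum_eq_single (φ k)]
    · rw [if_pos rfl, Finset.mul_sum]
      exact Finset.sum_congr rfl fun k' _ => by split_ifs <;> simp
    · intro y _ hy; rw [if_neg hy, zero_mul]
    · simp
  rw [dotProduct, Fintype.sum_prod_type]
  simp only [h1, Pi.star_apply]
  rw [Finset.sum_congr rfl fun a _ => h2 a, Finset.sum_comm]
  refine Finset.sum_congr rfl fun k _ => ?_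
  rw [Finset.sum_comm]
  refine Finset.sum_congr rfl fun k' _ => ?_
  split_ifs
  · rw [Matrix.mul_assoc, Matrix.mul_apply, Finset.sum_mul]
    exact Finset.sum_congr rfl fun a _ => by rw [Matrix.conjTranspose_apply, mul_assoc]
  · simp

/-- For an injective family `φ`, the vectors `shiftVec R (φ j)` diagonalize product operators. -/
lemma shiftVec_sandwich_of_injective {R A : Matrix ι ι ℂ} {g : κ → ℂ} {J : Type*} [DecidableEq J]
    {φ : J → ι → κ} {T : Set J}
    (hφ : ∀ i ∈ T, ∀ j ∈ T, ∀ k k', φ i k = φ j k' → i = j ∧ k = k') {i j : J} (hi : i ∈ T)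
    (hj : j ∈ T) :
    star (shiftVec R (φ i)) ⬝ᵥ (A ⊗ₖ Matrix.diagonal g) *ᵥ shiftVec R (φ j) =
      if i = j then ∑ k, (Rᴴ * A * R) k k * g (φ i k) else 0 := by
  rw [shiftVec_sandwich]
  split_ifs with h
  · subst h
    refine Finset.sum_congr rfl fun k _ => ?_
    rw [Finset.sum_eq_single k]
    · rw [if_pos rfl]
    · intro k' _ hk
      rw [if_neg fun he => hk (hφ i hi i hi k k' he).2.symm]
    · simp
  · refine Finset.sum_eq_zero fun k _ => Finset.sum_eq_zero fun k' _ => ?_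
    rw [if_neg fun he => h (hφ i hi j hj k k' he).1]

lemma conj_apply_eq_dotProduct {J : Type*} [Fintype J] (U O : Matrix J J ℂ) (i j : J) :
    (Uᴴ * O * U) i j = star (U.col i) ⬝ᵥ O *ᵥ U.col j := by
  rw [Matrix.mul_assoc, Matrix.mul_apply]
  simp only [dotProduct, Matrix.conjTranspose_apply, Pi.star_apply, Matrix.col_apply,
    Matrix.mulVec, Matrix.mul_apply]

-- With `ρf = R * Rᴴ`, the unitary sends the basis vector `i` over `T` to `∑ₖ R|k⟩ ⊗ |φ i k⟩`. As
-- all labels `φ i k` differ, these vectors are orthonormal, each has reduced state `ρf`, and its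
-- environment energy is a mean of `l (φ i k)`, close to `l i.2 + Δ`. Product operators become
-- diagonal on `T`, so coherences of `ω` within `T` do not matter and leakage out of `T` costs order
-- `√τ`.
open scoped Matrix.Norms.L2Operator in
lemma exists_unitary_shift_diagonal {l : κ → ℝ} {C : ℝ} (hC : ∀ x, |l x| ≤ C)
    (T : Finset κ) {φ : ι × κ → ι → κ}
    (hφ : ∀ i j : ι × κ, i.2 ∈ T → j.2 ∈ T → ∀ k k', φ i k = φ j k' → i = j ∧ k = k') {Δ ε : ℝ}
    (hε : 0 ≤ ε) (hΔ : ∀ i : ι × κ, i.2 ∈ T → ∀ k, |l (φ i k) - l i.2 - Δ| ≤ ε)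
    {ρf : Matrix ι ι ℂ} (hρf : IsDensity ρf) :
    ∃ U ∈ Matrix.unitaryGroup (ι × κ) ℂ, ∀ ω : Matrix (ι × κ) (ι × κ) ℂ, IsDensity ω →
      ∀ τ : ℝ, ∑ i with i.2 ∉ T, (ω i i).re ≤ τ → τ ≤ 1 →
        (∀ a b, ‖traceEnv (U * ω * Uᴴ) a b - ρf a b‖ ≤ (2 + ‖ρf a b‖) * √τ) ∧
        |meanEnergy (U * ω * Uᴴ) (Matrix.diagonal fun i : ι × κ => (l i.2 : ℂ)) -
          meanEnergy ω (Matrix.diagonal fun i : ι × κ => (l i.2 : ℂ)) - Δ| ≤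
            ε + (3 * C + |Δ|) * √τ := by
  obtain ⟨R, hR⟩ := exists_eq_mul_conjTranspose hρf.1
  have hφ' : ∀ i ∈ {i : ι × κ | i.2 ∈ T}, ∀ j ∈ {i : ι × κ | i.2 ∈ T}, ∀ k k',
      φ i k = φ j k' → i = j ∧ k = k' := fun i hi j hj => hφ i j hi hj
  have hRR : ∑ k, (Rᴴ * R) k k = 1 := by
    have := hρf.2
    rwa [hR, Matrix.trace_mul_comm] at this
  obtain ⟨U, hU, hUw⟩ := exists_unitary_of_orthonormal (fun i => shiftVec R (φ i))
    {i : ι × κ | i.2 ∈ T} (by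
      intro i hi j hj
      have h := shiftVec_sandwich_of_injective (R := R) (A := 1) (g := fun _ => 1) hφ' hi hj
      rw [Matrix.diagonal_one, Matrix.one_kronecker_one, Matrix.one_mulVec] at h
      rw [h]
      simp only [mul_one, hRR])
  have hcol : ∀ i : ι × κ, i.2 ∈ T → U.col i = shiftVec R (φ i) := fun i hi =>
    funext fun j => hUw i hi j
  refine ⟨U, hU, fun ω hω τ hτ hτ1 => ?_⟩
  have hT : (Finset.univ.filter fun i : ι × κ => i.2 ∈ T)ᶜ =
      Finset.univ.filter fun i : ι × κ => i.2 ∉ T := by ext i; simp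
  rw [← hT] at hτ
  -- The lost mass enters also linearly; as `τ ≤ 1`, such terms are absorbed in `√τ`.
  have hsq : τ ≤ √τ := by
    rcases le_or_gt τ 0 with h | h
    · exact h.trans (Real.sqrt_nonneg _)
    · exact Real.le_sqrt_of_sq_le (by nlinarith)
  have htail0 : 0 ≤ ∑ i ∈ (Finset.univ.filter fun i : ι × κ => i.2 ∈ T)ᶜ, (ω i i).re :=
    Finset.sum_nonneg fun i _ => hω.diag_nonneg i
  have hω1 : ∀ i, ω i i = ((ω i i).re : ℂ) := fun i => PosSemidef.diag_eq_re hω.1 i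
  have hsum : ∑ i with i.2 ∈ T, ω i i =
      1 - ((∑ i ∈ (Finset.univ.filter fun i : ι × κ => i.2 ∈ T)ᶜ, (ω i i).re : ℝ) : ℂ) := by
    rw [eq_sub_iff_add_eq, Complex.ofReal_sum, ← Finset.sum_congr rfl fun i _ => hω1 i,
      Finset.sum_add_sum_compl]
    exact hω.2
  have key : ∀ (A : Matrix ι ι ℂ) (g : κ → ℂ), ‖(U * ω * Uᴴ * A ⊗ₖ Matrix.diagonal g).trace -
      ∑ i with i.2 ∈ T, ω i i * ∑ k, (Rᴴ * A * R) k k * g (φ i k)‖ ≤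
        2 * ‖A ⊗ₖ Matrix.diagonal g‖ * √τ := by
    intro A g
    have h1 : (U * ω * Uᴴ * A ⊗ₖ Matrix.diagonal g).trace =
        (ω * (Uᴴ * A ⊗ₖ Matrix.diagonal g * U)).trace := by
      rw [mul_assoc, mul_assoc, Matrix.trace_mul_comm]
      simp only [mul_assoc]
    rw [h1, ← norm_conj_of_unitary hU (A ⊗ₖ Matrix.diagonal g)]
    refine norm_trace_mul_sub_le hω _ (fun i hi j hj => ?_) hτ
    rw [conj_apply_eq_dotProduct, hcol i (by simpa using hi), hcol j (by simpa using hj)]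
    exact shiftVec_sandwich_of_injective hφ' (by simpa using hi) (by simpa using hj)
  constructor
  · intro a b
    -- This operator reads off the entry `(a, b)` of the partial trace.
    have h1 := key (Matrix.single b a 1) (fun _ => 1)
    have h2 : ∑ k, (Rᴴ * Matrix.single b a 1 * R : Matrix ι ι ℂ) k k = ρf a b := by
      have : (Rᴴ * Matrix.single b a 1 * R).trace = ρf a b := by
        rw [Matrix.mul_assoc, Matrix.trace_mul_comm, Matrix.mul_assoc, ← hR,
          Matrix.trace_single_mul]
        simp
      exact this
    simp only [mul_one, h2, Matrix.diagonal_one] at h1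
    rw [← traceEnv_apply_eq, ← Finset.sum_mul, hsum] at h1
    set t : ℝ := ∑ i ∈ (Finset.univ.filter fun i : ι × κ => i.2 ∈ T)ᶜ, (ω i i).re
    have h3 : traceEnv (U * ω * Uᴴ) a b - ρf a b =
        (traceEnv (U * ω * Uᴴ) a b - (1 - (t : ℂ)) * ρf a b) - t * ρf a b := by ring
    rw [h3]
    refine (norm_sub_le _ _).trans ?_
    have h4 : ‖(t : ℂ) * ρf a b‖ ≤ √τ * ‖ρf a b‖ := by
      rw [norm_mul, Complex.norm_real, Real.norm_of_nonneg htail0]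
      exact mul_le_mul_of_nonneg_right (hτ.trans hsq) (norm_nonneg _)
    have h5 := mul_le_mul_of_nonneg_right (norm_single_kronecker_one_le (κ := κ) b a)
      (Real.sqrt_nonneg τ)
    linarith
  · have hD : (Matrix.diagonal fun i : ι × κ => (l i.2 : ℂ)) =
        (1 : Matrix ι ι ℂ) ⊗ₖ Matrix.diagonal fun y => (l y : ℂ) := by
      rw [← Matrix.diagonal_one, Matrix.diagonal_kronecker_diagonal]
      simp
    have hC0 : 0 ≤ C := by
      obtain ⟨i⟩ : Nonempty (ι × κ) := by
        by_contra hne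
        rw [not_nonempty_iff] at hne
        have := hω.sum_diag
        simp at this
      exact (abs_nonneg _).trans (hC i.2)
    have h1 := key 1 (fun y => (l y : ℂ))
    have hnorm : ‖(1 : Matrix ι ι ℂ) ⊗ₖ Matrix.diagonal fun y => (l y : ℂ)‖ ≤ C := by
      rw [← hD, Matrix.l2_opNorm_diagonal, pi_norm_le_iff_of_nonneg hC0]
      intro i
      rw [Complex.norm_real]
      exact hC i.2
    set w : ι → ℝ := fun k => ((Rᴴ * R) k k).re with hw
    have hw0 : ∀ k, 0 ≤ w k := fun k =>
      (Complex.nonneg_iff.1 (Matrix.posSemidef_conjTranspose_mul_self R).diag_nonneg).1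
    have hwR : ∀ k, (Rᴴ * R) k k = (w k : ℂ) := fun k =>
      PosSemidef.diag_eq_re (Matrix.posSemidef_conjTranspose_mul_self R) k
    have hw1 : ∑ k, w k = 1 := by
      have := congrArg Complex.re hRR
      simpa [hw] using this
    set q : ι × κ → ℝ := fun i => (ω i i).re with hq
    have hq0 : ∀ i, 0 ≤ q i := hω.diag_nonneg
    have hq1 : ∑ i, q i = 1 := hω.sum_diag
    have h2 : ∑ i with i.2 ∈ T, ω i i * ∑ k, (Rᴴ * 1 * R : Matrix ι ι ℂ) k k * (l (φ i k) : ℂ) =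
        ((∑ i with i.2 ∈ T, q i * ∑ k, w k * l (φ i k) : ℝ) : ℂ) := by
      push_cast
      refine Finset.sum_congr rfl fun i _ => ?_
      rw [hω1 i]
      congr 1
      refine Finset.sum_congr rfl fun k _ => ?_
      rw [mul_one, hwR]
    rw [h2] at h1
    have h3 : |meanEnergy (U * ω * Uᴴ) (Matrix.diagonal fun i : ι × κ => (l i.2 : ℂ)) -
        ∑ i with i.2 ∈ T, q i * ∑ k, w k * l (φ i k)| ≤ 2 * C * √τ := by
      unfold meanEnergy
      rw [hD]
      refine (abs_re_sub_le (b := ((∑ i with i.2 ∈ T, q i * ∑ k, w k * l (φ i k) : ℝ) : ℂ))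
        h1).trans ?_
      have := mul_le_mul_of_nonneg_right hnorm (Real.sqrt_nonneg τ)
      linarith
    have h4 : meanEnergy ω (Matrix.diagonal fun i : ι × κ => (l i.2 : ℂ)) = ∑ i, q i * l i.2 := by
      have := meanEnergy_conj_diagonal ω 1 fun i : ι × κ => l i.2
      simpa using this
    have h5 : ∀ i : ι × κ, i.2 ∈ T → |∑ k, w k * l (φ i k) - (l i.2 + Δ)| ≤ ε := by
      intro i hi
      have : ∑ k, w k * l (φ i k) - (l i.2 + Δ) = ∑ k, w k * (l (φ i k) - l i.2 - Δ) := by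
        calc _ = ∑ k, w k * l (φ i k) - (∑ k, w k) * (l i.2 + Δ) := by rw [hw1, one_mul]
          _ = _ := by
            rw [Finset.sum_mul, ← Finset.sum_sub_distrib]
            exact Finset.sum_congr rfl fun k _ => by ring
      rw [this]
      calc _ ≤ ∑ k, w k * ε := (Finset.abs_sum_le_sum_abs _ _).trans
            (Finset.sum_le_sum fun k _ => by
              rw [abs_mul, abs_of_nonneg (hw0 k)]
              exact mul_le_mul_of_nonneg_left (hΔ i hi k) (hw0 k))
        _ = ε := by rw [← Finset.sum_mul, hw1, one_mul]
    have h6 : |∑ i with i.2 ∈ T, q i * (∑ k, w k * l (φ i k) - (l i.2 + Δ))| ≤ ε := by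
      calc _ ≤ ∑ i with i.2 ∈ T, q i * ε := (Finset.abs_sum_le_sum_abs _ _).trans
            (Finset.sum_le_sum fun i hi => by
              rw [abs_mul, abs_of_nonneg (hq0 i)]
              exact mul_le_mul_of_nonneg_left (h5 i (Finset.mem_filter.1 hi).2) (hq0 i))
        _ ≤ ∑ i, q i * ε := Finset.sum_le_sum_of_subset_of_nonneg (Finset.filter_subset _ _)
            fun i _ _ => mul_nonneg (hq0 i) hε
        _ = ε := by rw [← Finset.sum_mul, hq1, one_mul]
    have h7 : |∑ i ∈ (Finset.univ.filter fun i : ι × κ => i.2 ∈ T)ᶜ, q i * (l i.2 + Δ)| ≤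
        (C + |Δ|) * √τ := by
      calc _ ≤ ∑ i ∈ (Finset.univ.filter fun i : ι × κ => i.2 ∈ T)ᶜ, q i * (C + |Δ|) :=
            (Finset.abs_sum_le_sum_abs _ _).trans (Finset.sum_le_sum fun i _ => by
              rw [abs_mul, abs_of_nonneg (hq0 i)]
              exact mul_le_mul_of_nonneg_left
                ((abs_add_le _ _).trans (by linarith [hC i.2])) (hq0 i))
        _ = (C + |Δ|) * ∑ i ∈ (Finset.univ.filter fun i : ι × κ => i.2 ∈ T)ᶜ, q i := by
            rw [← Finset.sum_mul, mul_comm]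
        _ ≤ _ := mul_le_mul_of_nonneg_left (hτ.trans hsq) (by positivity)
    have h8 : ∑ i with i.2 ∈ T, q i * ∑ k, w k * l (φ i k) =
        ∑ i, q i * l i.2 + Δ + ∑ i with i.2 ∈ T, q i * (∑ k, w k * l (φ i k) - (l i.2 + Δ)) -
          ∑ i ∈ (Finset.univ.filter fun i : ι × κ => i.2 ∈ T)ᶜ, q i * (l i.2 + Δ) := by
      have h9 : ∑ i, q i * (l i.2 + Δ) = ∑ i, q i * l i.2 + Δ := by
        simp only [mul_add, Finset.sum_add_distrib]
        rw [← Finset.sum_mul, hq1, one_mul]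
      rw [← h9, ← Finset.sum_add_sum_compl (Finset.univ.filter fun i : ι × κ => i.2 ∈ T)
        fun i => q i * (l i.2 + Δ)]
      simp only [mul_sub, Finset.sum_sub_distrib]
      ring
    rw [h8] at h3
    rw [h4]
    rw [abs_le] at h3 h6 h7 ⊢
    constructor <;> linarith [h3.1, h3.2, h6.1, h6.2, h7.1, h7.2]

lemma IsDensity.re_sum_kronecker {ρ : Matrix ι ι ℂ} (hρ : IsDensity ρ) {σ : Matrix κ κ ℂ}
    (T : Finset κ) :
    ∑ i with i.2 ∉ T, ((ρ ⊗ₖ σ) i i).re = ∑ x ∈ Tᶜ, (σ x x).re := by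
  have h : (Finset.univ.filter fun i : ι × κ => i.2 ∉ T) = Finset.univ ×ˢ Tᶜ := by
    ext i; simp
  rw [h, Finset.sum_product_right]
  refine Finset.sum_congr rfl fun x _ => ?_
  simp only [Matrix.kroneckerMap_apply]
  rw [← Complex.re_sum, ← Finset.sum_mul, show ∑ i, ρ i i = 1 from hρ.2, one_mul]

/-- A unitary that prepares `ρf` in the system and shifts the energy of the environment by `Δ`,
provided that the environment is concentrated on a set `T` of energy eigenstates from which there
are enough transitions with energy difference `Δ`. -/
lemma exists_unitary_shift {V HE : Matrix κ κ ℂ} (hV : V ∈ Matrix.unitaryGroup κ ℂ) {l : κ → ℝ}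
    (hHE : HE = V * Matrix.diagonal (fun x => (l x : ℂ)) * Vᴴ) {C : ℝ} (hC : ∀ x, |l x| ≤ C)
    (T : Finset κ) {φ : ι × κ → ι → κ}
    (hφ : ∀ i j : ι × κ, i.2 ∈ T → j.2 ∈ T → ∀ k k', φ i k = φ j k' → i = j ∧ k = k') {Δ ε : ℝ}
    (hε : 0 ≤ ε) (hΔ : ∀ i : ι × κ, i.2 ∈ T → ∀ k, |l (φ i k) - l i.2 - Δ| ≤ ε)
    {ρf : Matrix ι ι ℂ} (hρf : IsDensity ρf) :
    ∃ U ∈ Matrix.unitaryGroup (ι × κ) ℂ, ∀ ρ : Matrix ι ι ℂ, IsDensity ρ →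
      ∀ σ : Matrix κ κ ℂ, IsDensity σ →
      ∀ τ : ℝ, ∑ x ∈ Tᶜ, ((Vᴴ * σ * V) x x).re ≤ τ → τ ≤ 1 →
        (∀ a b, ‖traceEnv (U * (ρ ⊗ₖ σ) * Uᴴ) a b - ρf a b‖ ≤ (2 + ‖ρf a b‖) * √τ) ∧
        |meanEnergy (U * (ρ ⊗ₖ σ) * Uᴴ) ((1 : Matrix ι ι ℂ) ⊗ₖ HE) - meanEnergy σ HE - Δ| ≤
            ε + (3 * C + |Δ|) * √τ := by
  obtain ⟨U, hU, h⟩ := exists_unitary_shift_diagonal hC T hφ hε hΔ hρf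
  set X : Matrix (ι × κ) (ι × κ) ℂ := (1 : Matrix ι ι ℂ) ⊗ₖ V with hX
  have hXu : X ∈ Matrix.unitaryGroup (ι × κ) ℂ := one_kronecker_unitary hV
  refine ⟨X * U * Xᴴ, mul_mem (mul_mem hXu hU) (conjTranspose_mem_unitary hXu),
    fun ρ hρ σ hσ τ hτ hτ1 => ?_⟩
  have hω : ρ ⊗ₖ (Vᴴ * σ * V) = Xᴴ * (ρ ⊗ₖ σ) * X := by
    have := kronecker_conj_mul ρ σ Vᴴ
    rw [Matrix.conjTranspose_kronecker, Matrix.conjTranspose_one,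
      Matrix.conjTranspose_conjTranspose] at this
    rw [hX, ← this, Matrix.conjTranspose_kronecker, Matrix.conjTranspose_one]
  have hW : X * U * Xᴴ * (ρ ⊗ₖ σ) * (X * U * Xᴴ)ᴴ =
      X * (U * (ρ ⊗ₖ (Vᴴ * σ * V)) * Uᴴ) * Xᴴ := by
    rw [hω]
    simp only [Matrix.conjTranspose_mul, Matrix.conjTranspose_conjTranspose, mul_assoc]
  have hXX : ∀ M : Matrix (ι × κ) (ι × κ) ℂ, Xᴴ * (X * M * Xᴴ) * X = M := by
    intro M
    rw [mul_assoc X, ← mul_assoc Xᴴ X, conjTranspose_mul_self_of_unitary hXu, one_mul, mul_assoc,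
      conjTranspose_mul_self_of_unitary hXu, mul_one]
  obtain ⟨h1, h2⟩ := h (ρ ⊗ₖ (Vᴴ * σ * V)) (hρ.kronecker (hσ.conj' hV)) τ
    (by rw [hρ.re_sum_kronecker]; exact hτ) hτ1
  have hE : ∀ M : Matrix (ι × κ) (ι × κ) ℂ, meanEnergy M ((1 : Matrix ι ι ℂ) ⊗ₖ HE) =
      meanEnergy (Xᴴ * M * X) (Matrix.diagonal fun i : ι × κ => (l i.2 : ℂ)) := by
    intro M
    unfold meanEnergy
    rw [one_kronecker_eq_conj hHE, ← hX, ← mul_assoc, Matrix.trace_mul_comm, ← mul_assoc,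
      ← mul_assoc]
  constructor
  · intro a b
    rw [hW, ← traceEnv_conj _ hV, ← hX, hXX]
    exact h1 a b
  · rw [← meanEnergy_kronecker hρ σ HE, hE, hE, hW, hXX, ← hω]
    exact h2

end Shift

/-! ### A Chernoff bound. -/

section Concentration

variable {n : ℕ} {κ : Fin n → Type*} [∀ i, Fintype (κ i)]

lemma sum_prod_eq_prod_sum (F : ∀ i, κ i → ℝ) :
    ∑ x : ∀ i, κ i, ∏ i, F i (x i) = ∏ i, ∑ a, F i a := by
  classical
  rw [Finset.prod_univ_sum, Fintype.piFinset_univ]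

/-- From `exp y ≤ 1 + y + y²` for `|y| ≤ 1`: the linear term has mean zero, and `1 + v ≤ exp v`
makes the bound multiplicative over independent systems. -/
lemma sum_mul_exp_le {α : Type*} [Fintype α] {p Y : α → ℝ} (hp0 : ∀ a, 0 ≤ p a)
    (hp1 : ∑ a, p a = 1) (hY : ∑ a, p a * Y a = 0) {B s : ℝ} (hB : ∀ a, |Y a| ≤ B) (hs : 0 ≤ s)
    (hsB : s * B ≤ 1) : ∑ a, p a * Real.exp (s * Y a) ≤ Real.exp (s ^ 2 * B ^ 2) := by
  have h1 : ∀ a, p a * Real.exp (s * Y a) ≤ p a * (1 + s ^ 2 * B ^ 2) + s * (p a * Y a) := by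
    intro a
    have h2 : |s * Y a| ≤ 1 := by
      rw [abs_mul, abs_of_nonneg hs]
      exact (mul_le_mul_of_nonneg_left (hB a) hs).trans hsB
    have h3 := (abs_le.1 (Real.abs_exp_sub_one_sub_id_le h2)).2
    have h4 : (s * Y a) ^ 2 ≤ s ^ 2 * B ^ 2 := by
      rw [mul_pow, ← sq_abs (Y a)]
      exact mul_le_mul_of_nonneg_left (pow_le_pow_left₀ (abs_nonneg _) (hB a) 2) (sq_nonneg s)
    calc p a * Real.exp (s * Y a) ≤ p a * (1 + s ^ 2 * B ^ 2 + s * Y a) :=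
          mul_le_mul_of_nonneg_left (by linarith) (hp0 a)
      _ = _ := by ring
  calc _ ≤ ∑ a, (p a * (1 + s ^ 2 * B ^ 2) + s * (p a * Y a)) :=
        Finset.sum_le_sum fun a _ => h1 a
    _ = s ^ 2 * B ^ 2 + 1 := by
        rw [Finset.sum_add_distrib, ← Finset.sum_mul, ← Finset.mul_sum, hp1, hY]
        ring
    _ ≤ _ := Real.add_one_le_exp _

/-- A Chernoff bound for sums of independent bounded random variables of mean zero. -/
lemma sum_prod_le_exp {p Y : ∀ i, κ i → ℝ} (hp0 : ∀ i a, 0 ≤ p i a) (hp1 : ∀ i, ∑ a, p i a = 1)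
    (hY : ∀ i, ∑ a, p i a * Y i a = 0) {B s : ℝ} (hB : ∀ i a, |Y i a| ≤ B) (hs : 0 ≤ s)
    (hsB : s * B ≤ 1) (t : ℝ) (S : Finset (∀ i, κ i)) (hS : ∀ x ∈ S, t ≤ ∑ i, Y i (x i)) :
    ∑ x ∈ S, ∏ i, p i (x i) ≤ Real.exp (-s * t + n * (s ^ 2 * B ^ 2)) := by
  have hF : ∀ i, 0 ≤ ∑ a, p i a * Real.exp (s * Y i a) := fun i =>
    Finset.sum_nonneg fun a _ => mul_nonneg (hp0 i a) (Real.exp_pos _).le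
  have hprod : ∏ i, ∑ a, p i a * Real.exp (s * Y i a) ≤ Real.exp (n * (s ^ 2 * B ^ 2)) := by
    calc _ ≤ ∏ _i : Fin n, Real.exp (s ^ 2 * B ^ 2) :=
          Finset.prod_le_prod (fun i _ => hF i)
            fun i _ => sum_mul_exp_le (hp0 i) (hp1 i) (hY i) (hB i) hs hsB
      _ = _ := by rw [Finset.prod_const, Finset.card_univ, Fintype.card_fin, Real.exp_nat_mul]
  have h1 : ∀ x ∈ S, ∏ i, p i (x i) ≤
      Real.exp (-s * t) * ∏ i, (p i (x i) * Real.exp (s * Y i (x i))) := by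
    intro x hx
    rw [Finset.prod_mul_distrib, ← Real.exp_sum, ← Finset.mul_sum, mul_left_comm, ← Real.exp_add]
    refine le_mul_of_one_le_right (Finset.prod_nonneg fun i _ => hp0 i _) (Real.one_le_exp ?_)
    have := mul_le_mul_of_nonneg_left (hS x hx) hs
    linarith
  have h2 : ∀ x : ∀ i, κ i, 0 ≤ ∏ i, (p i (x i) * Real.exp (s * Y i (x i))) := fun x =>
    Finset.prod_nonneg fun i _ => mul_nonneg (hp0 i _) (Real.exp_pos _).le
  refine (Finset.sum_le_sum h1).trans ?_
  rw [← Finset.mul_sum, Real.exp_add]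
  refine mul_le_mul_of_nonneg_left (le_trans ?_ hprod) (Real.exp_pos _).le
  rw [← sum_prod_eq_prod_sum fun i a => p i a * Real.exp (s * Y i a)]
  exact Finset.sum_le_sum_of_subset_of_nonneg (Finset.subset_univ _) fun x _ _ => h2 x

end Concentration

/-! ### Typical configurations: their probability and their number. -/

section Typical

variable {n : ℕ} {G : Type*} [Fintype G] [DecidableEq G] {A : G → Type*} [∀ g, Fintype (A g)]

/-- For `n` systems, the `i`-th one of kind `kind i` with energy levels `L (kind i)`, the deviation
of the energy of all systems of kind `g` from its expected value. -/
def deviation (kind : Fin n → G) (L : ∀ g, A g → ℝ) (m : G → ℝ) (g : G)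
    (x : ∀ i, A (kind i)) : ℝ :=
  ∑ i, if kind i = g then L (kind i) (x i) - m (kind i) else 0

lemma sum_mul_deviation (kind : Fin n → G) (L : ∀ g, A g → ℝ) (m b : G → ℝ)
    (x : ∀ i, A (kind i)) :
    ∑ g, b g * deviation kind L m g x =
      ∑ i, b (kind i) * (L (kind i) (x i) - m (kind i)) := by
  simp only [deviation, Finset.mul_sum, mul_ite, mul_zero]
  rw [Finset.sum_comm]
  refine Finset.sum_congr rfl fun i _ => ?_
  rw [Finset.sum_ite_eq]
  simp

open Classical in
/-- The configurations for which the energies of all kinds deviate by at most `t`. -/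
noncomputable def typicalSet (kind : Fin n → G) (L : ∀ g, A g → ℝ) (m : G → ℝ) (t : ℝ) :
    Finset (∀ i, A (kind i)) :=
  Finset.univ.filter fun x => ∀ g, |deviation kind L m g x| ≤ t

lemma mem_typicalSet {kind : Fin n → G} {L : ∀ g, A g → ℝ} {m : G → ℝ} {t : ℝ}
    {x : ∀ i, A (kind i)} :
    x ∈ typicalSet kind L m t ↔ ∀ g, |deviation kind L m g x| ≤ t := by
  simp [typicalSet]

lemma abs_sum_mul_deviation_le {kind : Fin n → G} {L : ∀ g, A g → ℝ} {m : G → ℝ} {t : ℝ}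
    {x : ∀ i, A (kind i)} (hx : x ∈ typicalSet kind L m t) (b : G → ℝ) :
    |∑ g, b g * deviation kind L m g x| ≤ t * ∑ g, |b g| := by
  rw [Finset.mul_sum]
  refine (Finset.abs_sum_le_sum_abs _ _).trans (Finset.sum_le_sum fun g _ => ?_)
  rw [abs_mul, mul_comm]
  exact mul_le_mul_of_nonneg_right (mem_typicalSet.1 hx g) (abs_nonneg _)

lemma sum_le_sum_of_subset_biUnion {X : Type*} [DecidableEq X] {f : X → ℝ} (hf : ∀ x, 0 ≤ f x)
    {S : Finset X} {P : G → Finset X} (h : S ⊆ Finset.univ.biUnion P) :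
    ∑ x ∈ S, f x ≤ ∑ g, ∑ x ∈ P g, f x := by
  have h1 : ∀ x ∈ S, f x ≤ ∑ g, if x ∈ P g then f x else 0 := by
    intro x hx
    obtain ⟨g, -, hg⟩ := Finset.mem_biUnion.1 (h hx)
    refine le_trans (by rw [if_pos hg]) (Finset.single_le_sum
      (f := fun g => if x ∈ P g then f x else 0) (fun g _ => ?_) (Finset.mem_univ g))
    split_ifs
    · exact hf x
    · exact le_rfl
  refine (Finset.sum_le_sum h1).trans ?_
  rw [Finset.sum_comm]
  refine Finset.sum_le_sum fun g _ => ?_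
  rw [Finset.sum_ite_mem]
  exact Finset.sum_le_sum_of_subset_of_nonneg Finset.inter_subset_right fun x _ _ => hf x

/-- A union bound over the kinds and the two signs of the deviation. Only the means of the `p i`
enter, so one set `typicalSet` serves all compatible microstates. -/
lemma sum_compl_typicalSet_le {kind : Fin n → G} [DecidableEq (∀ i, A (kind i))]
    {L : ∀ g, A g → ℝ} {m : G → ℝ}
    {p : ∀ i, A (kind i) → ℝ} (hp0 : ∀ i a, 0 ≤ p i a) (hp1 : ∀ i, ∑ a, p i a = 1)
    (hm : ∀ i, ∑ a, p i a * L (kind i) a = m (kind i)) {B s : ℝ}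
    (hB : ∀ g a, |L g a - m g| ≤ B) (hB0 : 0 ≤ B) (hs : 0 ≤ s) (hsB : s * B ≤ 1) (t : ℝ) :
    ∑ x ∈ (typicalSet kind L m t)ᶜ, ∏ i, p i (x i) ≤
      2 * Fintype.card G * Real.exp (-s * t + n * (s ^ 2 * B ^ 2)) := by
  classical
  have hpp : ∀ x : ∀ i, A (kind i), 0 ≤ ∏ i, p i (x i) := fun x =>
    Finset.prod_nonneg fun i _ => hp0 i _
  have hY : ∀ (c : ℝ) (g : G) (i : Fin n), ∑ a, p i a *
      (c * if kind i = g then L (kind i) a - m (kind i) else 0) = 0 := by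
    intro c g i
    split_ifs
    · have : ∀ a, p i a * (c * (L (kind i) a - m (kind i))) =
          c * (p i a * L (kind i) a - p i a * m (kind i)) := fun a => by ring
      simp only [this]
      rw [← Finset.mul_sum, Finset.sum_sub_distrib, ← Finset.sum_mul, hp1, hm]
      ring
    · simp
  have hb : ∀ (c : ℝ) (g : G), |c| = 1 → ∑ x with t < c * deviation kind L m g x,
      ∏ i, p i (x i) ≤ Real.exp (-s * t + n * (s ^ 2 * B ^ 2)) := by
    intro c g hc
    refine sum_prod_le_exp (B := B) hp0 hp1 (hY c g) (fun i a => ?_) hs hsB t _ (fun x hx => ?_)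
    · rw [abs_mul, hc, one_mul]
      split_ifs
      · exact hB _ a
      · simpa using hB0
    · have := (Finset.mem_filter.1 hx).2.le
      rwa [deviation, Finset.mul_sum] at this
  set P : G → Finset (∀ i, A (kind i)) := fun g =>
    Finset.univ.filter fun x => t < 1 * deviation kind L m g x with hP
  set Q : G → Finset (∀ i, A (kind i)) := fun g =>
    Finset.univ.filter fun x => t < -1 * deviation kind L m g x with hQ
  have hsub : (typicalSet kind L m t)ᶜ ⊆ Finset.univ.biUnion fun g => P g ∪ Q g := by
    intro x hx
    rw [Finset.mem_compl, mem_typicalSet] at hx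
    push Not at hx
    obtain ⟨g, hg⟩ := hx
    rw [lt_abs] at hg
    refine Finset.mem_biUnion.2 ⟨g, Finset.mem_univ g, ?_⟩
    simpa [hP, hQ] using hg
  have hun : ∀ g ∈ Finset.univ, ∑ x ∈ P g ∪ Q g, ∏ i, p i (x i) ≤
      2 * Real.exp (-s * t + n * (s ^ 2 * B ^ 2)) := by
    intro g _
    have h1 := Finset.sum_union_inter (f := fun x => ∏ i, p i (x i)) (s₁ := P g) (s₂ := Q g)
    have h2 : 0 ≤ ∑ x ∈ P g ∩ Q g, ∏ i, p i (x i) := Finset.sum_nonneg fun x _ => hpp x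
    have h3 := hb 1 g (by simp)
    have h4 := hb (-1) g (by simp)
    linarith
  refine (sum_le_sum_of_subset_biUnion hpp hsub).trans ((Finset.sum_le_sum hun).trans_eq ?_)
  rw [Finset.sum_const, Finset.card_univ, nsmul_eq_mul]
  ring

/-- Counting by exponential weights: a typical configuration has weight at least `exp (-t ∑ |b g|)`,
and the total weight is a product of partition functions. The parameters `b` are free, one per kind,
and may be optimised; the mean energies `m` need not be thermal. -/
lemma card_typicalSet_le [∀ g, Nonempty (A g)] (kind : Fin n → G) (L : ∀ g, A g → ℝ)
    (m b : G → ℝ) (t : ℝ) :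
    ((typicalSet kind L m t).card : ℝ) ≤
      Real.exp (∑ i, (Real.log (partitionFunction (L (kind i)) (b (kind i))) +
        b (kind i) * m (kind i)) + t * ∑ g, |b g|) := by
  set F : ∀ i, A (kind i) → ℝ := fun i a =>
    Real.exp (b (kind i) * m (kind i)) * Real.exp (-b (kind i) * L (kind i) a) with hF
  have hF0 : ∀ x : ∀ i, A (kind i), 0 ≤ ∏ i, F i (x i) := fun x =>
    Finset.prod_nonneg fun i _ => mul_nonneg (Real.exp_pos _).le (Real.exp_pos _).le
  have h1 : ∀ x ∈ typicalSet kind L m t, (1 : ℝ) ≤ Real.exp (t * ∑ g, |b g|) *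
      ∏ i, F i (x i) := by
    intro x hx
    simp only [hF, ← Real.exp_add]
    rw [← Real.exp_sum, ← Real.exp_add]
    refine Real.one_le_exp ?_
    have h2 := (abs_le.1 (abs_sum_mul_deviation_le hx b)).2
    rw [sum_mul_deviation] at h2
    have h3 : ∑ i, (b (kind i) * m (kind i) + -b (kind i) * L (kind i) (x i)) =
        -∑ i, b (kind i) * (L (kind i) (x i) - m (kind i)) := by
      rw [← Finset.sum_neg_distrib]
      exact Finset.sum_congr rfl fun i _ => by ring
    rw [h3]
    linarith
  have h2 : ∏ i, ∑ a, F i a = Real.exp (∑ i, (Real.log (partitionFunction (L (kind i))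
      (b (kind i))) + b (kind i) * m (kind i))) := by
    rw [Real.exp_sum]
    refine Finset.prod_congr rfl fun i _ => ?_
    simp only [hF]
    rw [← Finset.mul_sum, Real.exp_add, Real.exp_log (partitionFunction_pos _ _), mul_comm]
    rfl
  have h3 : ((typicalSet kind L m t).card : ℝ) = ∑ x ∈ typicalSet kind L m t, (1 : ℝ) := by simp
  rw [h3]
  refine (Finset.sum_le_sum h1).trans ?_
  rw [← Finset.mul_sum, add_comm, Real.exp_add, ← h2, ← sum_prod_eq_prod_sum]
  exact mul_le_mul_of_nonneg_left (Finset.sum_le_sum_of_subset_of_nonneg (Finset.subset_univ _)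
    fun x _ _ => hF0 x) (Real.exp_pos _).le

end Typical

/-! ### Injecting typical configurations into a larger set. -/

section Transition

variable {n N M : ℕ} {A : Fin 3 → Type*} [∀ g, Fintype (A g)] [∀ g, Nonempty (A g)]
  [∀ g, DecidableEq (A g)]

/-- The target distribution of the transition: Gibbs for the systems of kinds `0` and `1`,
deterministic for the systems of kind `2`. -/
noncomputable def targetWeight (L : ∀ g, A g → ℝ) (β : ℝ) (a₀ : ∀ g, A g) (g : Fin 3) (a : A g) :
    ℝ :=
  if g = 2 then if a = a₀ g then 1 else 0 else gibbsWeight (L g) β a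

/-- The mean energies of the target distribution. -/
noncomputable def targetEnergy (L : ∀ g, A g → ℝ) (β : ℝ) (a₀ : ∀ g, A g) (g : Fin 3) : ℝ :=
  if g = 2 then L g (a₀ g) else gibbsEnergy (L g) β

lemma targetWeight_nonneg (L : ∀ g, A g → ℝ) (β : ℝ) (a₀ : ∀ g, A g) (g : Fin 3) (a : A g) :
    0 ≤ targetWeight L β a₀ g a := by
  unfold targetWeight
  split_ifs
  · exact zero_le_one
  · exact le_rfl
  · exact (gibbsWeight_pos _ _ _).le

lemma sum_targetWeight (L : ∀ g, A g → ℝ) (β : ℝ) (a₀ : ∀ g, A g) (g : Fin 3) :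
    ∑ a, targetWeight L β a₀ g a = 1 := by
  unfold targetWeight
  split_ifs
  · simp
  · exact sum_gibbsWeight _ _

lemma sum_targetWeight_mul (L : ∀ g, A g → ℝ) (β : ℝ) (a₀ : ∀ g, A g) (g : Fin 3) :
    ∑ a, targetWeight L β a₀ g a * L g a = targetEnergy L β a₀ g := by
  unfold targetWeight targetEnergy
  split_ifs
  · simp
  · rfl

/-- The target distribution is nearly flat on its typical set: every positive weight there is at
most `exp (-S)`, where `S` is the entropy of the two Gibbs kinds reduced by the fluctuation `2 |β|
t`. A mass of at least `1 / 2` then needs at least `exp S / 2` configurations. -/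
lemma exists_card_ge {kind : Fin n → Fin 3}
    (hkind : ∀ F : Fin 3 → ℝ, ∑ i, F (kind i) = N * F 0 + N * F 1 + M * F 2)
    (L : ∀ g, A g → ℝ) (β : ℝ) (a₀ : ∀ g, A g) {B s t : ℝ}
    (hB : ∀ g a, |L g a - targetEnergy L β a₀ g| ≤ B) (hB0 : 0 ≤ B) (hs : 0 ≤ s)
    (hsB : s * B ≤ 1) (htail : 6 * Real.exp (-s * t + n * (s ^ 2 * B ^ 2)) ≤ 1 / 2) :
    ∃ Y ⊆ typicalSet kind L (targetEnergy L β a₀) t,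
      (∀ y ∈ Y, ∀ i, kind i = 2 → y i = a₀ (kind i)) ∧
      Real.exp (N * (Real.log (partitionFunction (L 0) β) + β * gibbsEnergy (L 0) β +
        (Real.log (partitionFunction (L 1) β) + β * gibbsEnergy (L 1) β)) - 2 * |β| * t) / 2 ≤
          (Y.card : ℝ) := by
  classical
  set u := targetEnergy L β a₀ with hu
  set q : ∀ i, A (kind i) → ℝ := fun i => targetWeight L β a₀ (kind i) with hq
  have htyp := sum_compl_typicalSet_le (kind := kind) (L := L) (m := u) (p := q)
    (fun i a => targetWeight_nonneg _ _ _ _ _) (fun i => sum_targetWeight _ _ _ _)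
    (fun i => sum_targetWeight_mul _ _ _ _) hB hB0 hs hsB t
  have hall : ∑ x : ∀ i, A (kind i), ∏ i, q i (x i) = 1 := by
    rw [sum_prod_eq_prod_sum]
    exact Finset.prod_eq_one fun i _ => sum_targetWeight _ _ _ _
  -- Dropping the configurations of weight zero loses no mass and freezes the systems of kind `2` in
  -- `a₀`.
  refine ⟨(typicalSet kind L u t).filter fun y => ∏ i, q i (y i) ≠ 0, Finset.filter_subset _ _,
    fun y hy i hi => ?_, ?_⟩
  · have h1 := Finset.prod_ne_zero_iff.1 (Finset.mem_filter.1 hy).2 i (Finset.mem_univ i)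
    simp only [hq, targetWeight] at h1
    rw [if_pos hi] at h1
    by_contra hne
    exact h1 (if_neg hne)
  · set S : ℝ := N * (Real.log (partitionFunction (L 0) β) + β * gibbsEnergy (L 0) β +
        (Real.log (partitionFunction (L 1) β) + β * gibbsEnergy (L 1) β)) - 2 * |β| * t with hS
    have hle : ∀ y ∈ (typicalSet kind L u t).filter fun y => ∏ i, q i (y i) ≠ 0,
        ∏ i, q i (y i) ≤ Real.exp (-S) := by
      intro y hy
      obtain ⟨hy1, hy2⟩ := Finset.mem_filter.1 hy
      set b : Fin 3 → ℝ := fun g => if g = 2 then 0 else β with hb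
      set c : Fin 3 → ℝ := fun g =>
        if g = 2 then 0 else Real.log (partitionFunction (L g) β) + β * gibbsEnergy (L g) β with hc
      have h1 : ∀ i, q i (y i) =
          Real.exp (-c (kind i) - b (kind i) * (L (kind i) (y i) - u (kind i))) := by
        intro i
        have h2 := Finset.prod_ne_zero_iff.1 hy2 i (Finset.mem_univ i)
        simp only [hq, targetWeight, hc, hb] at h2 ⊢
        by_cases hi : kind i = 2
        · rw [if_pos hi] at h2 ⊢
          rw [if_pos hi, if_pos hi, if_pos]
          · simp
          · by_contra hne
            exact h2 (if_neg hne)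
        · rw [if_neg hi, if_neg hi, if_neg hi, hu, targetEnergy, if_neg hi, gibbsWeight]
          have : -(Real.log (partitionFunction (L (kind i)) β) + β * gibbsEnergy (L (kind i)) β) -
              β * (L (kind i) (y i) - gibbsEnergy (L (kind i)) β) =
              -β * L (kind i) (y i) - Real.log (partitionFunction (L (kind i)) β) := by ring
          rw [this, Real.exp_sub, Real.exp_log (partitionFunction_pos _ _)]
      rw [Finset.prod_congr rfl fun i _ => h1 i, ← Real.exp_sum]
      refine Real.exp_le_exp.2 ?_
      rw [Finset.sum_sub_distrib, Finset.sum_neg_distrib, ← sum_mul_deviation kind L u b y,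
        hkind c]
      have h2 := (abs_le.1 (abs_sum_mul_deviation_le hy1 b)).1
      have h3 : ∑ g, |b g| = 2 * |β| := by
        simp [hb, Fin.sum_univ_three]
        ring
      have h4 : c 0 = Real.log (partitionFunction (L 0) β) + β * gibbsEnergy (L 0) β := by
        simp [hc]
      have h5 : c 1 = Real.log (partitionFunction (L 1) β) + β * gibbsEnergy (L 1) β := by
        simp [hc]
      have h6 : c 2 = 0 := by simp [hc]
      rw [h3] at h2
      rw [h4, h5, h6, hS]
      linarith
    have h1 : 1 / 2 ≤ ∑ y ∈ (typicalSet kind L u t).filter fun y => ∏ i, q i (y i) ≠ 0,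
        ∏ i, q i (y i) := by
      rw [Finset.sum_filter_ne_zero]
      have h2 := Finset.sum_add_sum_compl (typicalSet kind L u t) fun x => ∏ i, q i (x i)
      rw [hall] at h2
      rw [Fintype.card_fin] at htyp
      rw [show (2 : ℝ) * ((3 : ℕ) : ℝ) = 6 by norm_num] at htyp
      linarith
    have h2 := h1.trans (Finset.sum_le_sum hle)
    rw [Finset.sum_const, nsmul_eq_mul, Real.exp_neg] at h2
    rw [← div_eq_mul_inv, le_div_iff₀ (Real.exp_pos _)] at h2
    linarith

/-- The energy can be adjusted with the systems of kind `2`. -/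
lemma exists_adjust {kind : Fin n → Fin 3}
    (hkind : ∀ F : Fin 3 → ℝ, ∑ i, F (kind i) = N * F 0 + N * F 1 + M * F 2)
    (L : ∀ g, A g → ℝ) {a₀ a₁ : ∀ g, A g} {η : ℝ} (hη : 0 < η) (h0 : L 2 (a₀ 2) = 0)
    (h1 : L 2 (a₁ 2) = η) {R : ℝ} (hR0 : 0 ≤ R) (hRM : R ≤ M * η) :
    ∃ z : ∀ i, A (kind i), |(∑ i, if kind i = 2 then L (kind i) (z i) else 0) - R| ≤ η := by
  have hcard : (Finset.univ.filter fun i => kind i = 2).card = M := by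
    have := hkind fun g => if g = 2 then 1 else 0
    simp only [Finset.sum_boole] at this
    simpa using this
  have hj : ⌊R / η⌋₊ ≤ (Finset.univ.filter fun i => kind i = 2).card := by
    rw [hcard]
    have : R / η ≤ M := by rwa [div_le_iff₀ hη]
    exact_mod_cast (Nat.floor_le (by positivity)).trans this
  obtain ⟨S, hS, hSc⟩ := Finset.exists_subset_card_eq hj
  -- Exciting `⌊R / η⌋` systems of kind `2` hits `R` up to one quantum `η`.
  refine ⟨fun i => if i ∈ S then a₁ (kind i) else a₀ (kind i), ?_⟩
  have h2 : ∀ g, g = 2 → L g (a₀ g) = 0 := by rintro g rfl; exact h0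
  have h3 : ∀ g, g = 2 → L g (a₁ g) = η := by rintro g rfl; exact h1
  have h4 : (∑ i, if kind i = 2 then L (kind i) (if i ∈ S then a₁ (kind i) else a₀ (kind i)) else 0)
      = ⌊R / η⌋₊ * η := by
    have : ∀ i, (if kind i = 2 then L (kind i) (if i ∈ S then a₁ (kind i) else a₀ (kind i)) else 0)
        = if i ∈ S then η else 0 := by
      intro i
      by_cases hi : i ∈ S
      · have hk := (Finset.mem_filter.1 (hS hi)).2
        rw [if_pos hk, if_pos hi, if_pos hi, h3 _ hk]
      · rw [if_neg hi, if_neg hi]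
        split_ifs with hk
        · exact h2 _ hk
        · rfl
    rw [Finset.sum_congr rfl fun i _ => this i, Finset.sum_ite_mem, Finset.univ_inter,
      Finset.sum_const, hSc, nsmul_eq_mul]
  rw [h4]
  have h5 : (⌊R / η⌋₊ : ℝ) * η ≤ R := by
    rw [← le_div_iff₀ hη]
    exact Nat.floor_le (by positivity)
  have h6 : R < (⌊R / η⌋₊ + 1) * η := by
    rw [← div_lt_iff₀ hη]
    exact Nat.lt_floor_add_one _
  rw [abs_le]
  constructor <;> linarith

/-- The hypothesis `hent` says that `J` copies of the typical set fit into the set of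
`exists_card_ge`. There the systems of kind `2` are frozen, hence free to be reset afterwards to
correct the energy; `hlow` and `hup` keep the required correction within their capacity `[0, M *
η]`. -/
lemma exists_transition {kind : Fin n → Fin 3}
    (hkind : ∀ F : Fin 3 → ℝ, ∑ i, F (kind i) = N * F 0 + N * F 1 + M * F 2)
    (L : ∀ g, A g → ℝ) {a₀ a₁ : ∀ g, A g} {η : ℝ} (hη : 0 < η) (h0 : L 2 (a₀ 2) = 0)
    (h1 : L 2 (a₁ 2) = η) (m : Fin 3 → ℝ) {β b₀ b₁ B s t Δ : ℝ}
    (hB : ∀ g a, |L g a - targetEnergy L β a₀ g| ≤ B) (hB0 : 0 ≤ B) (hs : 0 ≤ s)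
    (hsB : s * B ≤ 1) (htail : 6 * Real.exp (-s * t + n * (s ^ 2 * B ^ 2)) ≤ 1 / 2)
    {J : Type*} [Fintype J] [Nonempty J]
    (hent : Real.log (2 * Fintype.card J) + N * (Real.log (partitionFunction (L 0) b₀) + b₀ * m 0 +
        (Real.log (partitionFunction (L 1) b₁) + b₁ * m 1)) +
        M * Real.log (partitionFunction (L 2) 0) + t * (|b₀| + |b₁|) + 2 * |β| * t ≤
      N * (Real.log (partitionFunction (L 0) β) + β * gibbsEnergy (L 0) β +
        (Real.log (partitionFunction (L 1) β) + β * gibbsEnergy (L 1) β)))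
    (hlow : 0 ≤ N * (m 0 + m 1 - gibbsEnergy (L 0) β - gibbsEnergy (L 1) β) + M * m 2 + Δ - 6 * t)
    (hup : N * (m 0 + m 1 - gibbsEnergy (L 0) β - gibbsEnergy (L 1) β) + M * m 2 + Δ + 6 * t ≤
      M * η) :
    ∃ φ : J → (∀ i, A (kind i)) → ∀ i, A (kind i),
      (∀ j j' x x', x ∈ typicalSet kind L m t → x' ∈ typicalSet kind L m t →
        φ j x = φ j' x' → j = j' ∧ x = x') ∧
      ∀ j, ∀ x ∈ typicalSet kind L m t,
        |∑ i, L (kind i) (φ j x i) - ∑ i, L (kind i) (x i) - Δ| ≤ η := by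
  classical
  obtain ⟨Y, hYt, hY0, hYc⟩ := exists_card_ge hkind L β a₀ hB hB0 hs hsB htail
  -- The parameter `0` for kind `2` counts all its levels: nothing is assumed about its temperature,
  -- and its entropy is bounded crudely.
  have hT := card_typicalSet_le kind L m ![b₀, b₁, 0] t
  rw [hkind fun g => Real.log (partitionFunction (L g) (![b₀, b₁, 0] g)) +
    ![b₀, b₁, 0] g * m g, Fin.sum_univ_three] at hT
  simp only [Matrix.cons_val_zero, Matrix.cons_val_one, Matrix.cons_val_two,
    Matrix.tail_cons, Matrix.head_cons, zero_mul, add_zero, abs_zero] at hT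
  have hJ : (0 : ℝ) < Fintype.card J := by exact_mod_cast Fintype.card_pos
  have hcard : Fintype.card (J × typicalSet kind L m t) ≤ Fintype.card Y := by
    rw [Fintype.card_prod, Fintype.card_coe, Fintype.card_coe]
    have h2 : ((Fintype.card J * (typicalSet kind L m t).card : ℕ) : ℝ) ≤ Y.card := by
      refine le_trans ?_ hYc
      push_cast
      rw [le_div_iff₀ two_pos]
      calc _ = (2 * (Fintype.card J : ℝ)) * (typicalSet kind L m t).card := by ring
        _ ≤ Real.exp (Real.log (2 * Fintype.card J)) * _ := by
            rw [Real.exp_log (by positivity)]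
        _ ≤ _ := by
            refine (mul_le_mul_of_nonneg_left hT (Real.exp_pos _).le).trans ?_
            rw [← Real.exp_add]
            refine Real.exp_le_exp.2 ?_
            linarith
    exact_mod_cast h2
  obtain ⟨e⟩ := Function.Embedding.nonempty_of_card_le hcard
  have hz : ∀ R : ℝ, ∃ z : ∀ i, A (kind i), 0 ≤ R → R ≤ M * η →
      |(∑ i, if kind i = 2 then L (kind i) (z i) else 0) - R| ≤ η := by
    intro R
    by_cases hR : 0 ≤ R ∧ R ≤ M * η
    · obtain ⟨z, hz⟩ := exists_adjust hkind L hη h0 h1 hR.1 hR.2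
      exact ⟨z, fun _ _ => hz⟩
    · exact ⟨fun i => a₀ (kind i), fun h h' => absurd ⟨h, h'⟩ hR⟩
  choose z hz using hz
  set y : J → (∀ i, A (kind i)) → ∀ i, A (kind i) := fun j x =>
    if hx : x ∈ typicalSet kind L m t then (e (j, ⟨x, hx⟩) : ∀ i, A (kind i)) else x with hy
  have hyY : ∀ j, ∀ x ∈ typicalSet kind L m t, y j x ∈ Y := by
    intro j x hx
    simp only [hy, dif_pos hx]
    exact (e (j, ⟨x, hx⟩)).2
  have hyinj : ∀ j j' x x', x ∈ typicalSet kind L m t → x' ∈ typicalSet kind L m t →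
      y j x = y j' x' → j = j' ∧ x = x' := by
    intro j j' x x' hx hx' h
    simp only [hy, dif_pos hx, dif_pos hx'] at h
    have := e.injective (Subtype.ext h)
    simpa using this
  -- Overwriting kind `2` preserves injectivity, since all configurations in `Y` agree there.
  refine ⟨fun j x i => if kind i = 2 then
    z (∑ i, L (kind i) (x i) + Δ - ∑ i, L (kind i) (y j x i)) i else y j x i, ?_, ?_⟩
  · intro j j' x x' hx hx' h
    refine hyinj j j' x x' hx hx' (funext fun i => ?_)
    by_cases hi : kind i = 2
    · rw [hY0 _ (hyY j x hx) i hi, hY0 _ (hyY j' x' hx') i hi]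
    · simpa [hi] using congrFun h i
  · intro j x hx
    have hEx := sum_mul_deviation kind L m (fun _ => 1) x
    have hEy := sum_mul_deviation kind L (targetEnergy L β a₀) (fun _ => 1) (y j x)
    have hdx := abs_sum_mul_deviation_le hx fun _ => 1
    have hdy := abs_sum_mul_deviation_le (hYt (hyY j x hx)) fun _ => 1
    simp only [one_mul, Finset.sum_sub_distrib] at hEx hEy
    rw [hkind m] at hEx
    rw [hkind (targetEnergy L β a₀)] at hEy
    have hu0 : targetEnergy L β a₀ 0 = gibbsEnergy (L 0) β := by simp [targetEnergy]
    have hu1 : targetEnergy L β a₀ 1 = gibbsEnergy (L 1) β := by simp [targetEnergy]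
    have hu2 : targetEnergy L β a₀ 2 = 0 := by simp [targetEnergy, h0]
    rw [hu0, hu1, hu2] at hEy
    simp only [one_mul] at hdx hdy
    rw [hEx] at hdx
    rw [hEy] at hdy
    simp only [abs_one, Finset.sum_const, Finset.card_univ, Fintype.card_fin, nsmul_eq_mul,
      mul_one] at hdx hdy
    rw [abs_le] at hdx hdy
    push_cast at hdx hdy
    -- Both total energies fluctuate by at most `3 * t`, namely `t` for each kind; this is the
    -- margin `6 * t`.
    have h2 := hz (∑ i, L (kind i) (x i) + Δ - ∑ i, L (kind i) (y j x i))
      (by linarith [hdx.1, hdy.2]) (by linarith [hdx.2, hdy.1])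
    have h3 : ∑ i, L (kind i) (if kind i = 2 then
        z (∑ i, L (kind i) (x i) + Δ - ∑ i, L (kind i) (y j x i)) i else y j x i) =
        (∑ i, if kind i = 2 then
          L (kind i) (z (∑ i, L (kind i) (x i) + Δ - ∑ i, L (kind i) (y j x i)) i) else 0) +
          ∑ i, L (kind i) (y j x i) := by
      rw [← Finset.sum_add_distrib]
      refine Finset.sum_congr rfl fun i _ => ?_
      by_cases hi : kind i = 2
      · have h4 : ∀ g, g = 2 → L g (a₀ g) = 0 := by rintro g rfl; exact h0
        rw [if_pos hi, if_pos hi, hY0 _ (hyY j x hx) i hi, h4 _ hi, add_zero]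
      · rw [if_neg hi, if_neg hi, zero_add]
    rw [h3]
    convert h2 using 2
    ring

end Transition

open Filter Topology

/-! ### Strict convexity of the log-partition function. -/

section PartitionFunction

variable {ι : Type*} [Fintype ι] [Nonempty ι]

lemma hasDerivAt_log_partitionFunction (l : ι → ℝ) (β : ℝ) :
    HasDerivAt (fun β => Real.log (partitionFunction l β)) (-gibbsEnergy l β) β := by
  have h1 : HasDerivAt (partitionFunction l) (∑ i, Real.exp (-β * l i) * (-1 * l i)) β := by
    unfold partitionFunction
    exact HasDerivAt.fun_sum fun i _ => ((hasDerivAt_neg β).mul_const (l i)).exp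
  convert h1.log (partitionFunction_pos l β).ne' using 1
  rw [gibbsEnergy, ← Finset.sum_neg_distrib, Finset.sum_div]
  refine Finset.sum_congr rfl fun i _ => ?_
  rw [gibbsWeight]
  ring

lemma continuous_log_partitionFunction (l : ι → ℝ) :
    Continuous fun β => Real.log (partitionFunction l β) :=
  continuous_iff_continuousAt.2 fun β => (hasDerivAt_log_partitionFunction l β).continuousAt

lemma continuous_gibbsEnergy (l : ι → ℝ) : Continuous (gibbsEnergy l) := by
  have hZ : Continuous (partitionFunction l) := by unfold partitionFunction; fun_prop
  unfold gibbsEnergy gibbsWeight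
  exact continuous_finsetSum _ fun i _ => Continuous.mul
    (Continuous.div (by fun_prop) hZ fun β => (partitionFunction_pos l β).ne') continuous_const

lemma neg_mul_le_log_partitionFunction (l : ι → ℝ) (β : ℝ) (i : ι) :
    -β * l i ≤ Real.log (partitionFunction l β) := by
  rw [Real.le_log_iff_exp_le (partitionFunction_pos l β)]
  exact Finset.single_le_sum (f := fun i => Real.exp (-β * l i))
    (fun i _ => (Real.exp_pos _).le) (Finset.mem_univ i)

/-- Strict convexity in tangent-line form: `Z(γ) / Z(β)` is a Gibbs mean of exponentials, and the
strict inequality `y + 1 < exp y` applies at a level different from the mean energy. Adding the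
inequality with `β` and `γ` exchanged makes the Gibbs energy strictly decreasing. -/
lemma log_partitionFunction_gt {l : ι → ℝ} (hl : ∃ i j, l i ≠ l j) {β γ : ℝ} (h : β ≠ γ) :
    Real.log (partitionFunction l β) - (γ - β) * gibbsEnergy l β <
      Real.log (partitionFunction l γ) := by
  set u := gibbsEnergy l β with hu
  obtain ⟨i₀, hi₀⟩ : ∃ i, l i ≠ u := by
    obtain ⟨i, j, hij⟩ := hl
    by_contra! hc
    exact hij ((hc i).trans (hc j).symm)
  have h1 : partitionFunction l γ = partitionFunction l β * (Real.exp (-(γ - β) * u) *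
      ∑ i, gibbsWeight l β i * Real.exp (-(γ - β) * (l i - u))) := by
    rw [Finset.mul_sum, Finset.mul_sum, partitionFunction]
    refine Finset.sum_congr rfl fun i _ => ?_
    rw [gibbsWeight]
    have h2 := (partitionFunction_pos l β).ne'
    have h3 : Real.exp (-γ * l i) =
        Real.exp (-(γ - β) * u) * Real.exp (-β * l i) * Real.exp (-(γ - β) * (l i - u)) := by
      rw [← Real.exp_add, ← Real.exp_add]; ring_nf
    rw [h3]
    field_simp
  have h2 : 1 < ∑ i, gibbsWeight l β i * Real.exp (-(γ - β) * (l i - u)) := by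
    have h3 : ∑ i, gibbsWeight l β i * (-(γ - β) * (l i - u) + 1) = 1 := by
      have : ∀ i, gibbsWeight l β i * (-(γ - β) * (l i - u) + 1) =
          -(γ - β) * (gibbsWeight l β i * l i) + (1 + (γ - β) * u) * gibbsWeight l β i :=
        fun i => by ring
      simp only [this]
      rw [Finset.sum_add_distrib, ← Finset.mul_sum, ← Finset.mul_sum, sum_gibbsWeight]
      rw [show ∑ i, gibbsWeight l β i * l i = u from rfl]
      ring
    rw [← h3]
    refine Finset.sum_lt_sum (fun i _ => mul_le_mul_of_nonneg_left (Real.add_one_le_exp _)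
      (gibbsWeight_pos l β i).le) ⟨i₀, Finset.mem_univ _, ?_⟩
    refine mul_lt_mul_of_pos_left (Real.add_one_lt_exp ?_) (gibbsWeight_pos l β i₀)
    exact mul_ne_zero (neg_ne_zero.2 (sub_ne_zero.2 h.symm)) (sub_ne_zero.2 hi₀)
  rw [h1, Real.log_mul (partitionFunction_pos l β).ne' (by positivity),
    Real.log_mul (Real.exp_pos _).ne' (by positivity), Real.log_exp]
  have := Real.log_pos h2
  linarith

lemma gibbsEnergy_strictAnti {l : ι → ℝ} (hl : ∃ i j, l i ≠ l j) : StrictAnti (gibbsEnergy l) := by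
  intro β γ h
  have h1 := log_partitionFunction_gt hl h.ne
  have h2 := log_partitionFunction_gt hl h.ne'
  have h3 : 0 < (γ - β) * (gibbsEnergy l β - gibbsEnergy l γ) := by linarith
  exact sub_pos.1 ((mul_pos_iff_of_pos_left (sub_pos.2 h)).1 h3)

lemma gibbsEnergy_antitone (l : ι → ℝ) : Antitone (gibbsEnergy l) := by
  by_cases hl : ∃ i j, l i ≠ l j
  · exact (gibbsEnergy_strictAnti hl).antitone
  · push Not at hl
    obtain ⟨i₀⟩ := ‹Nonempty ι›
    have : ∀ β, gibbsEnergy l β = l i₀ := by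
      intro β
      have : Nonempty ι := ⟨i₀⟩
      rw [gibbsEnergy, Finset.sum_congr rfl fun i _ => by rw [hl i i₀], ← Finset.sum_mul,
        sum_gibbsWeight, one_mul]
    intro β γ _
    rw [this, this]

end PartitionFunction

/-! ### The entropy gap between systems without a common temperature. -/

section Gap

variable {ι κ : Type*} [Fintype ι] [Nonempty ι] [Fintype κ] [Nonempty κ]

/-- If two systems do not have a common inverse temperature, then the entropy at their total energy
is larger than the sum of their entropies. -/
lemma exists_entropy_gap {l : ι → ℝ} {k : κ → ℝ} {e₀ e₁ : ℝ}
    (hlow : ∃ i j, l i + k j < e₀ + e₁) (hup : ∃ i j, e₀ + e₁ < l i + k j)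
    (hne : ∀ β, gibbsEnergy l β = e₀ → gibbsEnergy k β ≠ e₁) :
    ∃ β b₀ b₁, gibbsEnergy l β + gibbsEnergy k β = e₀ + e₁ ∧
      Real.log (partitionFunction l b₀) + b₀ * e₀ +
        (Real.log (partitionFunction k b₁) + b₁ * e₁) <
      Real.log (partitionFunction l β) + β * e₀ +
        (Real.log (partitionFunction k β) + β * e₁) := by
  have hderiv₀ : ∀ β, HasDerivAt (fun β => Real.log (partitionFunction l β) + β * e₀)
      (-gibbsEnergy l β + 1 * e₀) β := fun β =>
    (hasDerivAt_log_partitionFunction l β).add ((hasDerivAt_id β).mul_const e₀)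
  have hderiv₁ : ∀ β, HasDerivAt (fun β => Real.log (partitionFunction k β) + β * e₁)
      (-gibbsEnergy k β + 1 * e₁) β := fun β =>
    (hasDerivAt_log_partitionFunction k β).add ((hasDerivAt_id β).mul_const e₁)
  set h : ℝ → ℝ := fun β => Real.log (partitionFunction l β) + β * e₀ +
        (Real.log (partitionFunction k β) + β * e₁) with hh
  have hderiv : ∀ β, HasDerivAt h (-gibbsEnergy l β + 1 * e₀ + (-gibbsEnergy k β + 1 * e₁)) β :=
    fun β => (hderiv₀ β).add (hderiv₁ β)
  have hcont : Continuous h := continuous_iff_continuousAt.2 fun β => (hderiv β).continuousAt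
  have hbound : ∀ i j β, β * (e₀ + e₁ - (l i + k j)) ≤ h β := by
    intro i j β
    have h1 := neg_mul_le_log_partitionFunction l β i
    have h2 := neg_mul_le_log_partitionFunction k β j
    simp only [hh]
    linarith
  -- A total energy strictly between the extreme levels makes `h` grow at both ends: `hup` at `-∞`,
  -- `hlow` at `+∞`. The derivative at the minimum gives the total energy balance.
  have hcoer : Tendsto h (cocompact ℝ) atTop := by
    rw [cocompact_eq_atBot_atTop, tendsto_sup]
    constructor
    · obtain ⟨i, j, hij⟩ := hup
      exact tendsto_atTop_mono (hbound i j)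
        (tendsto_id.atBot_mul_const_of_neg (sub_neg.2 hij))
    · obtain ⟨i, j, hij⟩ := hlow
      exact tendsto_atTop_mono (hbound i j)
        (tendsto_id.atTop_mul_const (sub_pos.2 hij))
  obtain ⟨β, hβ⟩ := hcont.exists_forall_le hcoer
  have h0 := IsLocalMin.hasDerivAt_eq_zero (Eventually.of_forall hβ) (hderiv β)
  have hsum : gibbsEnergy l β + gibbsEnergy k β = e₀ + e₁ := by linarith
  -- If `β` minimised the first summand too, it would have Gibbs energy `e₀`, so by the balance the
  -- second would have `e₁`: a common temperature. Hence improving the first summand alone suffices.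
  have hb : ∃ b, Real.log (partitionFunction l b) + b * e₀ <
      Real.log (partitionFunction l β) + β * e₀ := by
    by_contra! hc
    have h1 := IsLocalMin.hasDerivAt_eq_zero (Eventually.of_forall hc) (hderiv₀ β)
    exact hne β (by linarith) (by linarith)
  obtain ⟨b, hb⟩ := hb
  exact ⟨β, b, β, hsum, by linarith⟩

/-- The gap of `exists_entropy_gap` persists for slightly different total energies. -/
lemma exists_entropy_gap_perturbed {l : ι → ℝ} {k : κ → ℝ} {e₀ e₁ : ℝ}
    (hl : ∃ i j, l i ≠ l j)
    (hlow : ∃ i j, l i + k j < e₀ + e₁) (hup : ∃ i j, e₀ + e₁ < l i + k j)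
    (hne : ∀ β, gibbsEnergy l β = e₀ → gibbsEnergy k β ≠ e₁) (c : ℝ) :
    ∃ b₀ b₁, ∃ β : Bool → ℝ,
      (0 < gibbsEnergy l (β true) + gibbsEnergy k (β true) - (e₀ + e₁)) ∧
      (gibbsEnergy l (β false) + gibbsEnergy k (β false) - (e₀ + e₁) < 0) ∧
      ∀ i, Real.log (partitionFunction l b₀) + b₀ * e₀ +
        (Real.log (partitionFunction k b₁) + b₁ * e₁) +
        c * |gibbsEnergy l (β i) + gibbsEnergy k (β i) - (e₀ + e₁)| <
      Real.log (partitionFunction l (β i)) + β i * gibbsEnergy l (β i) +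
        (Real.log (partitionFunction k (β i)) + β i * gibbsEnergy k (β i)) := by
  obtain ⟨β, b₀, b₁, hsum, hgap⟩ := exists_entropy_gap hlow hup hne
  have hcl := continuous_log_partitionFunction l
  have hck := continuous_log_partitionFunction k
  have hul := continuous_gibbsEnergy l
  have huk := continuous_gibbsEnergy k
  have hlt : ∀ᶠ x in 𝓝 β, Real.log (partitionFunction l b₀) + b₀ * e₀ +
        (Real.log (partitionFunction k b₁) + b₁ * e₁) +
        c * |gibbsEnergy l x + gibbsEnergy k x - (e₀ + e₁)| <
      Real.log (partitionFunction l x) + x * gibbsEnergy l x +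
        (Real.log (partitionFunction k x) + x * gibbsEnergy k x) := by
    -- At `β` itself the term with `c` vanishes, and the balance of total energies turns the minimum
    -- of the sum into the joint Gibbs entropy.
    refine ContinuousAt.eventually_lt (by fun_prop) (by fun_prop) ?_
    rw [hsum, sub_self, abs_zero, mul_zero, add_zero]
    have : β * gibbsEnergy l β + β * gibbsEnergy k β = β * e₀ + β * e₁ := by
      rw [← mul_add, hsum, mul_add]
    linarith
  obtain ⟨x, hx1, hx2⟩ := ((hlt.filter_mono nhdsWithin_le_nhds).and
    (self_mem_nhdsWithin (s := Set.Iio β))).exists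
  obtain ⟨y, hy1, hy2⟩ := ((hlt.filter_mono nhdsWithin_le_nhds).and
    (self_mem_nhdsWithin (s := Set.Ioi β))).exists
  refine ⟨b₀, b₁, fun b => if b then x else y, ?_, ?_, ?_⟩
  · have h1 := gibbsEnergy_strictAnti hl (Set.mem_Iio.1 hx2)
    have h2 := gibbsEnergy_antitone k (Set.mem_Iio.1 hx2).le
    simp only [if_true]
    linarith
  · have h1 := gibbsEnergy_strictAnti hl (Set.mem_Ioi.1 hy2)
    have h2 := gibbsEnergy_antitone k (Set.mem_Ioi.1 hy2).le
    simp only [Bool.false_eq_true, if_false]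
    linarith
  · rintro (_ | _)
    · simpa using hy1
    · simpa using hx1

end Gap

/-! ### Choosing the size of the environment. -/

lemma exists_kind (N M : ℕ) : ∃ kind : Fin (2 * N + M) → Fin 3,
    ∀ F : Fin 3 → ℝ, ∑ i, F (kind i) = N * F 0 + N * F 1 + M * F 2 := by
  have e : Fin (2 * N + M) ≃ (Fin N ⊕ Fin N) ⊕ Fin M :=
    Fintype.equivOfCardEq (by simp; ring)
  refine ⟨fun i => Sum.elim (Sum.elim (fun _ => 0) fun _ => 1) (fun _ => 2) (e i), fun F => ?_⟩
  rw [Equiv.sum_comp e fun j => F (Sum.elim (Sum.elim (fun _ => 0) fun _ => 1) (fun _ => 2) j)]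
  simp

/-- Parameters of a large environment. -/
lemma exists_large (r c κ γ Δ C K ε : ℝ) (hc : 0 < c) (hκ : 0 < κ) (hγ : 0 < γ)
    (hε : 0 < ε) :
    ∃ N : ℕ, 1 ≤ N ∧ |Δ| ≤ N * κ ∧ C ≤ N * γ ∧ 6 * Real.exp (-c * N) ≤ 1 / 2 ∧
      K * ((3 + r) * N + 1) * √(6 * Real.exp (-c * N)) ≤ ε := by
  have hN : Tendsto (fun N : ℕ => (N : ℝ)) atTop atTop := tendsto_natCast_atTop_atTop
  have h1 : ∀ᶠ N : ℕ in atTop, |Δ| ≤ N * κ :=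
    (hN.atTop_mul_const hκ).eventually_ge_atTop _
  have h2 : ∀ᶠ N : ℕ in atTop, C ≤ N * γ := (hN.atTop_mul_const hγ).eventually_ge_atTop _
  have h3 : Tendsto (fun N : ℕ => 6 * Real.exp (-c * N)) atTop (𝓝 (6 * 0)) := by
    refine Tendsto.const_mul _ (Real.tendsto_exp_atBot.comp ?_)
    exact hN.const_mul_atTop_of_neg (by linarith)
  have h4 : Tendsto (fun N : ℕ => K * ((3 + r) * N + 1) * √(6 * Real.exp (-c * N))) atTop
      (𝓝 0) := by
    have h5 : ∀ N : ℕ, K * ((3 + r) * N + 1) * √(6 * Real.exp (-c * N)) =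
        K * √6 * (3 + r) * ((N : ℝ) ^ 1 * Real.exp (-(c / 2) * N)) +
          K * √6 * ((N : ℝ) ^ 0 * Real.exp (-(c / 2) * N)) := by
      intro N
      have h6 : √(6 * Real.exp (-c * N)) = √6 * Real.exp (-(c / 2) * N) := by
        rw [Real.sqrt_mul (by norm_num), Real.sqrt_eq_iff_mul_self_eq (Real.exp_pos _).le
          (Real.exp_pos _).le |>.2]
        rw [← Real.exp_add]; ring_nf
      rw [h6]; ring
    simp only [h5]
    have h6 : ∀ j : ℕ, Tendsto (fun N : ℕ => (N : ℝ) ^ j * Real.exp (-(c / 2) * N)) atTop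
        (𝓝 0) := fun j =>
      (Real.summable_pow_mul_exp_neg_nat_mul j (by linarith)).tendsto_atTop_zero
    simpa using ((h6 1).const_mul (K * √6 * (3 + r))).add ((h6 0).const_mul (K * √6))
  have h5 : ∀ᶠ N : ℕ in atTop, 6 * Real.exp (-c * N) < 1 / 2 :=
    h3.eventually_lt_const (by norm_num)
  have h6 := h4.eventually_lt_const hε
  obtain ⟨N, hN⟩ := (h1.and (h2.and (h5.and (h6.and (eventually_ge_atTop 1))))).exists
  exact ⟨N, hN.2.2.2.2, hN.1, hN.2.1, hN.2.2.1.le, hN.2.2.2.1.le⟩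

/-- A large environment made of three kinds of systems admits enough transitions between its typical
configurations and other ones whose energy is larger by `Δ`, if the systems of the first two kinds
do not have a common temperature. -/
lemma exists_typical_transition {A : Fin 3 → Type*} [∀ g, Fintype (A g)] [∀ g, Nonempty (A g)]
    [∀ g, DecidableEq (A g)] (L : ∀ g, A g → ℝ) {a₀ a₁ : ∀ g, A g} {η : ℝ} (hη : 0 < η)
    (h0 : L 2 (a₀ 2) = 0) (h1 : L 2 (a₁ 2) = η) (m : Fin 3 → ℝ) (hm0 : 0 ≤ m 2) (hm1 : m 2 ≤ η)
    (hL : ∃ i j, L 0 i ≠ L 0 j)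
    (hlow : ∃ i j, L 0 i + L 1 j < m 0 + m 1) (hup : ∃ i j, m 0 + m 1 < L 0 i + L 1 j)
    (hne : ∀ β, gibbsEnergy (L 0) β = m 0 → gibbsEnergy (L 1) β ≠ m 1)
    (J : Type*) [Fintype J] [Nonempty J] (Δ K ε : ℝ) (hK : 0 ≤ K) (hε : 0 < ε) :
    ∃ (n : ℕ) (kind : Fin n → Fin 3) (t τ : ℝ)
      (φ : J → (∀ i, A (kind i)) → ∀ i, A (kind i)),
      (∀ j j' x x', x ∈ typicalSet kind L m t → x' ∈ typicalSet kind L m t →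
        φ j x = φ j' x' → j = j' ∧ x = x') ∧
      (∀ j, ∀ x ∈ typicalSet kind L m t,
        |∑ i, L (kind i) (φ j x i) - ∑ i, L (kind i) (x i) - Δ| ≤ η) ∧
      τ ≤ 1 ∧ K * (n + 1) * √τ ≤ ε ∧
      ∀ p : ∀ i, A (kind i) → ℝ, (∀ i a, 0 ≤ p i a) → (∀ i, ∑ a, p i a = 1) →
        (∀ i, ∑ a, p i a * L (kind i) a = m (kind i)) →
        ∀ [DecidableEq (∀ i, A (kind i))],
        ∑ x ∈ (typicalSet kind L m t)ᶜ, ∏ i, p i (x i) ≤ τ := by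
  set c₂ := Real.log (partitionFunction (L 2) 0) with hc₂
  have hc₂0 : 0 ≤ c₂ := by
    refine Real.log_nonneg ?_
    have := Finset.single_le_sum (f := fun i => Real.exp (-0 * L 2 i))
      (fun i _ => (Real.exp_pos _).le) (Finset.mem_univ (a₀ 2))
    simpa [partitionFunction] using this
  obtain ⟨b₀, b₁, β', hpos, hneg, hgap⟩ :=
    exists_entropy_gap_perturbed hL hlow hup hne (4 / η * c₂)
  -- The mean energy `m 2` may be `0` or `η`, leaving the kind `2` systems no room on one side. The
  -- sign of the energy shift is chosen to move them towards the other side; this is why the gap is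
  -- needed on both sides of the balanced temperature.
  obtain ⟨β, hβ, hgapβ, hκne⟩ : ∃ β,
      ((0 < gibbsEnergy (L 0) β + gibbsEnergy (L 1) β - (m 0 + m 1) ∧ η / 2 ≤ m 2) ∨
        (gibbsEnergy (L 0) β + gibbsEnergy (L 1) β - (m 0 + m 1) < 0 ∧ m 2 ≤ η / 2)) ∧
      Real.log (partitionFunction (L 0) b₀) + b₀ * m 0 +
        (Real.log (partitionFunction (L 1) b₁) + b₁ * m 1) +
        4 / η * c₂ * |gibbsEnergy (L 0) β + gibbsEnergy (L 1) β - (m 0 + m 1)| <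
      Real.log (partitionFunction (L 0) β) + β * gibbsEnergy (L 0) β +
        (Real.log (partitionFunction (L 1) β) + β * gibbsEnergy (L 1) β) ∧
      gibbsEnergy (L 0) β + gibbsEnergy (L 1) β - (m 0 + m 1) ≠ 0 := by
    rcases le_total (η / 2) (m 2) with h | h
    · exact ⟨β' true, Or.inl ⟨hpos, h⟩, hgap true, hpos.ne'⟩
    · exact ⟨β' false, Or.inr ⟨hneg, h⟩, hgap false, hneg.ne⟩
  set κ := gibbsEnergy (L 0) β + gibbsEnergy (L 1) β - (m 0 + m 1) with hκ
  have hκ0 : 0 < |κ| := abs_pos.2 hκne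
  set γ := Real.log (partitionFunction (L 0) β) + β * gibbsEnergy (L 0) β +
        (Real.log (partitionFunction (L 1) β) + β * gibbsEnergy (L 1) β) -
      (Real.log (partitionFunction (L 0) b₀) + b₀ * m 0 +
        (Real.log (partitionFunction (L 1) b₁) + b₁ * m 1) + 4 / η * c₂ * |κ|) with hγ
  have hγ0 : 0 < γ := by linarith
  -- About `r * N` systems of kind `2` have capacity at least `4 |κ| N`. The shift `N |κ|` leaves a
  -- margin of at least `N |κ|`, shared equally between `Δ` and the fluctuations. Their entropy per
  -- `N` is `r * c₂`, the penalty included in the gap.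
  set r := 4 * |κ| / η with hr
  have hr0 : 0 < r := by positivity
  set b := |b₀| + |b₁| + 2 * |β| + 1 with hb
  have hb0 : 0 < b := by positivity
  -- With `t = δ * N`, the first bound lets fluctuations use at most half of the entropy gap, the
  -- second makes `6 * t ≤ N * |κ| / 2`.
  set δ := min (γ / (2 * b)) (|κ| / 12) with hδ
  have hδ0 : 0 < δ := lt_min (by positivity) (by positivity)
  have hδ1 : δ * b ≤ γ / 2 := by
    calc δ * b ≤ γ / (2 * b) * b := mul_le_mul_of_nonneg_right (min_le_left _ _) hb0.le
      _ = γ / 2 := by field_simp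
  have hδ2 : 6 * δ ≤ |κ| / 2 := by
    have : δ ≤ |κ| / 12 := min_le_right _ _
    linarith
  obtain ⟨B, hB0, hBm, hBu⟩ : ∃ B : ℝ, 0 < B ∧ (∀ g a, |L g a - m g| ≤ B) ∧
      ∀ g a, |L g a - targetEnergy L β a₀ g| ≤ B := by
    have h2 : ∀ (g : Fin 3) (a : A g), |L g a - m g| + |L g a - targetEnergy L β a₀ g| ≤
        ∑ g, ∑ a, (|L g a - m g| + |L g a - targetEnergy L β a₀ g|) := fun g a =>
      (Finset.single_le_sum (f := fun a => |L g a - m g| + |L g a - targetEnergy L β a₀ g|)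
        (fun _ _ => by positivity) (Finset.mem_univ a)).trans
      (Finset.single_le_sum
        (f := fun g => ∑ a, (|L g a - m g| + |L g a - targetEnergy L β a₀ g|))
        (fun _ _ => Finset.sum_nonneg fun _ _ => by positivity) (Finset.mem_univ g))
    refine ⟨1 + ∑ g, ∑ a, (|L g a - m g| + |L g a - targetEnergy L β a₀ g|),
      add_pos_of_pos_of_nonneg one_pos (Finset.sum_nonneg fun _ _ =>
        Finset.sum_nonneg fun _ _ => by positivity), fun g a => ?_, fun g a => ?_⟩
    · linarith [h2 g a, abs_nonneg (L g a - targetEnergy L β a₀ g)]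
    · linarith [h2 g a, abs_nonneg (L g a - m g)]
  -- There are at most `(3 + r) * N` systems, the ceiling in `M` costing at most `1 ≤ N`. The
  -- quadratic Chernoff term then takes at most half of the linear one, leaving the tail exponent
  -- `-(s * δ / 2) * N`.
  set s := min (1 / B) (δ / (2 * B ^ 2 * (3 + r))) with hs
  have hs0 : 0 < s := lt_min (by positivity) (by positivity)
  have hsB : s * B ≤ 1 := by
    calc s * B ≤ 1 / B * B := mul_le_mul_of_nonneg_right (min_le_left _ _) hB0.le
      _ = 1 := by field_simp
  have hs2 : (3 + r) * (s ^ 2 * B ^ 2) ≤ s * δ / 2 := by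
    have h2 : s ≤ δ / (2 * B ^ 2 * (3 + r)) := min_le_right _ _
    rw [le_div_iff₀ (by positivity)] at h2
    nlinarith
  obtain ⟨N, hN1, hNΔ, hNγ, hNexp, hNε⟩ := exists_large r (s * δ / 2) (|κ| / 2) (γ / 2) Δ
    (Real.log (2 * Fintype.card J) + c₂) K ε (by positivity) (by positivity) (by positivity)
    hε
  set M := ⌈r * N⌉₊ with hM
  have hMl : r * N ≤ M := Nat.le_ceil _
  have hMu : (M : ℝ) ≤ r * N + 1 := (Nat.ceil_lt_add_one (by positivity)).le
  have hMη : 4 * |κ| * N ≤ M * η := by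
    have h2 := mul_le_mul_of_nonneg_right hMl hη.le
    have h3 : r * N * η = 4 * |κ| * N := by rw [hr]; field_simp
    linarith
  obtain ⟨kind, hkind⟩ := exists_kind N M
  have hN1' : (1 : ℝ) ≤ N := by exact_mod_cast hN1
  have hn : ((2 * N + M : ℕ) : ℝ) ≤ (3 + r) * N := by
    push_cast
    linarith
  have hexp : Real.exp (-s * (δ * N) + ((2 * N + M : ℕ) : ℝ) * (s ^ 2 * B ^ 2)) ≤
      Real.exp (-(s * δ / 2) * N) := by
    refine Real.exp_le_exp.2 ?_
    have h2 := mul_le_mul_of_nonneg_right hn (by positivity : 0 ≤ s ^ 2 * B ^ 2)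
    have h3 := mul_le_mul_of_nonneg_right hs2 (Nat.cast_nonneg N : (0 : ℝ) ≤ N)
    linarith
  have hMm : M * m 2 ≤ M * η := mul_le_mul_of_nonneg_left hm1 (Nat.cast_nonneg M)
  have hδN : 6 * (δ * N) ≤ N * (|κ| / 2) := by
    have := mul_le_mul_of_nonneg_right hδ2 (Nat.cast_nonneg N : (0 : ℝ) ≤ N)
    linarith
  have hΔ := abs_le.1 hNΔ
  obtain ⟨φ, hφ, hφE⟩ := exists_transition hkind L hη h0 h1 m (β := β) (b₀ := b₀) (b₁ := b₁)
    (t := δ * N) (Δ := Δ) (J := J) hBu hB0.le hs0.le hsB (by linarith)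
    (by
      have h2 := mul_le_mul_of_nonneg_right hδ1 (Nat.cast_nonneg N : (0 : ℝ) ≤ N)
      have h3 := mul_le_mul_of_nonneg_right hMu hc₂0
      have h4 : r * N * c₂ = N * (4 / η * c₂ * |κ|) := by rw [hr]; ring
      have h5 : δ * b * N = δ * N * (|b₀| + |b₁|) + 2 * |β| * (δ * N) + δ * N := by
        rw [hb]; ring
      have h6 : 0 ≤ δ * N := by positivity
      have h7 : N * γ = N * (Real.log (partitionFunction (L 0) β) + β * gibbsEnergy (L 0) β +
          (Real.log (partitionFunction (L 1) β) + β * gibbsEnergy (L 1) β)) -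
          N * (Real.log (partitionFunction (L 0) b₀) + b₀ * m 0 +
          (Real.log (partitionFunction (L 1) b₁) + b₁ * m 1)) - N * (4 / η * c₂ * |κ|) := by
        rw [hγ]; ring
      linarith)
    (by
      have h2 : m 0 + m 1 - gibbsEnergy (L 0) β - gibbsEnergy (L 1) β = -κ := by rw [hκ]; ring
      rw [h2]
      rcases hβ with ⟨h3, h4⟩ | ⟨h3, h4⟩
      · rw [abs_of_pos h3] at *
        have h5 := mul_le_mul_of_nonneg_left h4 (Nat.cast_nonneg M : (0 : ℝ) ≤ M)
        linarith
      · rw [abs_of_neg h3] at *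
        have h5 := mul_nonneg (Nat.cast_nonneg M : (0 : ℝ) ≤ M) hm0
        linarith)
    (by
      have h2 : m 0 + m 1 - gibbsEnergy (L 0) β - gibbsEnergy (L 1) β = -κ := by rw [hκ]; ring
      rw [h2]
      rcases hβ with ⟨h3, h4⟩ | ⟨h3, h4⟩
      · rw [abs_of_pos h3] at *
        linarith
      · rw [abs_of_neg h3] at *
        have h5 := mul_le_mul_of_nonneg_left h4 (Nat.cast_nonneg M : (0 : ℝ) ≤ M)
        linarith)
  refine ⟨2 * N + M, kind, δ * N, 6 * Real.exp (-(s * δ / 2) * N), φ, hφ, hφE, by linarith, ?_, ?_⟩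
  · refine le_trans ?_ hNε
    gcongr
  · intro p hp0 hp1 hp2 _
    refine (sum_compl_typicalSet_le hp0 hp1 hp2 hBm hB0.le hs0.le hsB (δ * N)).trans ?_
    rw [Fintype.card_fin, show (2 : ℝ) * ((3 : ℕ) : ℝ) = 6 by norm_num]
    exact mul_le_mul_of_nonneg_left hexp (by norm_num)

/-! ### Qubit levels and non-thermal pairs. -/

section Levels

lemma exists_eigenvalues_two {g : ℝ} {A : Matrix (Fin 2) (Fin 2) ℂ} (hA : A.IsHermitian)
    (h : A = Matrix.diagonal fun i => ((![0, g] i : ℝ) : ℂ)) :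
    ∃ a b : Fin 2, hA.eigenvalues a = 0 ∧ hA.eigenvalues b = g := by
  have h1 := hA.trace_eq_sum_eigenvalues
  have h2 := hA.det_eq_prod_eigenvalues
  rw [Fin.sum_univ_two] at h1
  rw [Fin.prod_univ_two] at h2
  have h3 : hA.eigenvalues 0 + hA.eigenvalues 1 = g := by
    have : A.trace = g := by rw [h]; simp [Matrix.trace, Fin.sum_univ_two]
    rw [this] at h1
    simpa using (congrArg Complex.re h1).symm
  have h4 : hA.eigenvalues 0 * hA.eigenvalues 1 = 0 := by
    have : A.det = 0 := by rw [h]; simp [Fin.prod_univ_two]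
    rw [this] at h2
    simpa using (congrArg Complex.re h2).symm
  rcases mul_eq_zero.1 h4 with h5 | h5
  · exact ⟨0, 1, h5, by linarith⟩
  · exact ⟨1, 0, h5, by linarith⟩

lemma exists_eigenvalues_qubit (g : ℝ) : ∃ a b : Fin (qubit g).dim,
    (qubit g).isHermitian.eigenvalues a = 0 ∧ (qubit g).isHermitian.eigenvalues b = g :=
  exists_eigenvalues_two (qubit g).isHermitian rfl

lemma microstates_qubit_le {e g : ℝ} (hg : 0 ≤ g) (h : (microstates e (qubit g)).Nonempty) :
    0 ≤ e ∧ e ≤ g := by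
  obtain ⟨ρ, hρ, he⟩ := h
  have h2 : e = (ρ (1 : Fin 2) (1 : Fin 2)).re * g := he.symm.trans (meanEnergy_two ρ g)
  have h3 : ∑ i : Fin 2, (ρ i i).re = 1 := hρ.sum_diag
  rw [Fin.sum_univ_two] at h3
  have h4 : 0 ≤ (ρ (0 : Fin 2) (0 : Fin 2)).re := hρ.diag_nonneg (0 : Fin 2)
  have h5 : 0 ≤ (ρ (1 : Fin 2) (1 : Fin 2)).re := hρ.diag_nonneg (1 : Fin 2)
  rw [h2]
  exact ⟨mul_nonneg h5 hg, mul_le_of_le_one_left hg (by linarith)⟩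

/-- The order of `eigenvalues` is not known, so the energy is computed as a basis-independent
thermal energy and re-evaluated in the standard basis. -/
lemma gibbsEnergy_qubit (g β : ℝ) : gibbsEnergy (qubit g).isHermitian.eigenvalues β =
    Real.exp (-β * g) * g / (1 + Real.exp (-β * g)) := by
  have h1 := thermalEnergy_coe (H := qubit g) (qubit g).isHermitian.eigenvectorUnitary.2
    (eq_eigenvectorUnitary_conj (qubit g).isHermitian) β
  have h2 := thermalEnergy_coe (H := qubit g) (V := 1) (one_mem _)
    (l := fun i : Fin 2 => (![0, g] : Fin 2 → ℝ) i)
    (by rw [one_mul, Matrix.conjTranspose_one, mul_one]; rfl) β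
  rw [← h1, h2]
  show gibbsEnergy (fun i : Fin 2 => (![0, g] : Fin 2 → ℝ) i) β = _
  simp only [gibbsEnergy, gibbsWeight, partitionFunction, Fin.sum_univ_two, Matrix.cons_val_zero,
    Matrix.cons_val_one, mul_zero, zero_add, Real.exp_zero]
  ring

lemma groundEnergy_le_of_mem {e : ℝ} {H : Hamiltonian} (h : (microstates e H).Nonempty) :
    groundEnergy H ≤ e := by
  obtain ⟨ρ, hρ, rfl⟩ := h
  exact le_meanEnergy_of_le hρ H.isHermitian.eigenvectorUnitary.2
    (eq_eigenvectorUnitary_conj H.isHermitian) fun i => ciInf_le (Set.finite_range _).bddBelow i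

lemma le_topEnergy_of_mem {e : ℝ} {H : Hamiltonian} (h : (microstates e H).Nonempty) :
    e ≤ topEnergy H := by
  obtain ⟨ρ, hρ, rfl⟩ := h
  exact meanEnergy_le_of_le hρ H.isHermitian.eigenvectorUnitary.2
    (eq_eigenvectorUnitary_conj H.isHermitian) fun i => le_ciSup (Set.finite_range _).bddAbove i

/-- If the assignment `f` is not thermal, then some Hamiltonian does not have a common temperature
with the two-level system. -/
lemma exists_no_common_temperature {f : Hamiltonian → ℝ}
    (hf : ∀ H, (microstates (f H) H).Nonempty)
    (hnt : ¬ ∃ β : EReal, ∀ H, f H = thermalEnergy β H) :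
    ∃ H : Hamiltonian,
      (∃ i j, (qubit 1).isHermitian.eigenvalues i + H.isHermitian.eigenvalues j <
        f (qubit 1) + f H) ∧
      (∃ i j, f (qubit 1) + f H <
        (qubit 1).isHermitian.eigenvalues i + H.isHermitian.eigenvalues j) ∧
      ∀ β, gibbsEnergy (qubit 1).isHermitian.eigenvalues β = f (qubit 1) →
        gibbsEnergy H.isHermitian.eigenvalues β ≠ f H := by
  obtain ⟨a, b, ha, hb⟩ := exists_eigenvalues_qubit 1
  obtain ⟨hp0, hp1⟩ := microstates_qubit_le zero_le_one (hf (qubit 1))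
  push Not at hnt
  have hground : ∀ H : Hamiltonian, ∃ j, H.isHermitian.eigenvalues j = groundEnergy H := fun H =>
    exists_eq_ciInf_of_finite
  have htop : ∀ H : Hamiltonian, ∃ j, H.isHermitian.eigenvalues j = topEnergy H := fun H =>
    exists_eq_ciSup_of_finite
  -- The qubit energy singles out one candidate: `⊤` at `0`, `⊥` at `1`, and `β₀` otherwise.
  -- Non-thermality at this candidate supplies `H`. In the extreme cases no real `β` fits the qubit,
  -- and the strictness of `hlow` or `hup` that the qubit lacks comes from `H`.
  rcases hp0.eq_or_lt with h0 | h0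
  · obtain ⟨H, hH⟩ := hnt ⊤
    rw [thermalEnergy, if_pos rfl] at hH
    have h1 := lt_of_le_of_ne (groundEnergy_le_of_mem (hf H)) hH.symm
    have h2 := le_topEnergy_of_mem (hf H)
    obtain ⟨j, hj⟩ := hground H
    obtain ⟨k, hk⟩ := htop H
    refine ⟨H, ⟨a, j, by linarith⟩, ⟨b, k, by linarith⟩, fun β hβ => ?_⟩
    rw [gibbsEnergy_qubit, ← h0] at hβ
    have := Real.exp_pos (-β * 1)
    have h3 : 0 < Real.exp (-β * 1) * 1 / (1 + Real.exp (-β * 1)) := by positivity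
    linarith
  rcases hp1.eq_or_lt with h1 | h1
  · obtain ⟨H, hH⟩ := hnt ⊥
    rw [thermalEnergy, if_neg bot_ne_top, if_pos rfl] at hH
    have h2 := groundEnergy_le_of_mem (hf H)
    have h3 := lt_of_le_of_ne (le_topEnergy_of_mem (hf H)) hH
    obtain ⟨j, hj⟩ := hground H
    obtain ⟨k, hk⟩ := htop H
    refine ⟨H, ⟨a, j, by linarith⟩, ⟨b, k, by linarith⟩, fun β hβ => ?_⟩
    have := Real.exp_pos (-β * 1)
    rw [gibbsEnergy_qubit, h1, div_eq_iff (by positivity)] at hβ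
    linarith
  · set p := f (qubit 1) with hp
    set β₀ := Real.log ((1 - p) / p) with hβ₀
    obtain ⟨H, hH⟩ := hnt (β₀ : EReal)
    rw [thermalEnergy_coe H.isHermitian.eigenvectorUnitary.2
      (eq_eigenvectorUnitary_conj H.isHermitian)] at hH
    have h2 := groundEnergy_le_of_mem (hf H)
    have h3 := le_topEnergy_of_mem (hf H)
    obtain ⟨j, hj⟩ := hground H
    obtain ⟨k, hk⟩ := htop H
    refine ⟨H, ⟨a, j, by linarith⟩, ⟨b, k, by linarith⟩, fun β hβ => ?_⟩
    have h4 : β = β₀ := by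
      refine (gibbsEnergy_strictAnti ⟨a, b, by rw [ha, hb]; exact zero_ne_one⟩).injective
        (hβ.trans ?_)
      have h5 : 0 < 1 - p := by linarith
      rw [gibbsEnergy_qubit, mul_one, mul_one, Real.exp_neg, hβ₀, Real.exp_log (by positivity)]
      field_simp
      ring
    rw [h4]
    exact hH.symm

end Levels

/-! ### Non-thermal assignments: every transition and all work. -/

/-- If `f` does not assign a common temperature to the first two of three Hamiltonians, and if the
third one has two levels at a small distance, then an environment of these three kinds of systems
allows to prepare any state in any system, while its energy changes by a prescribed amount. -/
lemma exists_environment_of_levels {f : Hamiltonian → ℝ} (K : Fin 3 → Hamiltonian)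
    (L : ∀ g, Fin (K g).dim → ℝ) (hLK : ∀ g, L g = (K g).isHermitian.eigenvalues)
    {a₀ a₁ : ∀ g, Fin (K g).dim} {ε : ℝ} (hε : 0 < ε) (h0 : L 2 (a₀ 2) = 0)
    (h1 : L 2 (a₁ 2) = ε / 2) (hm0 : 0 ≤ f (K 2)) (hm1 : f (K 2) ≤ ε / 2)
    (hL : ∃ i j, L 0 i ≠ L 0 j)
    (hlow : ∃ i j, L 0 i + L 1 j < f (K 0) + f (K 1))
    (hup : ∃ i j, f (K 0) + f (K 1) < L 0 i + L 1 j)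
    (hne : ∀ β, gibbsEnergy (L 0) β = f (K 0) → gibbsEnergy (L 1) β ≠ f (K 1))
    {ι : Type*} [Fintype ι] [DecidableEq ι] [Nonempty ι] (Δ : ℝ)
    {ρf : Matrix ι ι ℂ} (hρf : IsDensity ρf) :
    ∃ (N : ℕ) (E : Fin N → Hamiltonian), ∃ U ∈ Matrix.unitaryGroup (ι × EnvIdx E) ℂ,
      ∀ ρ : Matrix ι ι ℂ, IsDensity ρ →
      ∀ σ : ∀ i, Matrix (Fin (E i).dim) (Fin (E i).dim) ℂ,
        (∀ i, σ i ∈ microstates (f (E i)) (E i)) →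
        (∀ a b, ‖traceEnv (U * (ρ ⊗ₖ tensor σ) * Uᴴ) a b - ρf a b‖ ≤ ε) ∧
        |meanEnergy (U * (ρ ⊗ₖ tensor σ) * Uᴴ) ((1 : Matrix ι ι ℂ) ⊗ₖ envHamiltonian E) -
          meanEnergy (tensor σ) (envHamiltonian E) - Δ| ≤ ε := by
  set B : ℝ := ∑ g, ∑ x, |L g x| with hB
  have hBL : ∀ g x, |L g x| ≤ B := fun g x =>
    (Finset.single_le_sum (f := fun x => |L g x|) (fun _ _ => abs_nonneg _)
      (Finset.mem_univ x)).trans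
    (Finset.single_le_sum (f := fun g => ∑ x, |L g x|)
      (fun _ _ => Finset.sum_nonneg fun _ _ => abs_nonneg _) (Finset.mem_univ g))
  have hB0 : 0 ≤ B := Finset.sum_nonneg fun _ _ => Finset.sum_nonneg fun _ _ => abs_nonneg _
  set R : ℝ := ∑ a, ∑ b, ‖ρf a b‖ with hR
  have hRρ : ∀ a b, ‖ρf a b‖ ≤ R := fun a b =>
    (Finset.single_le_sum (f := fun b => ‖ρf a b‖) (fun _ _ => norm_nonneg _)
      (Finset.mem_univ b)).trans
    (Finset.single_le_sum (f := fun a => ∑ b, ‖ρf a b‖)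
      (fun _ _ => Finset.sum_nonneg fun _ _ => norm_nonneg _) (Finset.mem_univ a))
  have hR0 : 0 ≤ R := Finset.sum_nonneg fun _ _ => Finset.sum_nonneg fun _ _ => norm_nonneg _
  -- One factor of the label set `ι × ι` records the initial system level, which unitarity forbids
  -- to forget; the other purifies `ρf`. The constant dominates both `2 + ‖ρf a b‖` and, after
  -- multiplication by `n + 1`, the energy term `3 * (n * B) + |Δ|`.
  obtain ⟨n, kind, t, τ, φ, hφ, hφE, hτ1, hτ, hp⟩ := exists_typical_transition L
    (half_pos hε) h0 h1 (fun g => f (K g)) hm0 hm1 hL hlow hup hne (ι × ι) Δ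
    (2 + R + 3 * B + |Δ|) (ε / 2) (by positivity) (half_pos hε)
  obtain rfl : L = fun g => (K g).isHermitian.eigenvalues := funext hLK
  set E : Fin n → Hamiltonian := fun i => K (kind i) with hE
  have hC : ∀ x : EnvIdx E, |envEnergy E x| ≤ n * B := by
    intro x
    refine (Finset.abs_sum_le_sum_abs _ _).trans ?_
    refine (Finset.sum_le_sum fun i _ => hBL (kind i) (x i)).trans_eq ?_
    rw [Finset.sum_const, Finset.card_univ, Fintype.card_fin, nsmul_eq_mul]
  obtain ⟨U, hU, h⟩ := exists_unitary_shift (ι := ι) (envBasis_unitary E)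
    (envHamiltonian_eq_envBasis E) hC (typicalSet (A := fun g => Fin (K g).dim) kind _ (fun g => f (K g)) t)
    (φ := fun i k => φ (i.1, k) i.2) (Δ := Δ) (ε := ε / 2)
    (by
      intro i j hi hj k k' he
      obtain ⟨h1, h2⟩ := hφ _ _ _ _ hi hj he
      rw [Prod.mk.injEq] at h1
      exact ⟨Prod.ext h1.1 h2, h1.2⟩)
    (by positivity) (fun i hi k => hφE (i.1, k) i.2 hi) hρf
  refine ⟨n, E, U, hU, fun ρ hρ σ hσ => ?_⟩
  have hσd : ∀ i, IsDensity (σ i) := fun i => (hσ i).1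
  set V : ∀ i, Matrix (Fin (E i).dim) (Fin (E i).dim) ℂ := fun i =>
    ((E i).isHermitian.eigenvectorUnitary : Matrix (Fin (E i).dim) (Fin (E i).dim) ℂ) with hV
  have hVu : ∀ i, V i ∈ Matrix.unitaryGroup (Fin (E i).dim) ℂ := fun i =>
    (E i).isHermitian.eigenvectorUnitary.2
  have htail := hp (fun i x => (((V i)ᴴ * σ i * V i) x x).re)
    (fun i x => ((hσd i).conj' (hVu i)).diag_nonneg x)
    (fun i => ((hσd i).conj' (hVu i)).sum_diag)
    (fun i => by
      refine Eq.trans ?_ (hσ i).2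
      exact (meanEnergy_conj_diagonal (σ i) (V i) (E i).isHermitian.eigenvalues).symm.trans
        (congrArg (meanEnergy (σ i)) (eq_eigenvectorUnitary_conj (E i).isHermitian).symm))
  obtain ⟨h1, h2⟩ := h ρ hρ (tensor σ) (IsDensity.tensor hσd) τ
    (by
      refine le_trans (le_of_eq ?_) htail
      exact Finset.sum_congr rfl fun x _ => tensor_conj_apply_re hσd x) hτ1
  have hn : (0 : ℝ) ≤ n := Nat.cast_nonneg n
  constructor
  · intro a b
    refine (h1 a b).trans ?_
    have h3 : (2 + ‖ρf a b‖) * √τ ≤ (2 + R + 3 * B + |Δ|) * (n + 1) * √τ := by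
      refine mul_le_mul_of_nonneg_right ?_ (Real.sqrt_nonneg _)
      nlinarith [hRρ a b, mul_nonneg hR0 hn, mul_nonneg hB0 hn, mul_nonneg (abs_nonneg Δ) hn,
        abs_nonneg Δ]
    linarith
  · refine h2.trans ?_
    have h3 : (3 * (n * B) + |Δ|) * √τ ≤ (2 + R + 3 * B + |Δ|) * (n + 1) * √τ := by
      refine mul_le_mul_of_nonneg_right ?_ (Real.sqrt_nonneg _)
      nlinarith [mul_nonneg hR0 hn, mul_nonneg hB0 hn, mul_nonneg (abs_nonneg Δ) hn,
        abs_nonneg Δ]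
    linarith

/-- A non-thermal assignment allows to prepare any state in any system, while the energy of the
environment changes by any prescribed amount. -/
lemma exists_environment {f : Hamiltonian → ℝ}
    (hf : ∀ H, (microstates (f H) H).Nonempty)
    (hnt : ¬ ∃ β : EReal, ∀ H, f H = thermalEnergy β H)
    {ι : Type*} [Fintype ι] [DecidableEq ι] [Nonempty ι] (Δ : ℝ) {ε : ℝ} (hε : 0 < ε)
    {ρf : Matrix ι ι ℂ} (hρf : IsDensity ρf) :
    ∃ (N : ℕ) (E : Fin N → Hamiltonian), ∃ U ∈ Matrix.unitaryGroup (ι × EnvIdx E) ℂ,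
      ∀ ρ : Matrix ι ι ℂ, IsDensity ρ →
      ∀ σ : ∀ i, Matrix (Fin (E i).dim) (Fin (E i).dim) ℂ,
        (∀ i, σ i ∈ microstates (f (E i)) (E i)) →
        (∀ a b, ‖traceEnv (U * (ρ ⊗ₖ tensor σ) * Uᴴ) a b - ρf a b‖ ≤ ε) ∧
        |meanEnergy (U * (ρ ⊗ₖ tensor σ) * Uᴴ) ((1 : Matrix ι ι ℂ) ⊗ₖ envHamiltonian E) -
          meanEnergy (tensor σ) (envHamiltonian E) - Δ| ≤ ε := by
  obtain ⟨H, hlow, hup, hne⟩ := exists_no_common_temperature hf hnt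
  obtain ⟨a, b, ha, hb⟩ := exists_eigenvalues_qubit (ε / 2)
  obtain ⟨c, d, hc, hd⟩ := exists_eigenvalues_qubit 1
  obtain ⟨hm0, hm1⟩ := microstates_qubit_le (half_pos hε).le (hf (qubit (ε / 2)))
  have hupd : ∀ (K : Fin 3 → Hamiltonian) (x : Fin (K 2).dim),
      ∃ a₀ : ∀ g, Fin (K g).dim, a₀ 2 = x := fun K x =>
    ⟨Function.update (fun g => ⟨0, (K g).dim_pos⟩) 2 x, by simp⟩
  obtain ⟨a₀, ha₀⟩ := hupd ![qubit 1, H, qubit (ε / 2)] a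
  obtain ⟨a₁, ha₁⟩ := hupd ![qubit 1, H, qubit (ε / 2)] b
  refine exists_environment_of_levels ![qubit 1, H, qubit (ε / 2)] _ (fun _ => rfl)
    (a₀ := a₀) (a₁ := a₁) hε (by rw [ha₀]; exact ha) (by rw [ha₁]; exact hb) hm0 hm1
    ⟨c, d, ?_⟩ hlow hup hne Δ hρf
  show (qubit 1).isHermitian.eigenvalues c ≠ (qubit 1).isHermitian.eigenvalues d
  rw [hc, hd]
  exact zero_ne_one

lemma everyTransitionPossible_of_not_thermal {f : Hamiltonian → ℝ}
    (hf : ∀ H, (microstates (f H) H).Nonempty)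
    (hnt : ¬ ∃ β : EReal, ∀ H, f H = thermalEnergy β H) : EveryTransitionPossible f := by
  intro e H ρf hρf ε hε ε' hε'
  set S : ℝ := ∑ a, ∑ b, ‖H.op a b‖ with hS
  have hS0 : 0 ≤ S := Finset.sum_nonneg fun _ _ => Finset.sum_nonneg fun _ _ => norm_nonneg _
  set δ := min (ε / ((Fintype.card (Fin H.dim) : ℝ) ^ 2 + 1)) (ε' / (S + 1)) with hδ
  have hδ0 : 0 < δ := lt_min (by positivity) (by positivity)
  have hδ1 : (Fintype.card (Fin H.dim) : ℝ) ^ 2 * δ ≤ ε := by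
    have h1 : δ ≤ ε / ((Fintype.card (Fin H.dim) : ℝ) ^ 2 + 1) := min_le_left _ _
    rw [le_div_iff₀ (by positivity)] at h1
    linarith
  have hδ2 : (S + 1) * δ ≤ ε' := by
    have h1 : δ ≤ ε' / (S + 1) := min_le_right _ _
    rw [le_div_iff₀ (by positivity)] at h1
    linarith
  -- The environment takes up exactly the energy that the system loses in going from mean energy `e`
  -- to `ρf`.
  obtain ⟨N, E, U, hU, h⟩ := exists_environment hf hnt (ι := Fin H.dim)
    (e - meanEnergy ρf H.op) hδ0 hρf
  refine ⟨N, E, U, hU, fun ρ hρ σ hσ => ?_⟩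
  obtain ⟨h1, h2⟩ := h ρ hρ.1 σ hσ
  refine ⟨(traceNorm_le hδ0.le fun a b => h1 a b).trans hδ1, ?_⟩
  rw [meanEnergy_totalHamiltonian, meanEnergy_totalHamiltonian,
    traceEnv_kronecker _ (IsDensity.tensor fun i => (hσ i).1), hρ.2, meanEnergy_kronecker hρ.1]
  set X := traceEnv (U * (ρ ⊗ₖ tensor σ) * Uᴴ)
  have h3 : |meanEnergy X H.op - meanEnergy ρf H.op| ≤ S * δ := by
    have h4 : meanEnergy X H.op - meanEnergy ρf H.op = ((X - ρf) * H.op).trace.re := by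
      simp [meanEnergy, Matrix.sub_mul, Matrix.trace_sub]
    rw [h4]
    refine (Complex.abs_re_le_norm _).trans ?_
    simp only [Matrix.trace, Matrix.diag_apply, Matrix.mul_apply]
    rw [Finset.sum_comm, hS, Finset.sum_mul]
    refine (norm_sum_le _ _).trans (Finset.sum_le_sum fun a _ => ?_)
    rw [Finset.sum_mul]
    refine (norm_sum_le _ _).trans (Finset.sum_le_sum fun b _ => ?_)
    rw [norm_mul, mul_comm]
    exact mul_le_mul_of_nonneg_left (h1 b a) (norm_nonneg _)
  rw [abs_le] at h2 h3 ⊢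
  constructor <;> linarith [h2.1, h2.2, h3.1, h3.2]

lemma workExtractable_of_not_thermal {f : Hamiltonian → ℝ}
    (hf : ∀ H, (microstates (f H) H).Nonempty)
    (hnt : ¬ ∃ β : EReal, ∀ H, f H = thermalEnergy β H) (W : ℝ) : WorkExtractable f W := by
  have h1 : IsDensity (1 : Matrix Unit Unit ℂ) := ⟨Matrix.PosSemidef.one, by simp⟩
  -- A one-dimensional system leaves only the energy shift; the surplus `1` absorbs the tolerance `ε
  -- = 1`.
  obtain ⟨N, E, U, hU, h⟩ := exists_environment hf hnt (ι := Unit) (-(W + 1)) one_pos h1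
  set e : EnvIdx E ≃ Unit × EnvIdx E := (Equiv.punitProd (EnvIdx E)).symm with he
  have hsub : ∀ A : Matrix (EnvIdx E) (EnvIdx E) ℂ,
      A = ((1 : Matrix Unit Unit ℂ) ⊗ₖ A).submatrix e e := by
    intro A
    ext x y
    simp [he]
  refine ⟨N, E, U.submatrix e e, ?_, fun σ hσ => ?_⟩
  · rw [Matrix.mem_unitaryGroup_iff, Matrix.star_eq_conjTranspose, Matrix.conjTranspose_submatrix,
      Matrix.submatrix_mul_equiv, mul_conjTranspose_self_of_unitary hU, Matrix.submatrix_one_equiv]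
  · have h2 := (abs_le.1 (h 1 h1 σ hσ).2).2
    have h3 : meanEnergy (U.submatrix e e * tensor σ * (U.submatrix e e)ᴴ) (envHamiltonian E) =
        meanEnergy (U * ((1 : Matrix Unit Unit ℂ) ⊗ₖ tensor σ) * Uᴴ)
          ((1 : Matrix Unit Unit ℂ) ⊗ₖ envHamiltonian E) := by
      unfold meanEnergy
      rw [hsub (tensor σ), hsub (envHamiltonian E), Matrix.conjTranspose_submatrix,
        Matrix.submatrix_mul_equiv, Matrix.submatrix_mul_equiv, Matrix.submatrix_mul_equiv,
        ← hsub, ← hsub]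
      congr 1
      exact Equiv.sum_comp e fun i => (U * ((1 : Matrix Unit Unit ℂ) ⊗ₖ tensor σ) * Uᴴ *
          (1 : Matrix Unit Unit ℂ) ⊗ₖ envHamiltonian E) i i
    rw [h3]
    linarith

end Thermo

theorem mainTheorem6 (f : Thermo.Hamiltonian → ℝ)
    (hf : ∀ H, (Thermo.microstates (f H) H).Nonempty) :
    ((¬ ∃ β : EReal, ∀ H, f H = Thermo.thermalEnergy β H) →
      (∀ W : ℝ, Thermo.WorkExtractable f W) ∧ Thermo.EveryTransitionPossible f) ∧
    (∀ β : EReal, (∀ H, f H = Thermo.thermalEnergy β H) →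
      ¬ Thermo.EveryTransitionPossible f ∧
      (0 ≤ β → ∀ W : ℝ, 0 < W → ¬ Thermo.WorkExtractable f W)) :=
  ⟨fun hnt => ⟨Thermo.workExtractable_of_not_thermal hf hnt,
    Thermo.everyTransitionPossible_of_not_thermal hf hnt⟩,
  fun _ h => ⟨Thermo.not_everyTransitionPossible_of_thermal hf h,
    fun hβ _ hW => Thermo.not_workExtractable_of_thermal hf h hβ hW⟩⟩
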